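/- **Theorem (pressureless gas dynamics with delta Riemann data).** Consider $$\partial_t\rho+\partial_x(\rho u)=0,\qquad \partial_t(\rho u)+\partial_x(\rho u^2)=0,\qquad(1)$$ with energy pair $\eta=\tfrac12\rho u^2$, $Q=\tfrac12\rho u^3$, and the initial data $$(\rho,u)(x,0)=\begin{cases}(\rho_0,u_0),&x<0\\(\rho_1,u_1),&x>0\end{cases}+(\xi_\delta,0)\,\delta,\qquad \rho_0,\rho_1,\xi_\delta>0,\ u_0,u_1\in\mathbb R.\qquad(2)$$ *Admissible solutions.* A solution is a family of locally finite measures $\rho(t)$, $t\ge 0$, with a uniformly bounded velocity $u(t)$ (determined $\rho(t)$-a.e.), satisfying (1) and the initial conditions for $\rho$ and $\rho u$ in the sense of distributions. It is admissible if it consists of finitely many continuous, ordered wave fronts $x=c_i(t)$ separating constant states or vacuum, where a front may carry a mass $\xi_i(t)\delta(x-c_i(t))$, $\xi_i\geq 0$, moving with velocity $c_i'(t)$ (the limit of a shadow wave as its width $\varepsilon$ tends to $0$); outside a finite set of interaction times the fronts are $C^1$ and neither meet nor separate and are overcompressive, $u_{\rm left}\ge c_i'\ge u_{\rm right}$ (for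 the sides that are not vacuum); and the energy inequality $\partial_t\eta+\partial_xQ\le0$ holds in the sense of distributions on every time interval $[s,t]$, $0\le s\le t$, including the initial time and interaction times as values of $s$. *Approximate data.* For $\mu>0$ and $w\in\mathbb R$ let $$U_{\mu,w}(x,0)=\begin{cases}(\rho_0,u_0),&x<-\mu/2\\(\xi_\delta/\mu,\,w),&-\mu/2<x<\mu/2\\(\rho_1,u_1),&x>\mu/2.\end{cases}$$ *Backward energy condition.* Fix $L>0$ and let $H_{[-L,L]}(t)$ be the total energy in $[-L,L]$ at time $t$ (a point mass $\xi$ of velocity $u$ contributes $\tfrac12\xi u^2$). An admissible solution with the data $U_{\mu,w}(\cdot,0)$ is *selected* for $\mu$ if $\frac{d}{dt}H_{[-L,L]}(0+)$ is maximal (least energy dissipation) among all admissible solutions with data $U_{\mu,\tilde w}(\cdot,0)$, $\tilde w\in\mathbb R$, and if among all maximizers its initial energy $H_{[-L,L]}(0)$ is minimal. An admissible solution $U$ of (1) with data (2) (where the initial momentum at the origin is $w\,\xi_\delta\,\delta$ for some $w\in\mathbb R$) *satisfies the backward energy condition* if there are $w(\mu)\in\mathbb R$ and admissible solutions $V^\mu$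 with data $U_{\mu,w(\mu)}(\cdot,0)$ that are selected for all sufficiently small $\mu>0$, such that the density and momentum of $V^\mu$ converge, in the sense of distributions in $x$ for every $t\ge0$, to those of $U$ as $\mu\to0+$. *Claim.* For every $L>0$ the solution satisfying the backward energy condition exists and is unique (up to values of the velocity on $\rho(t)$-null sets), and it is the following. 1. If $u_0>u_1$, it is the delta shock $$U(x,t)=\begin{cases}(\rho_0,u_0),&x<yt\\(\rho_1,u_1),&x>yt\end{cases}+(\xi_\delta+\sqrt{\rho_0\rho_1}\,(u_0-u_1)\,t,\,0)\,\delta(x-yt),\qquad y=\frac{\sqrt{\rho_0}\,u_0+\sqrt{\rho_1}\,u_1}{\sqrt{\rho_0}+\sqrt{\rho_1}},$$ where the point mass moves with velocity $y$. 2. If $u_0\le u_1$, it is $$U(x,t)=\begin{cases}(\rho_0,u_0),&x<u_0t\\(0,x/t),&u_0t<x<u_1t,\ x\neq u_\delta t\\(\rho_1,u_1),&x>u_1t\end{cases}+(\xi_\delta,0)\,\delta(x-u_\delta t),$$ where the point mass moves with velocity $$u_\delta=\begin{cases}\min\{u_0,u_1\},&u_0,u_1\ge0\\ \max\{u_0,u_1\},&u_0,u_1\le0\\0,&u_0u_1<0.\end{cases}$$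 Here $u_\delta\in[u_0,u_1]$, and for every $\mu>0$ it minimizes over $w\in[u_0,u_1]$ the total energy in $[-L,L]$ of the initial data $U_{\mu,w}(\cdot,0)$. This solution locally conserves energy: $\partial_t\eta+\partial_xQ=0$ in the sense of distributions. -/

import Mathlib

open MeasureTheory Filter Topology Set
open scoped ContDiff

/-- A state of a pressureless gas on the line for every time: at time `t` the mass distribution
is the measure `density t` (delta functions are allowed) and the matter at `x` has velocity
`velocity t x`, which is meaningful up to `density t`-null sets only (so it carries no information
in a vacuum).  Only times `t ≥ 0` are ever used. -/
structure GasFlow where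
  density : ℝ → Measure ℝ
  velocity : ℝ → ℝ → ℝ

/-- Test functions of the space variable. -/
def IsTestFunction (φ : ℝ → ℝ) : Prop := ContDiff ℝ ∞ φ ∧ HasCompactSupport φ

namespace GasFlow

/-- `⟨ρ uᵏ, φ⟩` at time `t`: mass, momentum, twice the energy and twice the energy flux, for
`k = 0, 1, 2, 3`. -/
noncomputable def moment (U : GasFlow) (k : ℕ) (φ : ℝ → ℝ) (t : ℝ) : ℝ :=
  ∫ x, φ x * U.velocity t x ^ k ∂U.density t

/-- The two flows are the same for `t ≥ 0`: same density, and same velocity wherever there is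
matter. -/
def Equiv (U V : GasFlow) : Prop :=
  ∀ t, 0 ≤ t → U.density t = V.density t ∧ U.velocity t =ᵐ[U.density t] V.velocity t

/-- `U` is a weak (measure) solution of
`∂ₜ ρ + ∂ₓ (ρ u) = 0`, `∂ₜ (ρ u) + ∂ₓ (ρ u²) = 0`
with the initial density `R` and the initial momentum `v • R`.  Both equations are tested on
arbitrary time intervals `[s, t]`. -/
structure IsWeakSolution (U : GasFlow) (R : Measure ℝ) (v : ℝ → ℝ) : Prop where
  density_zero : U.density 0 = R
  velocity_zero : U.velocity 0 =ᵐ[R] v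
  locallyFinite : ∀ t, 0 ≤ t → IsLocallyFiniteMeasure (U.density t)
  measurable : ∀ t, 0 ≤ t → AEMeasurable (U.velocity t) (U.density t)
  bounded : ∃ K : ℝ, ∀ t, 0 ≤ t → ∀ᵐ x ∂U.density t, |U.velocity t x| ≤ K
  mass : ∀ φ, IsTestFunction φ → ∀ s t, 0 ≤ s → s ≤ t →
    IntervalIntegrable (U.moment 1 (deriv φ)) volume s t ∧
    U.moment 0 φ t - U.moment 0 φ s = ∫ τ in s..t, U.moment 1 (deriv φ) τ
  momentum : ∀ φ, IsTestFunction φ → ∀ s t, 0 ≤ s → s ≤ t →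
    IntervalIntegrable (U.moment 2 (deriv φ)) volume s t ∧
    U.moment 1 φ t - U.moment 1 φ s = ∫ τ in s..t, U.moment 2 (deriv φ) τ

/-- `∂ₜ η + ∂ₓ Q ≤ 0` for the energy pair `η = ρ u² / 2`, `Q = ρ u³ / 2`, tested on every time
interval `[s, t]`, `0 ≤ s ≤ t`.  The starting time `s` may be `0` or a time of interaction, so
that the solution after an interaction is also an energy admissible solution of the initial value
problem that is posed at that time. -/
def EnergyAdmissible (U : GasFlow) : Prop :=
  ∀ φ, IsTestFunction φ → (∀ x, 0 ≤ φ x) → ∀ s t, 0 ≤ s → s ≤ t →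
    IntervalIntegrable (U.moment 3 (deriv φ)) volume s t ∧
    1 / 2 * U.moment 2 φ t - 1 / 2 * U.moment 2 φ s
      ≤ ∫ τ in s..t, 1 / 2 * U.moment 3 (deriv φ) τ

/-- `∂ₜ η + ∂ₓ Q = 0` in the sense of distributions, for the same energy pair. -/
def LocallyConservesEnergy (U : GasFlow) : Prop :=
  ∀ φ, IsTestFunction φ → ∀ s t, 0 ≤ s → s ≤ t →
    IntervalIntegrable (U.moment 3 (deriv φ)) volume s t ∧
    1 / 2 * U.moment 2 φ t - 1 / 2 * U.moment 2 φ s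
      = ∫ τ in s..t, 1 / 2 * U.moment 3 (deriv φ) τ

/-- The total energy `H_{[-L,L]}(t)`.  A delta function of mass `ξ` and velocity `u` contributes
`ξ u² / 2`. -/
noncomputable def energyOn (U : GasFlow) (L t : ℝ) : ℝ :=
  ∫ x in Icc (-L) L, 1 / 2 * U.velocity t x ^ 2 ∂U.density t

/-- Distributional convergence of density and momentum as `μ → 0+`, at every time. -/
def ConvergesTo (V : ℝ → GasFlow) (U : GasFlow) : Prop :=
  ∀ t, 0 ≤ t → ∀ φ, IsTestFunction φ →
    Tendsto (fun μ => (V μ).moment 0 φ t) (𝓝[>] 0) (𝓝 (U.moment 0 φ t)) ∧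
    Tendsto (fun μ => (V μ).moment 1 φ t) (𝓝[>] 0) (𝓝 (U.moment 1 φ t))

end GasFlow

/-- A pattern of `N` ordered wave fronts separating `N + 1` constant states.  A state of density
`0` is a vacuum.  A front of strength `0` is an ordinary discontinuity, a front of positive
strength carries a delta function (the limit of a shadow wave).  Fronts may coincide, and then
the states between them are absent. -/
structure WavePattern (N : ℕ) where
  front : Fin N → ℝ → ℝ
  strength : Fin N → ℝ → ℝ
  stateDensity : Fin (N + 1) → ℝ
  stateVelocity : Fin (N + 1) → ℝ
  interactionTimes : Finset ℝ

namespace WavePattern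

variable {N : ℕ}

/-- The region between the front number `j - 1` and the front number `j` (unbounded at the two
ends). -/
def gap (P : WavePattern N) (j : Fin (N + 1)) (t : ℝ) : Set ℝ :=
  {x | ∀ i : Fin N, ((i : ℕ) < j → P.front i t < x) ∧ ((j : ℕ) ≤ i → x < P.front i t)}

/-- The flow `U` consists of the waves of the pattern `P`.  Between the (finitely many)
interaction times fronts are smooth and neither meet nor separate. -/
structure Represents (P : WavePattern N) (U : GasFlow) : Prop where
  ordered : ∀ t, 0 ≤ t → Monotone fun i => P.front i t
  continuous : ∀ i, ContinuousOn (P.front i) (Ici 0)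
  smooth : ∀ i t, 0 < t → t ∉ P.interactionTimes → ContDiffAt ℝ 1 (P.front i) t
  noInteraction : ∀ s t, 0 < s → s ≤ t → (∀ r ∈ P.interactionTimes, r ∉ Icc s t) →
    ∀ i k, P.front i s = P.front k s ↔ P.front i t = P.front k t
  strength_nonneg : ∀ i t, 0 ≤ t → 0 ≤ P.strength i t
  stateDensity_nonneg : ∀ j, 0 ≤ P.stateDensity j
  density_eq : ∀ t, 0 ≤ t → U.density t =
    ∑ j, ENNReal.ofReal (P.stateDensity j) • volume.restrict (P.gap j t) +
    ∑ i, ENNReal.ofReal (P.strength i t) • Measure.dirac (P.front i t)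
  velocity_state : ∀ t, 0 ≤ t → ∀ j, 0 < P.stateDensity j →
    ∀ᵐ x ∂volume.restrict (P.gap j t), U.velocity t x = P.stateVelocity j
  velocity_front : ∀ i t, 0 < t → t ∉ P.interactionTimes → 0 < P.strength i t →
    U.velocity t (P.front i t) = deriv (P.front i) t

/-- Overcompressibility: `u_left ≥ c' ≥ u_right` at every front `c`, for those of its two sides
that are not a vacuum (both characteristic speeds of the system equal `u`).  Contact
discontinuities satisfy it with equality. -/
def Overcompressive (P : WavePattern N) : Prop :=
  ∀ t, 0 < t → t ∉ P.interactionTimes →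
    ∀ j, 0 < P.stateDensity j → (P.gap j t).Nonempty → ∀ i : Fin N,
      ((i : ℕ) + 1 = j → P.stateVelocity j ≤ deriv (P.front i) t) ∧
      ((i : ℕ) = j → deriv (P.front i) t ≤ P.stateVelocity j)

end WavePattern

/-- Admissible solutions: weak solutions made of finitely many waves, overcompressive and energy
admissible. -/
def IsAdmissibleSolution (U : GasFlow) (R : Measure ℝ) (v : ℝ → ℝ) : Prop :=
  U.IsWeakSolution R v ∧ U.EnergyAdmissible ∧
    ∃ (N : ℕ) (P : WavePattern N), P.Represents U ∧ P.Overcompressive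

/-- Delta Riemann data: `(ρ₀, u₀)` for `x < 0`, `(ρ₁, u₁)` for `x > 0`, plus `(ξ, 0) δ`. -/
structure DeltaRiemannData where
  ρ₀ : ℝ
  ρ₁ : ℝ
  u₀ : ℝ
  u₁ : ℝ
  ξ : ℝ

namespace DeltaRiemannData

/-- The initial density, with the delta function. -/
noncomputable def initialDensity (D : DeltaRiemannData) : Measure ℝ :=
  ENNReal.ofReal D.ρ₀ • volume.restrict (Iio 0) + ENNReal.ofReal D.ρ₁ • volume.restrict (Ioi 0) +
    ENNReal.ofReal D.ξ • Measure.dirac 0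

/-- The initial velocity, when the delta function is given the velocity `w`. -/
noncomputable def initialVelocity (D : DeltaRiemannData) (w : ℝ) (x : ℝ) : ℝ :=
  if x < 0 then D.u₀ else if x = 0 then w else D.u₁

/-- The piecewise constant approximation of the initial density. -/
noncomputable def approxDensity (D : DeltaRiemannData) (μ : ℝ) : Measure ℝ :=
  ENNReal.ofReal D.ρ₀ • volume.restrict (Iio (-(μ / 2))) +
    ENNReal.ofReal (D.ξ / μ) • volume.restrict (Ioo (-(μ / 2)) (μ / 2)) +
    ENNReal.ofReal D.ρ₁ • volume.restrict (Ioi (μ / 2))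

/-- The piecewise constant approximation of the initial velocity, with the velocity `w` in the
middle state. -/
noncomputable def approxVelocity (D : DeltaRiemannData) (μ w : ℝ) (x : ℝ) : ℝ :=
  if x < -(μ / 2) then D.u₀ else if x < μ / 2 then w else D.u₁

/-- The total energy in `[-L, L]` of the approximate initial data. -/
noncomputable def initialEnergy (D : DeltaRiemannData) (L μ w : ℝ) : ℝ :=
  ∫ x in Icc (-L) L, 1 / 2 * D.approxVelocity μ w x ^ 2 ∂D.approxDensity μ

/-- `U` is an admissible solution for the approximate data with middle velocity `w`, and among
all admissible solutions for all choices of the middle velocity it has the least energy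
dissipation at time `0+`: its `dH_{[-L,L]}/dt (0+)` is the greatest. -/
def HasLeastDissipation (D : DeltaRiemannData) (L μ w : ℝ) (U : GasFlow) : Prop :=
  IsAdmissibleSolution U (D.approxDensity μ) (D.approxVelocity μ w) ∧
  ∃ d, HasDerivWithinAt (U.energyOn L) d (Ici 0) 0 ∧
    ∀ w' U' d', IsAdmissibleSolution U' (D.approxDensity μ) (D.approxVelocity μ w') →
      HasDerivWithinAt (U'.energyOn L) d' (Ici 0) 0 → d' ≤ d

/-- `U` is selected for the parameter `μ`: it has the least dissipation, and among those that
have it, the least initial energy. -/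
def IsSelected (D : DeltaRiemannData) (L μ w : ℝ) (U : GasFlow) : Prop :=
  D.HasLeastDissipation L μ w U ∧
  ∀ w' U', D.HasLeastDissipation L μ w' U' → U.energyOn L 0 ≤ U'.energyOn L 0

/-- The backward energy condition.  `U` is an admissible solution with the delta Riemann data, and
it is the distributional limit, as `μ → 0+`, of solutions `V μ` of the approximate problems which
for all small `μ` are the selected ones.  The middle velocity `w μ` may depend on `μ`. -/
def SatisfiesBackwardEnergyCondition (D : DeltaRiemannData) (L : ℝ) (U : GasFlow) : Prop :=
  (∃ w, IsAdmissibleSolution U D.initialDensity (D.initialVelocity w)) ∧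
  ∃ (w : ℝ → ℝ) (V : ℝ → GasFlow),
    (∀ᶠ μ in 𝓝[>] (0 : ℝ), D.IsSelected L μ (w μ) (V μ)) ∧ GasFlow.ConvergesTo V U

/-- `y = (√ρ₀ u₀ + √ρ₁ u₁) / (√ρ₀ + √ρ₁)`. -/
noncomputable def shockSpeed (D : DeltaRiemannData) : ℝ :=
  (√D.ρ₀ * D.u₀ + √D.ρ₁ * D.u₁) / (√D.ρ₀ + √D.ρ₁)

/-- The delta shock with constant speed `y` and strength `ξ + √(ρ₀ ρ₁) (u₀ - u₁) t`. -/
noncomputable def deltaShock (D : DeltaRiemannData) : GasFlow where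
  density t :=
    ENNReal.ofReal D.ρ₀ • volume.restrict (Iio (D.shockSpeed * t)) +
    ENNReal.ofReal D.ρ₁ • volume.restrict (Ioi (D.shockSpeed * t)) +
    ENNReal.ofReal (D.ξ + √(D.ρ₀ * D.ρ₁) * (D.u₀ - D.u₁) * t) •
      Measure.dirac (D.shockSpeed * t)
  velocity t x :=
    if x < D.shockSpeed * t then D.u₀ else if x = D.shockSpeed * t then D.shockSpeed else D.u₁

/-- The velocity of the delta contact discontinuity. -/
noncomputable def contactSpeed (D : DeltaRiemannData) : ℝ :=
  if 0 ≤ D.u₀ ∧ 0 ≤ D.u₁ then min D.u₀ D.u₁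
  else if D.u₀ ≤ 0 ∧ D.u₁ ≤ 0 then max D.u₀ D.u₁
  else 0

/-- The contact discontinuities `x = u₀ t` and `x = u₁ t` with a vacuum between them, and in it
a delta contact discontinuity of constant strength `ξ` on `x = u_δ t`. -/
noncomputable def deltaContact (D : DeltaRiemannData) : GasFlow where
  density t :=
    ENNReal.ofReal D.ρ₀ • volume.restrict (Iio (D.u₀ * t)) +
    ENNReal.ofReal D.ρ₁ • volume.restrict (Ioi (D.u₁ * t)) +
    ENNReal.ofReal D.ξ • Measure.dirac (D.contactSpeed * t)
  velocity t x :=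
    if x = D.contactSpeed * t then D.contactSpeed
    else if x < D.u₀ * t then D.u₀
    else if D.u₁ * t < x then D.u₁
    else x / t

end DeltaRiemannData

/-! Selection acts only on the middle velocity `w`. For small `μ`, every admissible solution of the
approximate problem has, for a short time, an energy in `[-L, L]` that is affine in time. Its slope
is fixed by the two Riemann problems at `±μ/2`: it is a constant minus half of `K₀ max(u₀ - w, 0)³ +
K₁ max(w - u₁, 0)³` (`energyOn_hasDerivWithinAt`). Hence the selected solutions are exactly the
admissible ones with one particular `w = w(μ)` (`isSelected_iff`). Convergence at time `0` alone
then prescribes the velocity of the point mass in the limit. So the claim reduces to uniqueness for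
the delta Riemann problem with that velocity, and to exhibiting one convergent family of selected
solutions (`satisfiesBackwardEnergyCondition_iff`). Uniqueness for the approximate problems is never
needed.

Choice of `w`. If `u₀ ≤ u₁`, the dissipation vanishes exactly for `w ∈ [u₀, u₁]`, and the initial
energy, increasing in `w²`, picks the point of this interval closest to `0`. If `u₁ < u₀`, the
dissipation lies strictly above the sum of its tangents at the critical point, which is therefore
its only minimizer (`energyRate_lt`). There the two delta shocks have the speeds `w ± σ`, symmetric
about `w`, and `w` tends to `y` as `μ → 0`.

Uniqueness. A pattern may have superfluous fronts, several fronts at one point and empty gaps, and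
its fronts need not be straight. Fronts leaving a point `z` at time `a` split into clusters that
stay together until the next interaction. Overcompressivity makes the gaps between these clusters
vacuum. Cutoffs that are constant near all fronts turn the weak laws into exact balances for each
cluster. The energy inequality forces the mass leaving `z` to keep its velocity `v`. Integrating the
momentum balance locates the cluster at the barycenter of its initial mass and of the matter swept
up (`cluster_law`). Sign considerations then leave only contact discontinuities if `u_left ≤ v ≤
u_right` (`block_contact`), and only a straight delta shock if the mass is compressed with equal
momentum fluxes from both sides (`block_shock`). Two solutions that agree at a time thus agree a
little longer, and a continuity argument in time finishes (`equiv_of_step`).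

Existence. For `u₀ ≤ u₁` four contact discontinuities suffice. For `u₁ < u₀` two delta shocks meet
at a time of order `√μ` and merge into one shock on a curved path. Its position is again given by
the barycenter, a quadratic equation solved explicitly by `absorbedShift`. The weak laws follow from
Rankine-Hugoniot conditions (`FrontMotion`), and the merging conserves mass and momentum and loses
energy. -/

/-! ### Integrals over the gaps between ordered points -/

/-- The primitive of `φ` that vanishes at `-∞`. -/
noncomputable def primitive (φ : ℝ → ℝ) (x : ℝ) : ℝ := ∫ y in Iic x, φ y

theorem primitive_sub {φ : ℝ → ℝ} (hφ : Integrable φ) (x y : ℝ) :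
    primitive φ y - primitive φ x = ∫ z in x..y, φ z :=
  intervalIntegral.integral_Iic_sub_Iic hφ.integrableOn hφ.integrableOn

theorem primitive_sub_of_eqOn {φ : ℝ → ℝ} (hφ : Integrable φ) {x y a : ℝ}
    (h : ∀ z ∈ uIcc x y, φ z = a) : primitive φ y - primitive φ x = a * (y - x) := by
  rw [primitive_sub hφ, intervalIntegral.integral_congr (g := fun _ => a) h]
  simp [mul_comm]

namespace IsTestFunction

theorem integrable {φ : ℝ → ℝ} (h : IsTestFunction φ) : Integrable φ :=
  h.1.continuous.integrable_of_hasCompactSupport h.2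

theorem deriv {φ : ℝ → ℝ} (h : IsTestFunction φ) : IsTestFunction (deriv φ) :=
  ⟨ContDiff.deriv' (n := ∞) (by simpa using h.1), h.2.deriv⟩

theorem differentiable {φ : ℝ → ℝ} (h : IsTestFunction φ) : Differentiable ℝ φ :=
  h.1.differentiable (by simp)

theorem primitive_deriv {φ : ℝ → ℝ} (h : IsTestFunction φ) (x : ℝ) :
    primitive (_root_.deriv φ) x = φ x := by
  have := HasCompactSupport.integral_Iic_deriv_eq (f := φ) (h.1.of_le (by simp)) h.2 x
  simpa [primitive] using this

theorem integral_deriv {φ : ℝ → ℝ} (h : IsTestFunction φ) : ∫ x, _root_.deriv φ x = 0 := by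
  have h1 : Tendsto φ atBot (𝓝 0) :=
    h.2.is_zero_at_infty.mono_left atBot_le_cocompact
  have h2 : Tendsto φ atTop (𝓝 0) :=
    h.2.is_zero_at_infty.mono_left atTop_le_cocompact
  have := integral_of_hasDerivAt_of_tendsto (fun x => (h.differentiable x).hasDerivAt)
    h.deriv.integrable h1 h2
  simpa using this

end IsTestFunction

/-- The region between the points number `j - 1` and `j` of a finite family. -/
def frontGap {N : ℕ} (c : Fin N → ℝ) (j : Fin (N + 1)) : Set ℝ :=
  {x | ∀ i : Fin N, ((i : ℕ) < j → c i < x) ∧ ((j : ℕ) ≤ i → x < c i)}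

section Gap

variable {N : ℕ} {c : Fin N → ℝ}

theorem isOpen_frontGap (c : Fin N → ℝ) (j : Fin (N + 1)) : IsOpen (frontGap c j) := by
  have : frontGap c j = ⋂ i : Fin N, {x | ((i : ℕ) < j → c i < x) ∧ ((j : ℕ) ≤ i → x < c i)} := by
    ext x; simp [frontGap]
  rw [this]
  refine isOpen_iInter_of_finite fun i => ?_
  by_cases h : (i : ℕ) < j
  · simpa [h, not_le.2 h] using isOpen_lt continuous_const continuous_id
  · simpa [h, not_lt.1 h] using isOpen_lt continuous_id continuous_const

/-- The points below all the fronts `k ≥ j`. -/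
def belowFronts (c : Fin N → ℝ) (j : Fin (N + 1)) : Set ℝ := {x | ∀ i : Fin N, (j : ℕ) ≤ i → x < c i}

/-- The points above all the fronts `k < j`. -/
def aboveFronts (c : Fin N → ℝ) (j : Fin (N + 1)) : Set ℝ := {x | ∀ i : Fin N, (i : ℕ) < j → c i < x}

theorem frontGap_eq_inter (c : Fin N → ℝ) (j : Fin (N + 1)) :
    frontGap c j = belowFronts c j ∩ aboveFronts c j := by
  ext x
  simp only [frontGap, belowFronts, aboveFronts, mem_inter_iff, mem_ofPred_eq]
  exact ⟨fun h => ⟨fun i => (h i).2, fun i => (h i).1⟩, fun h i => ⟨h.2 i, h.1 i⟩⟩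

theorem belowFronts_last (c : Fin N → ℝ) : belowFronts c (Fin.last N) = univ := by
  ext x
  simp only [belowFronts, mem_ofPred_eq, mem_univ, iff_true, Fin.val_last]
  intro i hi; exact absurd i.2 (not_lt.2 hi)

theorem belowFronts_castSucc (hc : Monotone c) (k : Fin N) :
    belowFronts c k.castSucc = Iio (c k) := by
  ext x
  simp only [belowFronts, mem_ofPred_eq, mem_Iio, Fin.val_castSucc]
  exact ⟨fun h => h k le_rfl, fun h i hi => h.trans_le (hc (Fin.le_def.2 hi))⟩

theorem aboveFronts_zero (c : Fin N → ℝ) : aboveFronts c 0 = univ := by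
  ext x; simp [aboveFronts]

theorem aboveFronts_succ (hc : Monotone c) (k : Fin N) : aboveFronts c k.succ = Ioi (c k) := by
  ext x
  simp only [aboveFronts, mem_ofPred_eq, mem_Ioi, Fin.val_succ]
  exact ⟨fun h => h k (Nat.lt_succ_self _),
    fun h i hi => (hc (Fin.le_def.2 (Nat.lt_succ_iff.1 hi))).trans_lt h⟩

/-- The integral of `φ` up to the right end of the gap `j`. -/
noncomputable def upperPrimitive (c : Fin N → ℝ) (φ : ℝ → ℝ) (j : Fin (N + 1)) : ℝ :=
  ∫ x in belowFronts c j, φ x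

/-- The integral of `φ` up to the left end of the gap `j`. -/
noncomputable def lowerPrimitive (c : Fin N → ℝ) (φ : ℝ → ℝ) : Fin (N + 1) → ℝ :=
  Fin.cases 0 fun k => primitive φ (c k)

/-- For coinciding points the difference vanishes by monotonicity, so empty gaps need no separate
treatment. -/
theorem integral_frontGap (hc : Monotone c) {φ : ℝ → ℝ} (hφ : Integrable φ) (j : Fin (N + 1)) :
    ∫ x in frontGap c j, φ x = upperPrimitive c φ j - lowerPrimitive c φ j := by
  rw [frontGap_eq_inter]
  induction j using Fin.cases with
  | zero => simp [aboveFronts_zero, upperPrimitive, lowerPrimitive]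
  | succ k =>
    have h := integral_inter_add_sdiff (μ := volume) (s := belowFronts c k.succ)
      (measurableSet_Ioi (a := c k)) hφ.integrableOn
    -- The two sets may differ in the point `c k`, namely when the next point coincides with it.
    have hset : (belowFronts c k.succ \ Ioi (c k) : Set ℝ) =ᵐ[volume] Iic (c k) := by
      have hne : ∀ᵐ x ∂(volume : Measure ℝ), x ≠ c k := by simp [ae_iff]
      filter_upwards [hne] with x hx
      refine propext ⟨fun h => not_lt.1 h.2, fun h => ⟨fun i hi => ?_, not_lt.2 h⟩⟩
      refine lt_of_lt_of_le (lt_of_le_of_ne h hx) (hc (Fin.le_def.2 ?_))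
      simp only [Fin.val_succ] at hi; omega
    rw [aboveFronts_succ hc, upperPrimitive, ← h, setIntegral_congr_set hset]
    simp [lowerPrimitive, primitive]

/-- The jump of `f` across the point number `k`. -/
def gapJump (f : Fin (N + 1) → ℝ) (k : Fin N) : ℝ := f k.castSucc - f k.succ

/-- Abel summation. It makes a moment a sum over single fronts, plus a term that does not depend on
their positions. -/
theorem sum_integral_frontGap (hc : Monotone c) {φ : ℝ → ℝ} (hφ : Integrable φ)
    (f : Fin (N + 1) → ℝ) :
    ∑ j, f j * ∫ x in frontGap c j, φ x =
      f (Fin.last N) * (∫ x, φ x) + ∑ k, gapJump f k * primitive φ (c k) := by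
  simp_rw [integral_frontGap hc hφ, mul_sub, Finset.sum_sub_distrib]
  rw [Fin.sum_univ_castSucc, Fin.sum_univ_succ (fun j => f j * lowerPrimitive c φ j)]
  have h1 : ∀ k : Fin N, upperPrimitive c φ k.castSucc = primitive φ (c k) := fun k => by
    rw [upperPrimitive, belowFronts_castSucc hc, primitive, integral_Iic_eq_integral_Iio]
  have h2 : upperPrimitive c φ (Fin.last N) = ∫ x, φ x := by
    simp [upperPrimitive, belowFronts_last]
  simp_rw [h1, h2, gapJump, sub_mul, Finset.sum_sub_distrib]
  simp [lowerPrimitive]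
  ring

/-- All points at `x` have numbers in `p, …, q`, so what is seen immediately to the left and right
of `x` are the gaps before `p` and after `q`, however many empty gaps lie in between. -/
theorem exists_subset_frontGap {x : ℝ} {p q : Fin N} (hc : Monotone c)
    (h : ∀ k, c k = x ↔ p ≤ k ∧ k ≤ q) (hpq : p ≤ q) :
    ∃ δ > 0, Ioo (x - δ) x ⊆ frontGap c p.castSucc ∧ Ioo x (x + δ) ⊆ frontGap c q.succ := by
  have hp : c p = x := (h p).2 ⟨le_rfl, hpq⟩
  have hq : c q = x := (h q).2 ⟨hpq, le_rfl⟩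
  have hev : ∀ᶠ δ in 𝓝[>] (0 : ℝ), ∀ k, c k ≠ x → δ < |c k - x| := by
    rw [eventually_all]
    intro k
    by_cases hk : c k = x
    · simp [hk]
    · have := Ioo_mem_nhdsGT (abs_pos.2 (sub_ne_zero.2 hk))
      filter_upwards [this] with δ hδ _ using hδ.2
  obtain ⟨δ, hδ, hδ0⟩ := (hev.and self_mem_nhdsWithin).exists
  refine ⟨δ, hδ0, fun y hy k => ⟨fun hk => ?_, fun hk => ?_⟩, fun y hy k => ⟨fun hk => ?_, fun hk => ?_⟩⟩
  · simp only [Fin.val_castSucc] at hk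
    have hne : c k ≠ x := fun he => absurd ((h k).1 he).1 (not_le.2 hk)
    have h1 := hδ k hne
    have h2 : c k ≤ x := hp ▸ hc (Fin.le_def.2 hk.le)
    rw [abs_of_nonpos (by linarith)] at h1
    linarith [hy.1]
  · simp only [Fin.val_castSucc] at hk
    exact hy.2.trans_le (hp ▸ hc (Fin.le_def.2 hk))
  · simp only [Fin.val_succ] at hk
    exact (hq ▸ hc (Fin.le_def.2 (Nat.lt_succ_iff.1 hk)) : c k ≤ x).trans_lt hy.1
  · simp only [Fin.val_succ] at hk
    have hne : c k ≠ x := fun he => absurd ((h k).1 he).2 (not_le.2 (Fin.lt_def.2 hk))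
    have h1 := hδ k hne
    have h2 : x ≤ c k := hq ▸ hc (Fin.le_def.2 (by omega))
    rw [abs_of_nonneg (by linarith)] at h1
    linarith [hy.2]

theorem exists_fiber_eq (hc : Monotone c) {k₀ : Fin N} :
    ∃ p q, p ≤ k₀ ∧ k₀ ≤ q ∧ ∀ k, c k = c k₀ ↔ p ≤ k ∧ k ≤ q := by
  classical
  have hne : (Finset.univ.filter fun k => c k = c k₀).Nonempty := ⟨k₀, by simp⟩
  refine ⟨Finset.min' _ hne, Finset.max' _ hne, Finset.min'_le _ k₀ (by simp),
    Finset.le_max' _ k₀ (by simp), fun k => ⟨fun h =>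
    ⟨Finset.min'_le _ k (by simpa using h), Finset.le_max' _ k (by simpa using h)⟩, fun h => ?_⟩⟩
  have h1 := (Finset.mem_filter.1 (Finset.min'_mem _ hne)).2
  have h2 := (Finset.mem_filter.1 (Finset.max'_mem _ hne)).2
  exact le_antisymm ((hc h.2).trans h2.le) (h1.symm.le.trans (hc h.1))

/-- Summation by parts over a block of fronts. -/
theorem sum_gapJump_mul (f : Fin (N + 1) → ℝ) (x : Fin N → ℝ) {p q : Fin N} (hpq : p ≤ q)
    (h : ∀ k l : Fin N, p ≤ k → (l : ℕ) = k + 1 → l ≤ q → f k.succ = 0 ∨ x k = x l) :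
    ∑ k ∈ Finset.Icc p q, gapJump f k * x k = f p.castSucc * x p - f q.succ * x q := by
  obtain ⟨n, hn⟩ : ∃ n, (q : ℕ) = p + n := Nat.exists_eq_add_of_le hpq
  induction n generalizing q with
  | zero =>
    have : p = q := Fin.ext (by omega)
    subst this
    simp [gapJump, sub_mul]
  | succ n ih =>
    have hlt : (p : ℕ) + n < N := by have := q.2; omega
    let q' : Fin N := ⟨p + n, hlt⟩
    have hpq' : p ≤ q' := Fin.le_def.2 (by simp [q'])
    have hIcc : Finset.Icc p q = insert q (Finset.Icc p q') := by
      ext k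
      simp only [Finset.mem_Icc, Finset.mem_insert, Fin.le_def, Fin.ext_iff, q']
      omega
    have hq : q ∉ Finset.Icc p q' := by
      simp only [Finset.mem_Icc, Fin.le_def, q']; omega
    rw [hIcc, Finset.sum_insert hq, ih hpq' (fun k l hk hl hlq => h k l hk hl
      (hlq.trans (Fin.le_def.2 (by simp [q']; omega)))) rfl]
    have hs : q'.succ = q.castSucc := Fin.ext (by simp [q']; omega)
    rcases h q' q hpq' (by simp [q']; omega) le_rfl with h0 | h0
    · rw [hs] at h0
      simp only [gapJump, hs, h0]; ring
    · rw [h0, hs, gapJump]; ring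

end Gap


/-! ### Moments of a flow made of fronts -/

/-- At time `t` the flow `U` consists of constant states `(r j, u j)` separated by the points
`c k`, which carry the masses `ξ k`. -/
structure GasFlow.Carries (U : GasFlow) (t : ℝ) {N : ℕ} (c ξ : Fin N → ℝ)
    (r u : Fin (N + 1) → ℝ) : Prop where
  mono : Monotone c
  strength_nonneg : ∀ k, 0 ≤ ξ k
  density_nonneg : ∀ j, 0 ≤ r j
  density_eq : U.density t = ∑ j, ENNReal.ofReal (r j) • volume.restrict (frontGap c j) +
    ∑ k, ENNReal.ofReal (ξ k) • Measure.dirac (c k)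
  velocity_state : ∀ j, 0 < r j →
    ∀ᵐ x ∂volume.restrict (frontGap c j), U.velocity t x = u j

namespace GasFlow.Carries

variable {U : GasFlow} {t : ℝ} {N : ℕ} {c ξ : Fin N → ℝ} {r u : Fin (N + 1) → ℝ}

theorem integral_mul_velocity_pow (h : U.Carries t c ξ r u) {φ : ℝ → ℝ} (hφ : Integrable φ)
    (i : ℕ) :
    ∫ x, φ x * U.velocity t x ^ i ∂U.density t =
      ∑ j, r j * u j ^ i * (∫ x in frontGap c j, φ x) +
        ∑ k, ξ k * U.velocity t (c k) ^ i * φ (c k) := by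
  have hgap : ∀ j, 0 < r j → (fun x => φ x * U.velocity t x ^ i)
      =ᵐ[volume.restrict (frontGap c j)] fun x => φ x * u j ^ i := fun j hj => by
    filter_upwards [h.velocity_state j hj] with x hx
    rw [hx]
  have hI : ∀ j ∈ Finset.univ, Integrable (fun x => φ x * U.velocity t x ^ i)
      (ENNReal.ofReal (r j) • volume.restrict (frontGap c j)) := fun j _ => by
    rcases (h.density_nonneg j).eq_or_lt with hj | hj
    · simp [← hj]
    · exact ((hφ.integrableOn.mul_const _).congr (hgap j hj).symm).smul_measure (by simp)
  have hD : ∀ k ∈ Finset.univ, Integrable (fun x => φ x * U.velocity t x ^ i)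
      (ENNReal.ofReal (ξ k) • Measure.dirac (c k)) := fun k _ =>
    (integrable_dirac enorm_lt_top).smul_measure (by simp)
  rw [h.density_eq, integral_add_measure (integrable_finsetSum_measure.2 hI)
    (integrable_finsetSum_measure.2 hD), integral_finsetSum_measure hI,
    integral_finsetSum_measure hD]
  congr 1
  · refine Finset.sum_congr rfl fun j _ => ?_
    rw [integral_smul_measure, ENNReal.toReal_ofReal (h.density_nonneg j), smul_eq_mul]
    rcases (h.density_nonneg j).eq_or_lt with hj | hj
    · simp [← hj]
    · rw [integral_congr_ae (hgap j hj), integral_mul_const]; ring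
  · refine Finset.sum_congr rfl fun k _ => ?_
    rw [integral_smul_measure, ENNReal.toReal_ofReal (h.strength_nonneg k), smul_eq_mul,
      integral_dirac]
    ring

theorem integral_eq (h : U.Carries t c ξ r u) {φ : ℝ → ℝ} (hφ : Integrable φ) (i : ℕ) :
    ∫ x, φ x * U.velocity t x ^ i ∂U.density t =
      r (Fin.last N) * u (Fin.last N) ^ i * (∫ x, φ x) +
        ∑ k, (gapJump (fun j => r j * u j ^ i) k * primitive φ (c k) +
          ξ k * U.velocity t (c k) ^ i * φ (c k)) := by
  rw [h.integral_mul_velocity_pow hφ, sum_integral_frontGap h.mono hφ fun j => r j * u j ^ i,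
    Finset.sum_add_distrib, add_assoc]

end GasFlow.Carries

namespace WavePattern

variable {N : ℕ} {P : WavePattern N} {U : GasFlow}

/-- The jump of `ρ uⁱ` across the front `k`. -/
def jump (P : WavePattern N) (i : ℕ) (k : Fin N) : ℝ :=
  gapJump (fun j => P.stateDensity j * P.stateVelocity j ^ i) k

theorem Represents.carries (hP : P.Represents U) {t : ℝ} (ht : 0 ≤ t) :
    U.Carries t (fun k => P.front k t) (fun k => P.strength k t) P.stateDensity
      P.stateVelocity where
  mono := hP.ordered t ht
  strength_nonneg k := hP.strength_nonneg k t ht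
  density_nonneg := hP.stateDensity_nonneg
  density_eq := hP.density_eq t ht
  velocity_state := hP.velocity_state t ht

theorem Represents.moment_eq (hP : P.Represents U) {t : ℝ} (ht : 0 ≤ t) {φ : ℝ → ℝ}
    (hφ : Integrable φ) (i : ℕ) :
    U.moment i φ t = P.stateDensity (Fin.last N) * P.stateVelocity (Fin.last N) ^ i * (∫ x, φ x) +
      ∑ k, (P.jump i k * primitive φ (P.front k t) +
        P.strength k t * U.velocity t (P.front k t) ^ i * φ (P.front k t)) :=
  (hP.carries ht).integral_eq hφ i

end WavePattern

/-! ### Localization of the conservation laws at a point -/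

/-- A test function that is `1` near `x` and `0` near finitely many other points. -/
theorem exists_test_eq_one_near {ι : Type*} [Finite ι] (c : ι → ℝ) (x : ℝ) :
    ∃ φ : ℝ → ℝ, IsTestFunction φ ∧ (∀ y, 0 ≤ φ y) ∧ φ =ᶠ[𝓝 x] (fun _ => 1) ∧
      ∀ k, c k ≠ x → φ =ᶠ[𝓝 (c k)] fun _ => 0 := by
  have hev : ∀ᶠ δ in 𝓝[>] (0 : ℝ), ∀ k, c k ≠ x → δ < |c k - x| := by
    rw [eventually_all]
    intro k
    by_cases hk : c k = x
    · simp [hk]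
    · have := Ioo_mem_nhdsGT (abs_pos.2 (sub_ne_zero.2 hk))
      filter_upwards [this] with δ hδ _ using hδ.2
  obtain ⟨δ, hδ, hδ0⟩ := (hev.and self_mem_nhdsWithin).exists
  have hδ0' : (0 : ℝ) < δ := hδ0
  let f : ContDiffBump x := ⟨δ / 2, δ, by positivity, by linarith⟩
  refine ⟨f, ⟨f.contDiff, f.hasCompactSupport⟩, fun y => f.nonneg, f.eventuallyEq_one, fun k hk => ?_⟩
  have hopen : IsOpen {y : ℝ | δ < |y - x|} :=
    isOpen_lt continuous_const (continuous_id.sub continuous_const).abs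
  filter_upwards [hopen.mem_nhds (hδ k hk)] with y hy
  refine f.zero_of_le_dist ?_
  simpa [Real.dist_eq] using (le_of_lt hy : δ ≤ |y - x|)

namespace WavePattern

variable {N : ℕ} {P : WavePattern N} {U : GasFlow}

/-- The moments and the fluxes of a test function that is constant near every front depend
linearly on the positions of the fronts. -/
theorem Represents.moment_near (hP : P.Represents U) {t₀ : ℝ} (ht₀ : 0 ≤ t₀) {φ : ℝ → ℝ}
    (hφ : IsTestFunction φ) {a : Fin N → ℝ}
    (ha : ∀ k, φ =ᶠ[𝓝 (P.front k t₀)] fun _ => a k) :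
    ∃ ε > 0, ∀ t, 0 ≤ t → |t - t₀| < ε → ∀ i,
      U.moment i φ t =
          P.stateDensity (Fin.last N) * P.stateVelocity (Fin.last N) ^ i * (∫ x, φ x) +
          ∑ k, P.jump i k * primitive φ (P.front k t₀) +
        ∑ k, a k * (P.jump i k * (P.front k t - P.front k t₀) +
          P.strength k t * U.velocity t (P.front k t) ^ i) ∧
      U.moment i (deriv φ) t = ∑ k, a k * P.jump i k := by
  have hball : ∀ k, ∃ η > 0, ∀ y, |y - P.front k t₀| < η → φ y = a k := fun k => by
    obtain ⟨η, hη, h⟩ := Metric.eventually_nhds_iff.1 (ha k)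
    exact ⟨η, hη, fun y hy => h (by simpa [Real.dist_eq] using hy)⟩
  choose η hη0 hη using hball
  -- A neighbourhood within `[0, ∞)`, so that the initial time `t₀ = 0` is included.
  have hev : ∀ᶠ t in 𝓝[Ici 0] t₀, ∀ k, |P.front k t - P.front k t₀| < η k := by
    rw [eventually_all]
    intro k
    have := Metric.tendsto_nhds.1 (hP.continuous k t₀ ht₀) (η k) (hη0 k)
    simpa [Real.dist_eq] using this
  rw [eventually_nhdsWithin_iff, Metric.eventually_nhds_iff] at hev
  obtain ⟨ε, hε, hev⟩ := hev
  refine ⟨ε, hε, fun t ht htε i => ?_⟩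
  have hk := hev (y := t) (by simpa [Real.dist_eq] using htε) ht
  have hval : ∀ k, φ (P.front k t) = a k := fun k => hη k _ (hk k)
  have hder : ∀ k, deriv φ (P.front k t) = 0 := fun k => by
    have : φ =ᶠ[𝓝 (P.front k t)] fun _ => a k := by
      filter_upwards [(isOpen_lt (continuous_id.sub continuous_const).abs
        continuous_const).mem_nhds (hk k)] with y hy using hη k y hy
    rw [this.deriv_eq, deriv_const]
  have hprim : ∀ k, primitive φ (P.front k t) =
      primitive φ (P.front k t₀) + a k * (P.front k t - P.front k t₀) := fun k => by
    rw [← primitive_sub_of_eqOn hφ.integrable (x := P.front k t₀) (y := P.front k t) (a := a k)]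
    · ring
    · intro z hz
      refine hη k z (lt_of_le_of_lt ?_ (hk k))
      exact abs_sub_left_of_mem_uIcc hz
  constructor
  · rw [hP.moment_eq ht hφ.integrable, add_assoc, ← Finset.sum_add_distrib]
    congr 1
    refine Finset.sum_congr rfl fun k _ => ?_
    rw [hval, hprim]; ring
  · rw [hP.moment_eq ht hφ.deriv.integrable, hφ.integral_deriv, mul_zero, zero_add]
    refine Finset.sum_congr rfl fun k _ => ?_
    rw [hder, hφ.primitive_deriv, hval]; ring

/-- `∑ (jump of ρ uⁱ) c + ξ uⁱ` over the fronts that are at `x` at time `t₀`. -/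
noncomputable def blockMoment (P : WavePattern N) (U : GasFlow) (B : Finset (Fin N)) (i : ℕ)
    (t : ℝ) : ℝ :=
  ∑ k ∈ B, (P.jump i k * P.front k t + P.strength k t * U.velocity t (P.front k t) ^ i)

/-- Conservation of mass and momentum, and the energy inequality, for the fronts that are at `x`
at time `t₀`. -/
theorem Represents.local_laws (hP : P.Represents U) {R : Measure ℝ} {v : ℝ → ℝ}
    (hU : U.IsWeakSolution R v) (hE : U.EnergyAdmissible) {t₀ : ℝ} (ht₀ : 0 ≤ t₀) {x : ℝ}
    {B : Finset (Fin N)} (hB : ∀ k, P.front k t₀ = x ↔ k ∈ B) :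
    ∃ ε > 0, ∀ s t, 0 ≤ s → s ≤ t → |s - t₀| < ε → |t - t₀| < ε →
      P.blockMoment U B 0 t - P.blockMoment U B 0 s = (t - s) * ∑ k ∈ B, P.jump 1 k ∧
      P.blockMoment U B 1 t - P.blockMoment U B 1 s = (t - s) * ∑ k ∈ B, P.jump 2 k ∧
      P.blockMoment U B 2 t - P.blockMoment U B 2 s ≤ (t - s) * ∑ k ∈ B, P.jump 3 k := by
  classical
  obtain ⟨φ, hφ, hφ0, hφ1, hφk⟩ := exists_test_eq_one_near (fun k => P.front k t₀) x
  -- The cutoff is `1` near the fronts of `B` and `0` near all others. Its derivative vanishes near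
  -- every front, so the fluxes are constant in time and consist of jumps only.
  let a : Fin N → ℝ := fun k => if k ∈ B then 1 else 0
  have ha : ∀ k, φ =ᶠ[𝓝 (P.front k t₀)] fun _ => a k := fun k => by
    by_cases hk : k ∈ B
    · simpa [a, hk, (hB k).2 hk] using hφ1
    · simpa [a, hk] using hφk k (fun h => hk ((hB k).1 h))
  obtain ⟨ε, hε, h⟩ := hP.moment_near ht₀ hφ ha
  have hsum : ∀ g : Fin N → ℝ, ∑ k, a k * g k = ∑ k ∈ B, g k := fun g => by
    simp [a, Finset.sum_ite_mem]
  have hdiff : ∀ s t, 0 ≤ s → 0 ≤ t → |s - t₀| < ε → |t - t₀| < ε → ∀ i,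
      U.moment i φ t - U.moment i φ s = P.blockMoment U B i t - P.blockMoment U B i s := by
    intro s t hs ht hsε htε i
    rw [(h t ht htε i).1, (h s hs hsε i).1, add_sub_add_left_eq_sub, hsum, hsum, blockMoment,
      blockMoment, ← Finset.sum_sub_distrib, ← Finset.sum_sub_distrib]
    exact Finset.sum_congr rfl fun k _ => by ring
  have hflux : ∀ s t, 0 ≤ s → s ≤ t → |s - t₀| < ε → |t - t₀| < ε → ∀ i,
      ∫ τ in s..t, U.moment i (deriv φ) τ = (t - s) * ∑ k ∈ B, P.jump i k := by
    intro s t hs hst hsε htε i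
    rw [intervalIntegral.integral_congr (g := fun _ => ∑ k ∈ B, P.jump i k)]
    · simp
    · intro τ hτ
      rw [uIcc_of_le hst] at hτ
      rw [abs_lt] at hsε htε
      simp only
      rw [(h τ (hs.trans hτ.1) (abs_lt.2 ⟨by linarith [hτ.1], by linarith [hτ.2]⟩) i).2, hsum]
  refine ⟨ε, hε, fun s t hs hst hsε htε => ?_⟩
  have ht := hs.trans hst
  refine ⟨?_, ?_, ?_⟩
  · rw [← hdiff s t hs ht hsε htε, (hU.mass φ hφ s t hs hst).2, hflux s t hs hst hsε htε]
  · rw [← hdiff s t hs ht hsε htε, (hU.momentum φ hφ s t hs hst).2, hflux s t hs hst hsε htε]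
  · have := (hE φ hφ hφ0 s t hs hst).2
    rw [intervalIntegral.integral_const_mul, hflux s t hs hst hsε htε] at this
    rw [← hdiff s t hs ht hsε htε]
    linarith

end WavePattern


/-! ### Motion of a cluster of fronts between interactions -/

/-- The localized laws hold only near each time `t₀`, because the cutoff depends on the positions of
the fronts at `t₀`. Connectedness of the interval turns them into one constant. -/
theorem constant_on_Ioo_of_locally_constant {f : ℝ → ℝ} {a b : ℝ}
    (h : ∀ t₀ ∈ Ioo a b, ∃ ε > 0, ∀ s t, s ∈ Ioo a b → s ≤ t → t ∈ Ioo a b → |s - t₀| < ε →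
      |t - t₀| < ε → f t = f s) :
    ∃ A, ∀ t ∈ Ioo a b, f t = A := by
  have hd : ∀ t₀ ∈ Ioo a b, f =ᶠ[𝓝 t₀] fun _ => f t₀ := by
    intro t₀ ht₀
    obtain ⟨ε, hε, hf⟩ := h t₀ ht₀
    filter_upwards [isOpen_Ioo.mem_nhds ht₀, Metric.ball_mem_nhds t₀ hε] with t ht htε
    rw [Metric.mem_ball, Real.dist_eq] at htε
    rcases le_total t₀ t with hle | hle
    · exact hf t₀ t ht₀ hle ht (by simpa using hε) htε
    · exact (hf t t₀ ht hle ht₀ htε (by simpa using hε)).symm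
  refine isOpen_Ioo.exists_is_const_of_deriv_eq_zero isPreconnected_Ioo
    (fun t ht => ((differentiableAt_const (f t)).congr_of_eventuallyEq
      (hd t ht)).differentiableWithinAt) (fun t ht => ?_)
  rw [(hd t ht).deriv_eq]; simp

theorem constant_on_Ico_of_hasDerivAt_zero {f : ℝ → ℝ} {a b : ℝ} (hc : ContinuousOn f (Ico a b))
    (h : ∀ t ∈ Ioo a b, HasDerivAt f 0 t) : ∀ t ∈ Ico a b, f t = f a := by
  intro t ht
  rcases ht.1.eq_or_lt with rfl | hlt
  · rfl
  have hcc : ContinuousOn f (Icc a t) := hc.mono fun s hs => ⟨hs.1, hs.2.trans_lt ht.2⟩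
  obtain ⟨c, hc', he⟩ := exists_hasDerivAt_eq_slope f (fun _ => 0) hlt hcc
    (fun s hs => h s ⟨hs.1, hs.2.trans ht.2⟩)
  have : t - a ≠ 0 := by linarith
  field_simp at he
  linarith

theorem le_of_hasDerivAt_nonpos {f f' : ℝ → ℝ} {a b : ℝ} (hc : ContinuousOn f (Ico a b))
    (h : ∀ t ∈ Ioo a b, HasDerivAt f (f' t) t) (h' : ∀ t ∈ Ioo a b, f' t ≤ 0) :
    ∀ t ∈ Ico a b, f t ≤ f a := by
  intro t ht
  rcases ht.1.eq_or_lt with rfl | hlt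
  · rfl
  have hcc : ContinuousOn f (Icc a t) := hc.mono fun s hs => ⟨hs.1, hs.2.trans_lt ht.2⟩
  obtain ⟨c, hc', he⟩ := exists_hasDerivAt_eq_slope f f' hlt hcc
    (fun s hs => h s ⟨hs.1, hs.2.trans ht.2⟩)
  have h1 := h' c ⟨hc'.1, hc'.2.trans ht.2⟩
  rw [he, div_nonpos_iff] at h1
  rcases h1 with h1 | h1 <;> linarith

namespace WavePattern

variable {N : ℕ} {P : WavePattern N} {U : GasFlow}

/-- There are no interactions in the open time interval `(a, b)`, where `0 ≤ a < b`. -/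
structure IsQuiet (P : WavePattern N) (a b : ℝ) : Prop where
  nonneg : 0 ≤ a
  lt : a < b
  notMem : ∀ t ∈ Ioo a b, t ∉ P.interactionTimes

theorem exists_isQuiet (P : WavePattern N) {a : ℝ} (ha : 0 ≤ a) : ∃ b, P.IsQuiet a b := by
  have hev : ∀ᶠ b in 𝓝[>] a, ∀ t ∈ (P.interactionTimes : Set ℝ), ¬ (a < t ∧ t < b) := by
    rw [P.interactionTimes.finite_toSet.eventually_all]
    intro t _
    by_cases h : a < t
    · filter_upwards [Ioo_mem_nhdsGT h] with b hb hh using absurd hb.2 (not_lt.2 hh.2.le)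
    · exact Eventually.of_forall fun b hb => h hb.1
  obtain ⟨b, hb, hab⟩ := (hev.and self_mem_nhdsWithin).exists
  exact ⟨b, ha, hab, fun t ht hmem => hb t hmem ht⟩

section Quiet

variable {a b : ℝ}

theorem Represents.coincide_iff (hP : P.Represents U) (hq : P.IsQuiet a b)
    {s t : ℝ} (hs : s ∈ Ioo a b) (ht : t ∈ Ioo a b) (i k : Fin N) :
    P.front i s = P.front k s ↔ P.front i t = P.front k t := by
  have key : ∀ s t, s ∈ Ioo a b → t ∈ Ioo a b → s ≤ t →
      (P.front i s = P.front k s ↔ P.front i t = P.front k t) := fun s t hs ht hst =>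
    hP.noInteraction s t (hq.nonneg.trans_lt hs.1) hst
      (fun r hr hmem => hq.notMem r ⟨hs.1.trans_le hmem.1, hmem.2.trans_lt ht.2⟩ hr) i k
  rcases le_total s t with h | h
  · exact key s t hs ht h
  · exact (key t s ht hs h).symm

theorem Represents.hasDerivAt_front (hP : P.Represents U) (hq : P.IsQuiet a b)
    {t : ℝ} (ht : t ∈ Ioo a b) (k : Fin N) :
    HasDerivAt (P.front k) (deriv (P.front k) t) t :=
  ((hP.smooth k t (hq.nonneg.trans_lt ht.1) (hq.notMem t ht)).differentiableAt
    (by simp)).hasDerivAt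

theorem Represents.continuousOn_front (hP : P.Represents U) (hq : P.IsQuiet a b)
    (k : Fin N) : ContinuousOn (P.front k) (Ico a b) :=
  (hP.continuous k).mono fun _ ht => hq.nonneg.trans ht.1

/-- The fronts coincide throughout the quiet interval, and continuity carries this to its left end,
which may itself be an interaction time. -/
theorem Represents.coincide_at_left (hP : P.Represents U) (hq : P.IsQuiet a b)
    {t : ℝ} (ht : t ∈ Ioo a b) {i k : Fin N}
    (h : P.front i t = P.front k t) : P.front i a = P.front k a := by
  have hi := (hP.continuousOn_front hq i a ⟨le_rfl, hq.lt⟩).tendsto.mono_left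
    (nhdsWithin_mono a Ioo_subset_Ico_self)
  have hk := (hP.continuousOn_front hq k a ⟨le_rfl, hq.lt⟩).tendsto.mono_left
    (nhdsWithin_mono a Ioo_subset_Ico_self)
  have : (𝓝[Ioo a b] a).NeBot := by
    rw [nhdsWithin_Ioo_eq_nhdsGT hq.lt]; infer_instance
  refine tendsto_nhds_unique (hi.congr' ?_) hk
  filter_upwards [self_mem_nhdsWithin] with s hs
  exact (hP.coincide_iff hq ht hs i k).1 h

/-- Matter does not come from nowhere: a gap between fronts that start at the same point is a
vacuum or stays empty. -/
theorem Represents.interior_gap (hP : P.Represents U) (hq : P.IsQuiet a b)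
    (hO : P.Overcompressive) {k l : Fin N} (hl : (l : ℕ) = k + 1)
    (hkl : P.front k a = P.front l a) {t : ℝ} (ht : t ∈ Ioo a b) :
    P.stateDensity k.succ = 0 ∨ P.front k t = P.front l t := by
  by_contra! hcon
  have hpos : 0 < P.stateDensity k.succ := lt_of_le_of_ne (hP.stateDensity_nonneg _) hcon.1.symm
  have hlt : ∀ s ∈ Ioo a b, P.front k s < P.front l s := fun s hs =>
    lt_of_le_of_ne (hP.ordered s (hq.nonneg.trans hs.1.le) (Fin.le_def.2 (by omega)))
      fun h => hcon.2 ((hP.coincide_iff hq hs ht k l).1 h)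
  -- The matter in the gap is at most as fast as its left front and at least as fast as its right
  -- one, so the width, initially zero, cannot grow.
  have hder : ∀ s ∈ Ioo a b, deriv (P.front l) s - deriv (P.front k) s ≤ 0 := by
    intro s hs
    have hs0 := hq.nonneg.trans_lt hs.1
    have hne : (P.gap k.succ s).Nonempty := by
      obtain ⟨x, hx⟩ := exists_between (hlt s hs)
      refine ⟨x, fun i => ⟨fun hi => ?_, fun hi => ?_⟩⟩
      · exact (hP.ordered s hs0.le (Fin.le_def.2 (by simp at hi; omega)) :
          P.front i s ≤ P.front k s).trans_lt hx.1
      · exact hx.2.trans_le (hP.ordered s hs0.le (Fin.le_def.2 (by simp at hi; omega)) :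
          P.front l s ≤ P.front i s)
    have h := hO s hs0 (hq.notMem s hs) k.succ hpos hne
    have h1 := (h k).1 (by simp)
    have h2 := (h l).2 (by simp [hl])
    linarith
  have := le_of_hasDerivAt_nonpos (f := fun s => P.front l s - P.front k s)
    ((hP.continuousOn_front hq l).sub (hP.continuousOn_front hq k))
    (fun s hs => (hP.hasDerivAt_front hq hs l).sub (hP.hasDerivAt_front hq hs k)) hder t
    ⟨ht.1.le, ht.2⟩
  have := hlt t ht
  simp only [hkl, sub_self] at *
  linarith

/-- Between interactions the momentum of the fronts of a cluster is the product of its mass and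
the slope. -/
theorem Represents.strength_mul_velocity (hP : P.Represents U) (hq : P.IsQuiet a b)
    {t : ℝ} (ht : t ∈ Ioo a b) {k l : Fin N}
    (hkl : P.front k t = P.front l t) (i : ℕ) :
    P.strength k t * U.velocity t (P.front k t) ^ i =
      P.strength k t * deriv (P.front l) t ^ i := by
  have ht0 := hq.nonneg.trans_lt ht.1
  rcases (hP.strength_nonneg k t ht0.le).eq_or_lt with h | h
  · simp [← h]
  · have he : P.front k =ᶠ[𝓝 t] P.front l := by
      filter_upwards [isOpen_Ioo.mem_nhds ht] with s hs
      exact (hP.coincide_iff hq ht hs k l).1 hkl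
    rw [hP.velocity_front k t ht0 (hq.notMem t ht) h, he.deriv_eq]

end Quiet

end WavePattern


namespace WavePattern

variable {N : ℕ} {P : WavePattern N} {U : GasFlow} {R : Measure ℝ} {v₀ : ℝ → ℝ}

theorem Represents.tendsto_front (hP : P.Represents U) {a : ℝ} (ha : 0 ≤ a) (k : Fin N) :
    Tendsto (P.front k) (𝓝[>] a) (𝓝 (P.front k a)) :=
  (hP.continuous k a ha).tendsto.mono_left
    (nhdsWithin_mono a fun _ ht => ha.trans (le_of_lt ht))

/-- The mass that leaves the point `z` after the time `a`. -/
theorem Represents.block_mass (hP : P.Represents U) (hU : U.IsWeakSolution R v₀)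
    (hE : U.EnergyAdmissible) {a z : ℝ} (ha : 0 ≤ a) {B : Finset (Fin N)}
    (hB : ∀ k, P.front k a = z ↔ k ∈ B) :
    ∀ᶠ t in 𝓝[>] a, ∑ k ∈ B, P.strength k t = ∑ k ∈ B, P.strength k a +
      (t - a) * ∑ k ∈ B, P.jump 1 k - ∑ k ∈ B, P.jump 0 k * (P.front k t - z) := by
  obtain ⟨ε, hε, h⟩ := hP.local_laws hU hE ha hB
  filter_upwards [Ioo_mem_nhdsGT (show a < a + ε by linarith)] with t ht
  have h1 := (h a t ha ht.1.le (by simpa using hε)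
    (abs_lt.2 ⟨by linarith [ht.1], by linarith [ht.2]⟩)).1
  have hz : ∑ k ∈ B, P.jump 0 k * P.front k a = ∑ k ∈ B, P.jump 0 k * z :=
    Finset.sum_congr rfl fun k hk => by rw [(hB k).2 hk]
  simp only [blockMoment, pow_zero, mul_one, Finset.sum_add_distrib, hz] at h1
  simp only [mul_sub, Finset.sum_sub_distrib]
  linarith

/-- The mass that leaves the point `z` does so with the velocity that it had there. -/
theorem Represents.energy_excess (hP : P.Represents U) (hU : U.IsWeakSolution R v₀)
    (hE : U.EnergyAdmissible) {a z v : ℝ} (ha : 0 ≤ a) {B : Finset (Fin N)}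
    (hB : ∀ k, P.front k a = z ↔ k ∈ B)
    (hv : ∑ k ∈ B, P.strength k a = 0 ∨ U.velocity a z = v) :
    ∃ e : ℝ → ℝ, Tendsto e (𝓝[>] a) (𝓝 0) ∧ ∀ᶠ t in 𝓝[>] a,
      ∑ k ∈ B, P.strength k t * (U.velocity t (P.front k t) - v) ^ 2 ≤ e t := by
  obtain ⟨ε, hε, h⟩ := hP.local_laws hU hE ha hB
  set J : ℕ → ℝ := fun i => ∑ k ∈ B, P.jump i k with hJ
  set X : ℕ → ℝ → ℝ := fun i t => ∑ k ∈ B, P.jump i k * (P.front k t - z) with hX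
  have hXlim : ∀ i, Tendsto (X i) (𝓝[>] a) (𝓝 0) := fun i => by
    have : Tendsto (X i) (𝓝[>] a) (𝓝 (∑ k ∈ B, P.jump i k * (z - z))) :=
      tendsto_finsetSum _ fun k hk => ((by
        simpa [(hB k).2 hk] using hP.tendsto_front ha k :
        Tendsto (P.front k) (𝓝[>] a) (𝓝 z)).sub_const z).const_mul _
    simpa using this
  have hs : Tendsto (fun t => t - a) (𝓝[>] a) (𝓝 0) := by
    have : Tendsto (fun t : ℝ => t - a) (𝓝[>] a) (𝓝 (a - a)) :=
      (tendsto_id.mono_left nhdsWithin_le_nhds).sub_const a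
    simpa using this
  -- Expanding the square combines the energy, momentum and mass laws with the weights `1`, `-2 v`,
  -- `v²`. The terms at time `a` cancel since the mass there is zero or has velocity `v`. What
  -- remains comes from fluxes and displacements over a vanishing time.
  refine ⟨fun t => ((t - a) * J 3 - X 2 t) - 2 * v * ((t - a) * J 2 - X 1 t) +
    v ^ 2 * ((t - a) * J 1 - X 0 t), ?_, ?_⟩
  · have := ((((hs.mul_const (J 3)).sub (hXlim 2)).sub
      (((hs.mul_const (J 2)).sub (hXlim 1)).const_mul (2 * v))).add
      (((hs.mul_const (J 1)).sub (hXlim 0)).const_mul (v ^ 2)))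
    simpa using this
  · filter_upwards [Ioo_mem_nhdsGT (show a < a + ε by linarith)] with t ht
    obtain ⟨h0, h1, h2⟩ := h a t ha ht.1.le (by simpa using hε)
      (abs_lt.2 ⟨by linarith [ht.1], by linarith [ht.2]⟩)
    have hbm : ∀ i, P.blockMoment U B i t - P.blockMoment U B i a = X i t +
        ∑ k ∈ B, P.strength k t * U.velocity t (P.front k t) ^ i -
        (∑ k ∈ B, P.strength k a) * U.velocity a z ^ i := fun i => by
      have hz : P.blockMoment U B i a = ∑ k ∈ B, (P.jump i k * z +
          P.strength k a * U.velocity a z ^ i) :=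
        Finset.sum_congr rfl fun k hk => by rw [(hB k).2 hk]
      rw [hz]
      simp only [blockMoment, hX, Finset.sum_add_distrib, mul_sub, Finset.sum_sub_distrib,
        Finset.sum_mul]
      ring
    rw [hbm] at h0 h1 h2
    have hexp : ∑ k ∈ B, P.strength k t * (U.velocity t (P.front k t) - v) ^ 2 =
        ∑ k ∈ B, P.strength k t * U.velocity t (P.front k t) ^ 2 -
        2 * v * ∑ k ∈ B, P.strength k t * U.velocity t (P.front k t) ^ 1 +
        v ^ 2 * ∑ k ∈ B, P.strength k t * U.velocity t (P.front k t) ^ 0 := by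
      simp only [Finset.mul_sum, ← Finset.sum_sub_distrib, ← Finset.sum_add_distrib]
      exact Finset.sum_congr rfl fun k _ => by ring
    rw [hexp]
    have hM : (∑ k ∈ B, P.strength k a) * U.velocity a z ^ 2 -
        2 * v * ((∑ k ∈ B, P.strength k a) * U.velocity a z ^ 1) +
        v ^ 2 * ((∑ k ∈ B, P.strength k a) * U.velocity a z ^ 0) = 0 := by
      rcases hv with hv | hv
      · simp [hv]
      · rw [hv]; ring
    simp only [hJ]
    linear_combination h2 - 2 * v * h1 + v ^ 2 * h0 + hM

/-- The law of motion of a cluster of fronts that leaves the point `z` at the time `a` and stays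
together on `(a, b)`: its mass is an initial mass `A` of velocity `v` together with the matter
that it has swept up from its two sides, and it is in the barycenter of this matter. -/
theorem Represents.cluster_law (hP : P.Represents U) (hU : U.IsWeakSolution R v₀)
    (hE : U.EnergyAdmissible) (hO : P.Overcompressive) {a b z v : ℝ} (hq : P.IsQuiet a b)
    {p₀ q₀ : Fin N} (hB : ∀ k, P.front k a = z ↔ p₀ ≤ k ∧ k ≤ q₀)
    (hv : ∑ k ∈ Finset.Icc p₀ q₀, P.strength k a = 0 ∨ U.velocity a z = v)
    {k₀ : Fin N} (hk₀ : P.front k₀ a = z) :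
    ∃ p q, p ≤ k₀ ∧ k₀ ≤ q ∧ p₀ ≤ p ∧ q ≤ q₀ ∧
      (∀ t ∈ Ioo a b, ∀ k, P.front k t = P.front k₀ t ↔ p ≤ k ∧ k ≤ q) ∧
      (p = p₀ ∨ P.stateDensity p.castSucc = 0) ∧ (q = q₀ ∨ P.stateDensity q.succ = 0) ∧
      ∃ A, 0 ≤ A ∧ ∀ t ∈ Ioo a b,
        (∑ k ∈ Finset.Icc p q, P.strength k t = A +
          P.stateDensity p.castSucc *
            (P.stateVelocity p.castSucc * (t - a) - (P.front k₀ t - z)) +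
          P.stateDensity q.succ * ((P.front k₀ t - z) - P.stateVelocity q.succ * (t - a))) ∧
        (A * ((P.front k₀ t - z) - v * (t - a)) =
          P.stateDensity p.castSucc / 2 *
            (P.stateVelocity p.castSucc * (t - a) - (P.front k₀ t - z)) ^ 2 -
          P.stateDensity q.succ / 2 *
            ((P.front k₀ t - z) - P.stateVelocity q.succ * (t - a)) ^ 2) ∧
        (0 < P.stateDensity p.castSucc →
          P.front k₀ t - z ≤ P.stateVelocity p.castSucc * (t - a)) ∧
        (0 < P.stateDensity q.succ →
          P.stateVelocity q.succ * (t - a) ≤ P.front k₀ t - z) := by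
  have ha := hq.nonneg
  obtain ⟨t₁, ht₁⟩ : (Ioo a b).Nonempty := nonempty_Ioo.2 hq.lt
  obtain ⟨p, q, hpk, hkq, hpq₁⟩ := exists_fiber_eq (hP.ordered t₁ (ha.trans ht₁.1.le)) (k₀ := k₀)
  have hpq : ∀ t ∈ Ioo a b, ∀ k, P.front k t = P.front k₀ t ↔ p ≤ k ∧ k ≤ q := fun t ht k =>
    (hP.coincide_iff hq ht ht₁ k k₀).trans (hpq₁ k)
  have hple : p ≤ q := hpk.trans hkq
  have hmem : ∀ k, p ≤ k → k ≤ q → P.front k a = z := fun k h1 h2 =>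
    (hP.coincide_at_left hq ht₁ ((hpq t₁ ht₁ k).2 ⟨h1, h2⟩)).trans hk₀
  have hp₀ : p₀ ≤ p := ((hB p).1 (hmem p le_rfl hple)).1
  have hq₀ : q ≤ q₀ := ((hB q).1 (hmem q hple le_rfl)).2
  refine ⟨p, q, hpk, hkq, hp₀, hq₀, hpq, ?_, ?_, ?_⟩
  -- If the cluster does not contain the first front from `z`, the gap on its left separates it from
  -- a front with the same origin, so `interior_gap` makes that gap vacuum.
  · rcases hp₀.eq_or_lt with h | h
    · exact Or.inl h.symm
    right
    let k : Fin N := ⟨p - 1, by omega⟩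
    have hkp : (p : ℕ) = k + 1 := by simp only [k]; have := Fin.lt_def.1 h; omega
    have hk : P.front k a = z := (hB k).2 ⟨Fin.le_def.2 (by have := Fin.lt_def.1 h; omega),
      (Fin.le_def.2 (by omega : (k : ℕ) ≤ p)).trans (hple.trans hq₀)⟩
    have hcs : k.succ = p.castSucc := Fin.ext (by simp [hkp])
    rcases hP.interior_gap hq hO hkp (hk.trans (hmem p le_rfl hple).symm) ht₁ with h0 | h0
    · rwa [← hcs]
    · have := ((hpq t₁ ht₁ k).1 (h0.trans ((hpq t₁ ht₁ p).2 ⟨le_rfl, hple⟩))).1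
      exact absurd (Fin.le_def.1 this) (by omega)
  · rcases hq₀.eq_or_lt with h | h
    · exact Or.inl h
    right
    let l : Fin N := ⟨q + 1, by have := Fin.lt_def.1 h; have := q₀.2; omega⟩
    have hl : P.front l a = z := (hB l).2 ⟨(hp₀.trans hple).trans (Fin.le_def.2 (by simp [l])),
      Fin.le_def.2 (by have := Fin.lt_def.1 h; simp [l]; omega)⟩
    rcases hP.interior_gap hq hO (k := q) (l := l) rfl ((hmem q hple le_rfl).trans hl.symm) ht₁
      with h0 | h0
    · exact h0
    · have := ((hpq t₁ ht₁ l).1 (h0.symm.trans ((hpq t₁ ht₁ q).2 ⟨hple, le_rfl⟩))).2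
      exact absurd (Fin.le_def.1 this) (by simp [l])
  -- the laws of the cluster
  set c := P.front k₀ with hc
  set rl := P.stateDensity p.castSucc
  set ul := P.stateVelocity p.castSucc
  set rr := P.stateDensity q.succ
  set ur := P.stateVelocity q.succ
  set S : ℝ → ℝ := fun t => ∑ k ∈ Finset.Icc p q, P.strength k t with hS
  have hcon : ∀ t ∈ Ioo a b, ∀ k ∈ Finset.Icc p q, P.front k t = c t := fun t ht k hk =>
    (hpq t ht k).2 (Finset.mem_Icc.1 hk)
  have hjump : ∀ i, ∑ k ∈ Finset.Icc p q, P.jump i k = rl * ul ^ i - rr * ur ^ i := fun i => by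
    have := sum_gapJump_mul (fun j => P.stateDensity j * P.stateVelocity j ^ i) (fun _ => 1) hple
      (fun _ _ _ _ _ => Or.inr rfl)
    simpa [jump] using this
  have hblock : ∀ i, ∀ t ∈ Ioo a b, P.blockMoment U (Finset.Icc p q) i t =
      (rl * ul ^ i - rr * ur ^ i) * c t + S t * deriv c t ^ i := fun i t ht => by
    rw [blockMoment, Finset.sum_add_distrib, ← hjump, Finset.sum_mul, hS, Finset.sum_mul]
    congr 1
    · exact Finset.sum_congr rfl fun k hk => by rw [hcon t ht k hk]
    · exact Finset.sum_congr rfl fun k hk => hP.strength_mul_velocity hq ht (hcon t ht k hk) i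
  have hloc : ∀ t₀ ∈ Ioo a b, ∃ ε > 0, ∀ s t, s ∈ Ioo a b → s ≤ t → t ∈ Ioo a b →
      |s - t₀| < ε → |t - t₀| < ε →
      (S t + (rl - rr) * c t - (rl * ul - rr * ur) * t =
        S s + (rl - rr) * c s - (rl * ul - rr * ur) * s) ∧
      (S t * deriv c t + (rl * ul - rr * ur) * c t - (rl * ul ^ 2 - rr * ur ^ 2) * t =
        S s * deriv c s + (rl * ul - rr * ur) * c s - (rl * ul ^ 2 - rr * ur ^ 2) * s) := by
    intro t₀ ht₀
    obtain ⟨ε, hε, h⟩ := hP.local_laws hU hE (ha.trans ht₀.1.le) (x := c t₀)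
      (B := Finset.Icc p q) (fun k => by rw [hpq t₀ ht₀ k, Finset.mem_Icc])
    refine ⟨ε, hε, fun s t hs hst ht hsε htε => ?_⟩
    obtain ⟨h0, h1, -⟩ := h s t (ha.trans hs.1.le) hst hsε htε
    rw [hblock _ t ht, hblock _ s hs, hjump] at h0 h1
    constructor <;> linarith
  obtain ⟨A', hA'⟩ := constant_on_Ioo_of_locally_constant (fun t₀ ht₀ => by
    obtain ⟨ε, hε, h⟩ := hloc t₀ ht₀
    exact ⟨ε, hε, fun s t hs hst ht h1 h2 => (h s t hs hst ht h1 h2).1⟩)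
  obtain ⟨B', hB'⟩ := constant_on_Ioo_of_locally_constant (fun t₀ ht₀ => by
    obtain ⟨ε, hε, h⟩ := hloc t₀ ht₀
    exact ⟨ε, hε, fun s t hs hst ht h1 h2 => (h s t hs hst ht h1 h2).2⟩)
  -- The normalization makes `A` and `M` the limits at `a+` of the mass and the momentum of the
  -- cluster, that is, what it takes with it from `z`.
  set A := A' - (rl - rr) * z + (rl * ul - rr * ur) * a with hA
  set M := B' - (rl * ul - rr * ur) * z + (rl * ul ^ 2 - rr * ur ^ 2) * a with hM
  have hSA : ∀ t ∈ Ioo a b, S t = A + rl * (ul * (t - a) - (c t - z)) +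
      rr * ((c t - z) - ur * (t - a)) := fun t ht => by
    have := hA' t ht
    simp only [hA]; linarith
  have hSM : ∀ t ∈ Ioo a b, S t * deriv c t = M + rl * ul * (ul * (t - a) - (c t - z)) +
      rr * ur * ((c t - z) - ur * (t - a)) := fun t ht => by
    have := hB' t ht
    simp only [hM]; linarith
  have hclim : Tendsto (fun t => c t - z) (𝓝[>] a) (𝓝 0) := by
    have := (hP.tendsto_front ha k₀).sub_const z
    rwa [show P.front k₀ a = z from hk₀, sub_self] at this
  have hslim : Tendsto (fun t => t - a) (𝓝[>] a) (𝓝 0) := by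
    have : Tendsto (fun t : ℝ => t - a) (𝓝[>] a) (𝓝 (a - a)) :=
      (tendsto_id.mono_left nhdsWithin_le_nhds).sub_const a
    simpa using this
  have hIoo : Ioo a b ∈ 𝓝[>] a := Ioo_mem_nhdsGT hq.lt
  have hSlim : Tendsto S (𝓝[>] a) (𝓝 A) := by
    have : Tendsto (fun t => A + rl * (ul * (t - a) - (c t - z)) +
        rr * ((c t - z) - ur * (t - a))) (𝓝[>] a) (𝓝 (A + rl * (ul * 0 - 0) + rr * (0 - ur * 0))) :=
      ((((hslim.const_mul ul).sub hclim).const_mul rl).const_add A).add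
        ((hclim.sub (hslim.const_mul ur)).const_mul rr)
    simp only [mul_zero, sub_self, add_zero] at this
    refine this.congr' ?_
    filter_upwards [hIoo] with t ht using (hSA t ht).symm
  have hMlim : Tendsto (fun t => S t * deriv c t) (𝓝[>] a) (𝓝 M) := by
    have : Tendsto (fun t => M + rl * ul * (ul * (t - a) - (c t - z)) +
        rr * ur * ((c t - z) - ur * (t - a))) (𝓝[>] a)
        (𝓝 (M + rl * ul * (ul * 0 - 0) + rr * ur * (0 - ur * 0))) :=
      ((((hslim.const_mul ul).sub hclim).const_mul (rl * ul)).const_add M).add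
        ((hclim.sub (hslim.const_mul ur)).const_mul (rr * ur))
    simp only [mul_zero, sub_self, add_zero] at this
    refine this.congr' ?_
    filter_upwards [hIoo] with t ht using (hSM t ht).symm
  have hS0 : ∀ t ∈ Ioo a b, 0 ≤ S t := fun t ht =>
    Finset.sum_nonneg fun k _ => hP.strength_nonneg k t (ha.trans ht.1.le)
  have hA0 : 0 ≤ A := ge_of_tendsto hSlim (by filter_upwards [hIoo] with t ht using hS0 t ht)
  -- `(S c' - v S)² = S · S (c' - v)²`, and the last factor is bounded by the vanishing energy
  -- excess of all fronts from `z`.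
  have hMA : M = v * A := by
    obtain ⟨e, he, hle⟩ := hP.energy_excess hU hE ha (B := Finset.Icc p₀ q₀)
      (fun k => by rw [hB k, Finset.mem_Icc]) hv
    have h1 : Tendsto (fun t => (S t * deriv c t - v * S t) ^ 2) (𝓝[>] a)
        (𝓝 ((M - v * A) ^ 2)) := (hMlim.sub (hSlim.const_mul v)).pow 2
    have h2 : Tendsto (fun t => S t * e t) (𝓝[>] a) (𝓝 (A * 0)) := hSlim.mul he
    have h3 : (M - v * A) ^ 2 ≤ A * 0 := by
      refine le_of_tendsto_of_tendsto h1 h2 ?_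
      filter_upwards [hIoo, hle] with t ht hlet
      have h4 : S t * (deriv c t - v) ^ 2 ≤ e t := by
        refine le_trans ?_ hlet
        have h5 : S t * (deriv c t - v) ^ 2 = ∑ k ∈ Finset.Icc p q,
            P.strength k t * (U.velocity t (P.front k t) - v) ^ 2 := by
          rw [hS, Finset.sum_mul]
          refine Finset.sum_congr rfl fun k hk => ?_
          have e1 := hP.strength_mul_velocity hq ht (hcon t ht k hk) 1
          have e2 := hP.strength_mul_velocity hq ht (hcon t ht k hk) 2
          linear_combination -e2 + 2 * v * e1
        rw [h5]
        refine Finset.sum_le_sum_of_subset_of_nonneg (Finset.Icc_subset_Icc hp₀ hq₀)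
          fun k _ _ => mul_nonneg (hP.strength_nonneg k t (ha.trans ht.1.le)) (sq_nonneg _)
      calc (S t * deriv c t - v * S t) ^ 2 = S t * (S t * (deriv c t - v) ^ 2) := by ring
        _ ≤ S t * e t := mul_le_mul_of_nonneg_left h4 (hS0 t ht)
    have h6 : (M - v * A) ^ 2 = 0 := le_antisymm (by linarith) (sq_nonneg _)
    have := pow_eq_zero_iff (two_ne_zero) |>.1 h6
    linarith
  have hcder : ∀ t ∈ Ioo a b, HasDerivAt c (deriv c t) t := fun t ht =>
    hP.hasDerivAt_front hq ht k₀
  have hccont : ContinuousOn c (Ico a b) := hP.continuousOn_front hq k₀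
  refine ⟨A, hA0, fun t ht => ⟨hSA t ht, ?_, ?_, ?_⟩⟩
  -- The derivative of this expression is `S c'` minus the momentum of the collected matter, which
  -- is zero, and the expression itself vanishes at `a`.
  · have hK := constant_on_Ico_of_hasDerivAt_zero (a := a) (b := b)
      (f := fun t => A * ((c t - z) - v * (t - a)) - rl / 2 * (ul * (t - a) - (c t - z)) ^ 2 +
        rr / 2 * ((c t - z) - ur * (t - a)) ^ 2) (by fun_prop) (fun s hs => by
        have h1 := hcder s hs
        have hid := (hasDerivAt_id s).sub_const a
        have h2 := (h1.sub_const z).sub (hid.const_mul v)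
        have h3 := ((hid.const_mul ul).sub (h1.sub_const z)).pow 2
        have h4 := ((h1.sub_const z).sub (hid.const_mul ur)).pow 2
        have h5 := ((h2.const_mul A).sub (h3.const_mul (rl / 2))).add (h4.const_mul (rr / 2))
        refine h5.congr_deriv ?_
        have e1 := hSA s hs
        have e2 := hSM s hs
        simp only [Pi.sub_apply, id]
        rw [hMA] at e2
        rw [e1] at e2
        simp
        linear_combination e2) t ⟨ht.1.le, ht.2⟩
    have hz : c a = z := hk₀
    simp only [hz, sub_self, mul_zero] at hK
    linarith
  · intro hrl
    have := le_of_hasDerivAt_nonpos (a := a) (b := b) (f := fun t => (c t - z) - ul * (t - a))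
      (f' := fun t => deriv c t - ul) (by fun_prop) (fun s hs => by
        exact (((hcder s hs).sub_const z).sub
          (((hasDerivAt_id s).sub_const a).const_mul ul)).congr_deriv (by simp)) (fun s hs => by
        obtain ⟨δ, hδ, hsub, -⟩ := exists_subset_frontGap (hP.ordered s (ha.trans hs.1.le))
          (x := c s) (hpq s hs) hple
        have hs0 := ha.trans_lt hs.1
        have h1 := ((hO s hs0 (hq.notMem s hs) p.castSucc hrl
          ⟨c s - δ / 2, hsub ⟨by linarith, by linarith⟩⟩) p).2 (by simp)
        have he : P.front p =ᶠ[𝓝 s] c := by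
          filter_upwards [isOpen_Ioo.mem_nhds hs] with s' hs'
          exact (hpq s' hs' p).2 ⟨le_rfl, hple⟩
        rw [he.deriv_eq] at h1
        linarith) t ⟨ht.1.le, ht.2⟩
    have hz : c a = z := hk₀
    simp only [hz, sub_self, mul_zero] at this
    linarith
  · intro hrr
    have := le_of_hasDerivAt_nonpos (a := a) (b := b) (f := fun t => ur * (t - a) - (c t - z))
      (f' := fun t => ur - deriv c t) (by fun_prop) (fun s hs => by
        exact ((((hasDerivAt_id s).sub_const a).const_mul ur).sub
          ((hcder s hs).sub_const z)).congr_deriv (by simp)) (fun s hs => by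
        obtain ⟨δ, hδ, -, hsub⟩ := exists_subset_frontGap (hP.ordered s (ha.trans hs.1.le))
          (x := c s) (hpq s hs) hple
        have hs0 := ha.trans_lt hs.1
        have h1 := ((hO s hs0 (hq.notMem s hs) q.succ hrr
          ⟨c s + δ / 2, hsub ⟨by linarith, by linarith⟩⟩) q).1 (by simp)
        have he : P.front q =ᶠ[𝓝 s] c := by
          filter_upwards [isOpen_Ioo.mem_nhds hs] with s' hs'
          exact (hpq s' hs' q).2 ⟨hple, le_rfl⟩
        rw [he.deriv_eq] at h1
        linarith) t ⟨ht.1.le, ht.2⟩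
    have hz : c a = z := hk₀
    simp only [hz, sub_self, mul_zero] at this
    linarith

end WavePattern


/-! ### What can leave a point: contacts and delta shocks -/

/-- With matter on both sides, `x ≤ ul s ≤ v s ≤ ur s ≤ x`, so all are equal. With matter on one
side only, the two sides of the barycenter equation have opposite signs, so both vanish. Nothing is
swept up, and a positive mass moves with velocity `v`. -/
theorem contact_of_cluster_law {A v s x rl ul rr ur : ℝ} (hA : 0 ≤ A) (hs : 0 < s) (hrl : 0 ≤ rl)
    (hrr : 0 ≤ rr) (hl : 0 < rl → ul ≤ v) (hr : 0 < rr → v ≤ ur)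
    (h : A * (x - v * s) = rl / 2 * (ul * s - x) ^ 2 - rr / 2 * (x - ur * s) ^ 2)
    (hxl : 0 < rl → x ≤ ul * s) (hxr : 0 < rr → ur * s ≤ x) :
    rl * (ul * s - x) = 0 ∧ rr * (x - ur * s) = 0 ∧ A * (x - v * s) = 0 := by
  rcases hrl.eq_or_lt with h1 | h1 <;> rcases hrr.eq_or_lt with h2 | h2
  · simp [← h1, ← h2] at h ⊢
    exact h
  · have a2 := hxr h2
    have a3 := mul_le_mul_of_nonneg_right (hr h2) hs.le
    have h3 : 0 ≤ A * (x - v * s) := mul_nonneg hA (by linarith)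
    have h4 : 0 ≤ rr / 2 * (x - ur * s) ^ 2 := by positivity
    have h5 : rr / 2 * (x - ur * s) ^ 2 = 0 := by rw [← h1] at h; linarith
    have h6 : x - ur * s = 0 := by simpa [h2.ne'] using h5
    rw [← h1] at h ⊢
    rw [h6] at h ⊢
    simp at h ⊢; exact h
  · have a2 := hxl h1
    have a3 := mul_le_mul_of_nonneg_right (hl h1) hs.le
    have h3 : A * (x - v * s) ≤ 0 := mul_nonpos_of_nonneg_of_nonpos hA (by linarith)
    have h4 : 0 ≤ rl / 2 * (ul * s - x) ^ 2 := by positivity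
    have h5 : rl / 2 * (ul * s - x) ^ 2 = 0 := by rw [← h2] at h; linarith
    have h6 : ul * s - x = 0 := by simpa [h1.ne'] using h5
    rw [← h2] at h ⊢
    rw [h6] at h ⊢
    simp at h ⊢; exact h
  · have a2 := hxl h1
    have a3 := mul_le_mul_of_nonneg_right (hl h1) hs.le
    have b2 := hxr h2
    have b3 := mul_le_mul_of_nonneg_right (hr h2) hs.le
    have e1 : ul * s - x = 0 := by linarith
    have e2 : x - ur * s = 0 := by linarith
    have e3 : x - v * s = 0 := by linarith
    simp [e1, e2, e3]

namespace WavePattern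

variable {N : ℕ} {P : WavePattern N} {U : GasFlow} {R : Measure ℝ} {v₀ : ℝ → ℝ}

theorem Represents.velocity_of_straight (hP : P.Represents U) {a b z v : ℝ} (hq : P.IsQuiet a b)
    {k : Fin N} (h : ∀ t ∈ Ioo a b, P.front k t = z + v * (t - a)) {t : ℝ} (ht : t ∈ Ioo a b)
    (hk : 0 < P.strength k t) : U.velocity t (P.front k t) = v := by
  have ht0 := hq.nonneg.trans_lt ht.1
  rw [hP.velocity_front k t ht0 (hq.notMem t ht) hk]
  have he : P.front k =ᶠ[𝓝 t] fun s => z + v * (s - a) := by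
    filter_upwards [isOpen_Ioo.mem_nhds ht] with s hs using h s hs
  rw [he.deriv_eq]
  have : HasDerivAt (fun s => z + v * (s - a)) v t := by
    simpa using (((hasDerivAt_id t).sub_const a).const_mul v).const_add z
  exact this.deriv

/-- Between consecutive fronts with a common origin the state is vacuum or the fronts still
coincide; in either case the intermediate terms cancel, and only the two outer states are left. -/
theorem Represents.sum_jump_mul (hP : P.Represents U) (hO : P.Overcompressive) {a b z : ℝ}
    (hq : P.IsQuiet a b) {p₀ q₀ : Fin N} (hpq : p₀ ≤ q₀)
    (hB : ∀ k, P.front k a = z ↔ p₀ ≤ k ∧ k ≤ q₀) {t : ℝ} (ht : t ∈ Ioo a b) (i : ℕ) (F : ℝ → ℝ) :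
    ∑ k ∈ Finset.Icc p₀ q₀, P.jump i k * F (P.front k t) =
      P.stateDensity p₀.castSucc * P.stateVelocity p₀.castSucc ^ i * F (P.front p₀ t) -
      P.stateDensity q₀.succ * P.stateVelocity q₀.succ ^ i * F (P.front q₀ t) := by
  refine sum_gapJump_mul (fun j => P.stateDensity j * P.stateVelocity j ^ i)
    (fun k => F (P.front k t)) hpq fun k l hk hl hlq => ?_
  have hkl : k ≤ l := Fin.le_def.2 (by omega)
  rcases hP.interior_gap hq hO hl (((hB k).2 ⟨hk, hkl.trans hlq⟩).trans
    ((hB l).2 ⟨hk.trans hkl, hlq⟩).symm) ht with h | h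
  · left; simp [h]
  · right; simp only [h]

/-- A mass that is not compressed by the states on its two sides becomes a contact discontinuity,
or a delta contact discontinuity between vacuums. -/
theorem Represents.block_contact (hP : P.Represents U) (hU : U.IsWeakSolution R v₀)
    (hE : U.EnergyAdmissible) (hO : P.Overcompressive) {a z v : ℝ} (ha : 0 ≤ a)
    {p₀ q₀ : Fin N} (hpq : p₀ ≤ q₀) (hB : ∀ k, P.front k a = z ↔ p₀ ≤ k ∧ k ≤ q₀)
    (hv : ∑ k ∈ Finset.Icc p₀ q₀, P.strength k a = 0 ∨ U.velocity a z = v)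
    (hl : 0 < P.stateDensity p₀.castSucc → P.stateVelocity p₀.castSucc ≤ v)
    (hr : 0 < P.stateDensity q₀.succ → v ≤ P.stateVelocity q₀.succ) :
    ∀ᶠ t in 𝓝[>] a, ∀ (i : ℕ) (F φ : ℝ → ℝ),
      ∑ k ∈ Finset.Icc p₀ q₀, (P.jump i k * F (P.front k t) +
          P.strength k t * U.velocity t (P.front k t) ^ i * φ (P.front k t)) =
        P.stateDensity p₀.castSucc * P.stateVelocity p₀.castSucc ^ i *
          F (z + P.stateVelocity p₀.castSucc * (t - a)) -
        P.stateDensity q₀.succ * P.stateVelocity q₀.succ ^ i *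
          F (z + P.stateVelocity q₀.succ * (t - a)) +
        (∑ k ∈ Finset.Icc p₀ q₀, P.strength k a) * v ^ i * φ (z + v * (t - a)) := by
  obtain ⟨b, hq⟩ := P.exists_isQuiet ha
  -- Every front with mass follows the line of velocity `v`, and the two outermost fronts follow the
  -- characteristics of the outer states wherever these are not vacuum.
  have hcl : ∀ k₀, P.front k₀ a = z → (∀ t ∈ Ioo a b, 0 < P.strength k₀ t →
        ∀ s ∈ Ioo a b, P.front k₀ s = z + v * (s - a)) ∧
      ∀ t ∈ Ioo a b,
      (k₀ = p₀ → P.stateDensity p₀.castSucc *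
        (P.stateVelocity p₀.castSucc * (t - a) - (P.front k₀ t - z)) = 0) ∧
      (k₀ = q₀ → P.stateDensity q₀.succ *
        ((P.front k₀ t - z) - P.stateVelocity q₀.succ * (t - a)) = 0) := by
    intro k₀ hk₀
    obtain ⟨p, q, hpk, hkq, hp₀, hq₀, -, hp, hq', A, hA, hlaw⟩ :=
      hP.cluster_law hU hE hO hq hB hv hk₀
    have hl' : 0 < P.stateDensity p.castSucc → P.stateVelocity p.castSucc ≤ v := by
      rcases hp with rfl | h
      · exact hl
      · intro h'; exact absurd h h'.ne'
    have hr' : 0 < P.stateDensity q.succ → v ≤ P.stateVelocity q.succ := by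
      rcases hq' with rfl | h
      · exact hr
      · intro h'; exact absurd h h'.ne'
    have hc : ∀ t ∈ Ioo a b, _ := fun t ht =>
      contact_of_cluster_law hA (sub_pos.2 ht.1) (hP.stateDensity_nonneg _)
        (hP.stateDensity_nonneg _) hl' hr' (hlaw t ht).2.1 (hlaw t ht).2.2.1 (hlaw t ht).2.2.2
    refine ⟨fun t ht hpos s hs => ?_, fun t ht => ⟨?_, ?_⟩⟩
    · have h1 := (hlaw t ht).1
      rw [(hc t ht).1, (hc t ht).2.1] at h1
      have h2 : P.strength k₀ t ≤ ∑ k ∈ Finset.Icc p q, P.strength k t :=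
        Finset.single_le_sum (f := fun k => P.strength k t)
          (fun k _ => hP.strength_nonneg k t (ha.trans ht.1.le)) (Finset.mem_Icc.2 ⟨hpk, hkq⟩)
      have h3 : 0 < A := by linarith
      have h4 := (mul_eq_zero.1 (hc s hs).2.2).resolve_left h3.ne'
      linarith
    · rintro rfl
      have : p = k₀ := le_antisymm hpk hp₀
      subst this
      exact (hc t ht).1
    · rintro rfl
      have : q = k₀ := le_antisymm hq₀ hkq
      subst this
      exact (hc t ht).2.1
  filter_upwards [Ioo_mem_nhdsGT hq.lt, hP.block_mass hU hE ha (B := Finset.Icc p₀ q₀)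
    (fun k => by rw [hB k, Finset.mem_Icc])] with t ht hmass i F φ
  have hJ := fun i F => hP.sum_jump_mul hO hq hpq hB ht i F
  have hL := ((hcl p₀ ((hB p₀).2 ⟨le_rfl, hpq⟩)).2 t ht).1 rfl
  have hR := ((hcl q₀ ((hB q₀).2 ⟨hpq, le_rfl⟩)).2 t ht).2 rfl
  -- With the outer fronts on the characteristics, the inflow of mass and the displacement of the
  -- jumps cancel.
  have hm : ∑ k ∈ Finset.Icc p₀ q₀, P.strength k t = ∑ k ∈ Finset.Icc p₀ q₀, P.strength k a := by
    have h0 := hJ 0 (fun x => x - z)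
    have h1 := hJ 1 (fun _ => 1)
    simp only [mul_one] at h1
    rw [h0, h1] at hmass
    simp only [pow_zero, pow_one, mul_one] at hmass
    linarith
  have hFl : P.stateDensity p₀.castSucc * F (P.front p₀ t) =
      P.stateDensity p₀.castSucc * F (z + P.stateVelocity p₀.castSucc * (t - a)) := by
    rcases mul_eq_zero.1 hL with h | h
    · simp [h]
    · rw [show P.front p₀ t = z + P.stateVelocity p₀.castSucc * (t - a) by linarith]
  have hFr : P.stateDensity q₀.succ * F (P.front q₀ t) =
      P.stateDensity q₀.succ * F (z + P.stateVelocity q₀.succ * (t - a)) := by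
    rcases mul_eq_zero.1 hR with h | h
    · simp [h]
    · rw [show P.front q₀ t = z + P.stateVelocity q₀.succ * (t - a) by linarith]
  rw [Finset.sum_add_distrib, hJ, ← hm, Finset.sum_mul, Finset.sum_mul]
  have hterm : ∀ k ∈ Finset.Icc p₀ q₀,
      P.strength k t * U.velocity t (P.front k t) ^ i * φ (P.front k t) =
        P.strength k t * v ^ i * φ (z + v * (t - a)) := by
    intro k hk
    rcases (hP.strength_nonneg k t (ha.trans ht.1.le)).eq_or_lt with h | h
    · simp [← h]
    · have hs := (hcl k ((hB k).2 (Finset.mem_Icc.1 hk))).1 t ht h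
      rw [hP.velocity_of_straight hq hs ht h, hs t ht]
  rw [Finset.sum_congr rfl hterm]
  linear_combination P.stateVelocity p₀.castSucc ^ i * hFl - P.stateVelocity q₀.succ ^ i * hFr

/-- If `x < v s`, the left term exceeds its value at `x = v s` and the right term is at most its
value there. At `x = v s` the two are balanced, or the right one is absent, so the right side of the
barycenter equation is positive while the left side is not. -/
theorem le_of_compressed_left {A v s x rl ul rr ur : ℝ} (hA : 0 ≤ A) (hs : 0 < s) (hrl : 0 < rl)
    (hul : v < ul) (hr : rr = 0 ∨ 0 < rr ∧ ur < v ∧ rl * (ul - v) ^ 2 = rr * (v - ur) ^ 2)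
    (h : A * (x - v * s) = rl / 2 * (ul * s - x) ^ 2 - rr / 2 * (x - ur * s) ^ 2)
    (hxr : 0 < rr → ur * s ≤ x) : v * s ≤ x := by
  by_contra! hx
  have h1 : A * (x - v * s) ≤ 0 := mul_nonpos_of_nonneg_of_nonpos hA (by linarith)
  have h2 : (ul - v) * s < ul * s - x := by linarith
  have h3 : 0 < (ul - v) * s := mul_pos (by linarith) hs
  have h4 : ((ul - v) * s) ^ 2 < (ul * s - x) ^ 2 := pow_lt_pow_left₀ h2 h3.le two_ne_zero
  have h5 := mul_lt_mul_of_pos_left h4 hrl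
  have h5' : 0 ≤ rl * ((ul - v) * s) ^ 2 := by positivity
  rcases hr with hr | ⟨hr, hur, he⟩
  · rw [hr] at h; nlinarith
  · have h6 := hxr hr
    have h7 : (x - ur * s) ^ 2 ≤ ((v - ur) * s) ^ 2 :=
      pow_le_pow_left₀ (by linarith) (by linarith) 2
    have h8 := mul_le_mul_of_nonneg_left h7 hr.le
    have h9 : rl * ((ul - v) * s) ^ 2 = rr * ((v - ur) * s) ^ 2 := by
      rw [mul_pow, mul_pow]; linear_combination s ^ 2 * he
    linarith

/-- A mass that is compressed from both sides, with balanced forces, becomes a delta shock. -/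
theorem Represents.block_shock (hP : P.Represents U) (hU : U.IsWeakSolution R v₀)
    (hE : U.EnergyAdmissible) (hO : P.Overcompressive) {a z v : ℝ} (ha : 0 ≤ a)
    {p₀ q₀ : Fin N} (hpq : p₀ ≤ q₀) (hB : ∀ k, P.front k a = z ↔ p₀ ≤ k ∧ k ≤ q₀)
    (hv : ∑ k ∈ Finset.Icc p₀ q₀, P.strength k a = 0 ∨ U.velocity a z = v)
    (hrl : 0 < P.stateDensity p₀.castSucc) (hrr : 0 < P.stateDensity q₀.succ)
    (hl : v < P.stateVelocity p₀.castSucc) (hr : P.stateVelocity q₀.succ < v)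
    (hbal : P.stateDensity p₀.castSucc * (P.stateVelocity p₀.castSucc - v) ^ 2 =
      P.stateDensity q₀.succ * (v - P.stateVelocity q₀.succ) ^ 2) :
    ∀ᶠ t in 𝓝[>] a, ∀ (i : ℕ) (F φ : ℝ → ℝ),
      ∑ k ∈ Finset.Icc p₀ q₀, (P.jump i k * F (P.front k t) +
          P.strength k t * U.velocity t (P.front k t) ^ i * φ (P.front k t)) =
        (P.stateDensity p₀.castSucc * P.stateVelocity p₀.castSucc ^ i -
          P.stateDensity q₀.succ * P.stateVelocity q₀.succ ^ i) * F (z + v * (t - a)) +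
        (∑ k ∈ Finset.Icc p₀ q₀, P.strength k a +
          (P.stateDensity p₀.castSucc * (P.stateVelocity p₀.castSucc - v) +
            P.stateDensity q₀.succ * (v - P.stateVelocity q₀.succ)) * (t - a)) * v ^ i *
          φ (z + v * (t - a)) := by
  obtain ⟨b, hq⟩ := P.exists_isQuiet ha
  -- The first front is bounded from below and the last one from above by the same line, and the
  -- ordering squeezes all others onto it. Only these two need their clusters examined.
  have hge : ∀ t ∈ Ioo a b, v * (t - a) ≤ P.front p₀ t - z := by
    intro t ht
    obtain ⟨p, q, hpk, hkq, hp₀, hq₀, -, hp, hq', A, hA, hlaw⟩ :=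
      hP.cluster_law hU hE hO hq hB hv ((hB p₀).2 ⟨le_rfl, hpq⟩)
    have : p = p₀ := le_antisymm hpk hp₀
    subst this
    refine le_of_compressed_left hA (sub_pos.2 ht.1) hrl hl ?_ (hlaw t ht).2.1 (hlaw t ht).2.2.2
    rcases hq' with rfl | h
    · exact Or.inr ⟨hrr, hr, hbal⟩
    · exact Or.inl h
  have hle : ∀ t ∈ Ioo a b, P.front q₀ t - z ≤ v * (t - a) := by
    intro t ht
    obtain ⟨p, q, hpk, hkq, hp₀, hq₀, -, hp, hq', A, hA, hlaw⟩ :=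
      hP.cluster_law hU hE hO hq hB hv ((hB q₀).2 ⟨hpq, le_rfl⟩)
    have : q = q₀ := le_antisymm hq₀ hkq
    subst this
    -- The reflection `x ↦ -x` exchanges the two sides.
    have := le_of_compressed_left (A := A) (v := -v) (s := t - a) (x := -(P.front q t - z))
      (rl := P.stateDensity q.succ) (ul := -P.stateVelocity q.succ)
      (rr := P.stateDensity p.castSucc) (ur := -P.stateVelocity p.castSucc)
      hA (sub_pos.2 ht.1) hrr (by linarith) ?_ ?_ ?_
    · linarith
    · rcases hp with rfl | h
      · exact Or.inr ⟨hrl, by linarith, by linear_combination -hbal⟩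
      · exact Or.inl h
    · linear_combination -(hlaw t ht).2.1
    · intro h; have := (hlaw t ht).2.2.1 h; linarith
  have hall : ∀ k ∈ Finset.Icc p₀ q₀, ∀ t ∈ Ioo a b, P.front k t = z + v * (t - a) := by
    intro k hk t ht
    obtain ⟨h1, h2⟩ := Finset.mem_Icc.1 hk
    have hm := hP.ordered t (ha.trans ht.1.le)
    have h3 : P.front p₀ t ≤ P.front k t := hm h1
    have h4 : P.front k t ≤ P.front q₀ t := hm h2
    linarith [hge t ht, hle t ht]
  filter_upwards [Ioo_mem_nhdsGT hq.lt, hP.block_mass hU hE ha (B := Finset.Icc p₀ q₀)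
    (fun k => by rw [hB k, Finset.mem_Icc])] with t ht hmass i F φ
  have hJ := fun i F => hP.sum_jump_mul hO hq hpq hB ht i F
  have hp := hall p₀ (Finset.mem_Icc.2 ⟨le_rfl, hpq⟩) t ht
  have hq₀ := hall q₀ (Finset.mem_Icc.2 ⟨hpq, le_rfl⟩) t ht
  have hm : ∑ k ∈ Finset.Icc p₀ q₀, P.strength k t = ∑ k ∈ Finset.Icc p₀ q₀, P.strength k a +
      (P.stateDensity p₀.castSucc * (P.stateVelocity p₀.castSucc - v) +
            P.stateDensity q₀.succ * (v - P.stateVelocity q₀.succ)) * (t - a) := by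
    have h0 := hJ 0 (fun x => x - z)
    have h1 := hJ 1 (fun _ => 1)
    simp only [mul_one] at h1
    rw [h0, h1, hp, hq₀] at hmass
    rw [hmass]
    ring
  have hterm : ∀ k ∈ Finset.Icc p₀ q₀,
      P.strength k t * U.velocity t (P.front k t) ^ i * φ (P.front k t) =
        P.strength k t * v ^ i * φ (z + v * (t - a)) := by
    intro k hk
    rcases (hP.strength_nonneg k t (ha.trans ht.1.le)).eq_or_lt with h | h
    · simp [← h]
    · rw [hP.velocity_of_straight hq (hall k hk) ht h, hall k hk t ht]
  rw [Finset.sum_add_distrib, hJ, ← hm, Finset.sum_mul, Finset.sum_mul,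
    Finset.sum_congr rfl hterm, hp, hq₀]
  ring

end WavePattern


/-! ### Reading the states of a pattern off the flow -/

/-- On the open set `O` the flow is in the constant state `(ρ, u)` at time `t`. -/
structure GasFlow.HasState (U : GasFlow) (t : ℝ) (O : Set ℝ) (ρ u : ℝ) : Prop where
  isOpen : IsOpen O
  density_eq : (U.density t).restrict O = ENNReal.ofReal ρ • volume.restrict O
  velocity_eq : ∀ᵐ x ∂(U.density t).restrict O, U.velocity t x = u

theorem mem_frontGap_of_forall_ne {N : ℕ} {c : Fin N → ℝ} (hc : Monotone c) {z : ℝ}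
    (hz : ∀ k, c k ≠ z) : ∃ j, z ∈ frontGap c j := by
  classical
  by_cases hne : (Finset.univ.filter fun k => z < c k).Nonempty
  · let k₀ := Finset.min' _ hne
    have hk₀ : z < c k₀ := (Finset.mem_filter.1 (Finset.min'_mem _ hne)).2
    refine ⟨k₀.castSucc, fun i => ⟨fun hi => ?_, fun hi => hk₀.trans_le (hc (Fin.le_def.2 hi))⟩⟩
    by_contra! h
    have := Finset.min'_le (Finset.univ.filter fun k => z < c k) i
      (by simpa using lt_of_le_of_ne h (hz i).symm)
    exact absurd (Fin.le_def.1 this) (not_le.2 hi)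
  · refine ⟨Fin.last N, fun i => ⟨fun _ => ?_, fun hi => absurd i.2 (not_lt.2 hi)⟩⟩
    by_contra! h
    exact hne ⟨i, by simpa using lt_of_le_of_ne h (hz i).symm⟩

namespace GasFlow

variable {U : GasFlow} {t : ℝ} {N : ℕ} {c ξ : Fin N → ℝ} {r u : Fin (N + 1) → ℝ}

theorem Carries.density_apply (h : U.Carries t c ξ r u) {j : Fin (N + 1)} {s : Set ℝ}
    (hs : MeasurableSet s) (hsj : s ⊆ frontGap c j) :
    U.density t s = ENNReal.ofReal (r j) * volume s := by
  rw [h.density_eq]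
  simp only [Measure.coe_add, Pi.add_apply, Measure.coe_finsetSum, Finset.sum_apply,
    Measure.smul_apply, smul_eq_mul]
  rw [Finset.sum_eq_single j, Finset.sum_eq_zero]
  · rw [Measure.restrict_apply hs, inter_eq_left.2 hsj, add_zero]
  · intro k _
    have : c k ∉ s := fun hk => by
      have := hsj hk k
      rcases lt_or_ge (k : ℕ) j with h | h
      · exact lt_irrefl _ (this.1 h)
      · exact lt_irrefl _ (this.2 h)
    simp [this, hs]
  · intro j' _ hj'
    have : s ∩ frontGap c j' = ∅ := by
      by_contra hne
      obtain ⟨x, hx, hx'⟩ := nonempty_iff_ne_empty.2 hne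
      have hx := hsj hx
      rcases lt_or_gt_of_ne hj' with h | h
      · let i : Fin N := ⟨j', by have := Fin.lt_def.1 h; omega⟩
        exact lt_asymm ((hx' i).2 le_rfl) ((hx i).1 (Fin.lt_def.1 h))
      · let i : Fin N := ⟨j, by have := Fin.lt_def.1 h; omega⟩
        exact lt_asymm ((hx i).2 le_rfl) ((hx' i).1 (Fin.lt_def.1 h))
    rw [Measure.restrict_apply hs, this]; simp
  · simp

theorem Carries.density_singleton (h : U.Carries t c ξ r u) (z : ℝ) {B : Finset (Fin N)}
    (hB : ∀ k, c k = z ↔ k ∈ B) : U.density t {z} = ENNReal.ofReal (∑ k ∈ B, ξ k) := by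
  rw [h.density_eq, ENNReal.ofReal_sum_of_nonneg fun k _ => h.strength_nonneg k]
  have h1 : ∀ j, (volume.restrict (frontGap c j)) {z} = 0 := fun j =>
    le_antisymm ((Measure.restrict_apply_le _ _).trans (by simp)) zero_le
  classical
  simp only [Measure.coe_add, Pi.add_apply, Measure.coe_finsetSum, Finset.sum_apply,
    Measure.smul_apply, smul_eq_mul, h1, mul_zero, Finset.sum_const_zero, zero_add]
  rw [← Finset.sum_subset (Finset.subset_univ B) (fun k _ hk => by
    have : c k ≠ z := fun h => hk ((hB k).1 h)
    simp [this])]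
  exact Finset.sum_congr rfl fun k hk => by simp [(hB k).2 hk]

/-- A nonempty open overlap has positive measure, so densities and, outside vacuum, velocities can
be compared on it. A flow has many patterns, but wherever a gap meets the region its state is
forced. -/
theorem Carries.state_eq (h : U.Carries t c ξ r u) {j : Fin (N + 1)} {O : Set ℝ} {ρ v : ℝ}
    (hO : U.HasState t O ρ v) (hρ : 0 ≤ ρ) (hne : (O ∩ frontGap c j).Nonempty) :
    r j = ρ ∧ (0 < ρ → u j = v) := by
  obtain ⟨x, hx⟩ := hne
  set s := O ∩ frontGap c j ∩ Metric.ball x 1 with hs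
  have hopen : IsOpen s := (hO.isOpen.inter (isOpen_frontGap c j)).inter Metric.isOpen_ball
  have hpos : volume s ≠ 0 := (hopen.measure_pos volume ⟨x, hx, by simp⟩).ne'
  have hfin : volume s ≠ ⊤ :=
    ((measure_mono inter_subset_right).trans_lt measure_ball_lt_top).ne
  have hsO : s ⊆ O := fun y hy => hy.1.1
  have hsj : s ⊆ frontGap c j := fun y hy => hy.1.2
  have h1 := h.density_apply hopen.measurableSet hsj
  have h2 : U.density t s = ENNReal.ofReal ρ * volume s := by
    have := congrArg (fun m => m s) hO.density_eq
    simpa [Measure.restrict_apply hopen.measurableSet, inter_eq_left.2 hsO] using this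
  have hr : r j = ρ := by
    have h3 := (ENNReal.mul_left_inj hpos hfin).1 (h1.symm.trans h2)
    exact (ENNReal.ofReal_eq_ofReal_iff (h.density_nonneg j) hρ).1 h3
  refine ⟨hr, fun hρ0 => ?_⟩
  have h4 : ∀ᵐ y ∂volume.restrict s, U.velocity t y = u j :=
    ae_restrict_of_ae_restrict_of_subset hsj (h.velocity_state j (hr ▸ hρ0))
  have h5 : ∀ᵐ y ∂volume.restrict s, U.velocity t y = v := by
    have h6 := hO.velocity_eq
    rw [hO.density_eq, Measure.ae_ennreal_smul_measure_iff (by simpa using hρ0)] at h6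
    exact ae_restrict_of_ae_restrict_of_subset hsO h6
  have : (ae (volume.restrict s)).NeBot := by
    rw [ae_neBot]
    intro h0
    exact hpos (by simpa using congrArg (fun m => m univ) h0)
  obtain ⟨y, hy1, hy2⟩ := (h4.and h5).exists
  exact hy1.symm.trans hy2

theorem HasState.density_singleton {O : Set ℝ} {ρ v z : ℝ} (hO : U.HasState t O ρ v)
    (hz : z ∈ O) : U.density t {z} = 0 := by
  have := congrArg (fun m => m {z}) hO.density_eq
  simpa [Measure.restrict_apply, inter_eq_left.2 (singleton_subset_iff.2 hz)] using this

theorem HasState.congr {V : GasFlow} {O : Set ℝ} {ρ v : ℝ} (hO : U.HasState t O ρ v)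
    (hd : U.density t = V.density t) (hv : U.velocity t =ᵐ[U.density t] V.velocity t) :
    V.HasState t O ρ v where
  isOpen := hO.isOpen
  density_eq := hd ▸ hO.density_eq
  velocity_eq := by
    rw [← hd]
    filter_upwards [hO.velocity_eq, ae_restrict_of_ae hv] with x h1 h2
    rw [← h2, h1]

theorem HasState.mono {O O' : Set ℝ} {ρ v : ℝ} (h : U.HasState t O ρ v) (hO' : IsOpen O')
    (hsub : O' ⊆ O) : U.HasState t O' ρ v where
  isOpen := hO'
  density_eq := by
    have := congrArg (fun m => m.restrict O') h.density_eq
    simpa [Measure.restrict_restrict hO'.measurableSet, inter_eq_left.2 hsub] using this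
  velocity_eq := ae_restrict_of_ae_restrict_of_subset hsub h.velocity_eq

end GasFlow

namespace WavePattern

variable {N : ℕ} {P : WavePattern N} {U : GasFlow} {R : Measure ℝ} {v₀ : ℝ → ℝ}

/-- The fronts that are at `z` at time `a` are those with the numbers `p, …, q`. -/
def IsFiber (P : WavePattern N) (a z : ℝ) (p q : Fin N) : Prop :=
  p ≤ q ∧ ∀ k, P.front k a = z ↔ p ≤ k ∧ k ≤ q

theorem Represents.left_state (hP : P.Represents U) {a : ℝ} (ha : 0 ≤ a) {z : ℝ} {p q : Fin N}
    (h : P.IsFiber a z p q) {O : Set ℝ} {ρ u x : ℝ} (hO : U.HasState a O ρ u) (hρ : 0 ≤ ρ)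
    (hx : x < z) (hxO : Ioo x z ⊆ O) :
    P.stateDensity p.castSucc = ρ ∧ (0 < ρ → P.stateVelocity p.castSucc = u) := by
  obtain ⟨δ, hδ, hsub, -⟩ := exists_subset_frontGap (hP.ordered a ha) h.2 h.1
  obtain ⟨y, hy⟩ := exists_between (max_lt hx (show z - δ < z by linarith))
  exact (hP.carries ha).state_eq hO hρ
    ⟨y, hxO ⟨(le_max_left _ _).trans_lt hy.1, hy.2⟩,
      hsub ⟨(le_max_right _ _).trans_lt hy.1, hy.2⟩⟩

theorem Represents.right_state (hP : P.Represents U) {a : ℝ} (ha : 0 ≤ a) {z : ℝ} {p q : Fin N}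
    (h : P.IsFiber a z p q) {O : Set ℝ} {ρ u x : ℝ} (hO : U.HasState a O ρ u) (hρ : 0 ≤ ρ)
    (hx : z < x) (hxO : Ioo z x ⊆ O) :
    P.stateDensity q.succ = ρ ∧ (0 < ρ → P.stateVelocity q.succ = u) := by
  obtain ⟨δ, hδ, -, hsub⟩ := exists_subset_frontGap (hP.ordered a ha) h.2 h.1
  obtain ⟨y, hy⟩ := exists_between (lt_min hx (show z < z + δ by linarith))
  exact (hP.carries ha).state_eq hO hρ
    ⟨y, hxO ⟨hy.1, hy.2.trans_le (min_le_left _ _)⟩,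
      hsub ⟨hy.1, hy.2.trans_le (min_le_right _ _)⟩⟩

theorem Represents.last_state (hP : P.Represents U) {a : ℝ} (ha : 0 ≤ a) {O : Set ℝ} {ρ u x : ℝ}
    (hO : U.HasState a O ρ u) (hρ : 0 ≤ ρ) (hxO : Ioi x ⊆ O) :
    P.stateDensity (Fin.last N) = ρ ∧ (0 < ρ → P.stateVelocity (Fin.last N) = u) := by
  obtain ⟨y, hy⟩ : ∃ y, ∀ k, P.front k a < y ∧ x < y := by
    have : ∀ᶠ y in atTop, ∀ k, P.front k a < y ∧ x < y := by
      rw [eventually_all]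
      exact fun k => (eventually_gt_atTop _).and (eventually_gt_atTop _)
    exact this.exists
  refine (hP.carries ha).state_eq hO hρ ⟨max y (x + 1), hxO ?_, fun i => ⟨fun _ => ?_, fun hi => ?_⟩⟩
  · exact (lt_add_one x).trans_le (le_max_right _ _)
  · exact (hy i).1.trans_le (le_max_left _ _)
  · exact absurd i.2 (not_lt.2 hi)

theorem Represents.sum_strength_eq (hP : P.Represents U) {a : ℝ} (ha : 0 ≤ a) {z : ℝ}
    {p q : Fin N} (h : P.IsFiber a z p q) {m : ℝ} (hm : 0 ≤ m)
    (hd : U.density a {z} = ENNReal.ofReal m) :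
    ∑ k ∈ Finset.Icc p q, P.strength k a = m := by
  have h1 := (hP.carries ha).density_singleton z (B := Finset.Icc p q)
    (fun k => by rw [h.2 k, Finset.mem_Icc])
  rw [hd] at h1
  exact ((ENNReal.ofReal_eq_ofReal_iff hm
    (Finset.sum_nonneg fun k _ => hP.strength_nonneg k a ha)).1 h1).symm

/-- There is a front at a point where the density jumps. -/
theorem Represents.exists_front_of_jump (hP : P.Represents U) {a : ℝ} (ha : 0 ≤ a) {z x y : ℝ}
    {O O' : Set ℝ} {ρ u ρ' u' : ℝ} (hO : U.HasState a O ρ u) (hO' : U.HasState a O' ρ' u')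
    (hρ : 0 ≤ ρ) (hρ' : 0 ≤ ρ') (hx : x < z) (hxO : Ioo x z ⊆ O) (hy : z < y)
    (hyO : Ioo z y ⊆ O') (hne : ρ ≠ ρ') : ∃ k, P.front k a = z := by
  by_contra! hcon
  obtain ⟨j, hj⟩ := mem_frontGap_of_forall_ne (hP.ordered a ha) hcon
  obtain ⟨δ, hδ, hball⟩ := Metric.isOpen_iff.1 (isOpen_frontGap _ j) z hj
  rw [Real.ball_eq_Ioo] at hball
  obtain ⟨w, hw⟩ := exists_between (max_lt hx (show z - δ < z by linarith))
  obtain ⟨w', hw'⟩ := exists_between (lt_min hy (show z < z + δ by linarith))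
  have h1 := (hP.carries ha).state_eq hO hρ (j := j) ⟨w, hxO ⟨(le_max_left _ _).trans_lt hw.1, hw.2⟩,
      hball ⟨(le_max_right _ _).trans_lt hw.1, by linarith [hw.2]⟩⟩
  have h2 := (hP.carries ha).state_eq hO' hρ' (j := j)
    ⟨w', hyO ⟨hw'.1, hw'.2.trans_le (min_le_left _ _)⟩,
      hball ⟨by linarith [hw'.1], hw'.2.trans_le (min_le_right _ _)⟩⟩
  exact hne (h1.1.symm.trans h2.1)

theorem Represents.exists_front_of_mass (hP : P.Represents U) {a : ℝ} (ha : 0 ≤ a) {z : ℝ}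
    (hz : U.density a {z} ≠ 0) : ∃ k, P.front k a = z := by
  by_contra! hcon
  refine hz ?_
  rw [(hP.carries ha).density_singleton z (B := ∅) (fun k => by simp [hcon k])]
  simp

/-- If the contributions of the fronts from every point are known then so are all moments. -/
theorem Represents.moment_eq_sum_fibers (hP : P.Represents U) {a t : ℝ} (ha : 0 ≤ a) (ht : 0 ≤ t)
    {i : ℕ} {φ : ℝ → ℝ} (hφ : Integrable φ) {g : ℝ → ℝ}
    (hg : ∀ z p q, P.IsFiber a z p q → ∑ k ∈ Finset.Icc p q,
      (P.jump i k * primitive φ (P.front k t) +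
        P.strength k t * U.velocity t (P.front k t) ^ i * φ (P.front k t)) = g z) :
    U.moment i φ t = P.stateDensity (Fin.last N) * P.stateVelocity (Fin.last N) ^ i * (∫ x, φ x) +
      ∑ z ∈ Finset.univ.image (fun k => P.front k a), g z := by
  classical
  rw [hP.moment_eq ht hφ]
  congr 1
  rw [← Finset.sum_fiberwise_of_maps_to (s := Finset.univ)
    (t := Finset.univ.image fun k => P.front k a) (g := fun k => P.front k a)
    (fun k hk => Finset.mem_image_of_mem _ hk)]
  refine Finset.sum_congr rfl fun z hz => ?_
  obtain ⟨k₀, -, rfl⟩ := Finset.mem_image.1 hz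
  obtain ⟨p, q, hp, hq, hpq⟩ := exists_fiber_eq (hP.ordered a ha) (k₀ := k₀)
  rw [← hg (P.front k₀ a) p q ⟨hp.trans hq, hpq⟩]
  refine Finset.sum_congr ?_ fun _ _ => rfl
  ext k
  simp only [Finset.mem_filter, Finset.mem_univ, true_and, Finset.mem_Icc]
  exact hpq k

/-- A fiber is determined by its first and last index, so there are finitely many and the short
times can be chosen in common. -/
theorem eventually_forall_fiber {a : ℝ} {l : Filter ℝ} {C : ℝ → ℝ → Fin N → Fin N → Prop}
    (h : ∀ z p q, P.IsFiber a z p q → ∀ᶠ t in l, C t z p q) :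
    ∀ᶠ t in l, ∀ z p q, P.IsFiber a z p q → C t z p q := by
  have : ∀ᶠ t in l, ∀ p q, P.IsFiber a (P.front p a) p q → C t (P.front p a) p q := by
    simp only [eventually_all]
    intro p q hpq
    exact h _ p q hpq
  filter_upwards [this] with t ht z p q hpq
  have hz : P.front p a = z := (hpq.2 p).2 ⟨le_rfl, hpq.1⟩
  subst hz
  exact ht p q hpq

end WavePattern


/-! ### Riemann problems and their dissipation -/

/-- The speed of the delta shock between `(ρl, ul)` and `(ρr, ur)`. -/
noncomputable def deltaShockSpeed (ρl ul ρr ur : ℝ) : ℝ := (√ρl * ul + √ρr * ur) / (√ρl + √ρr)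

theorem sub_deltaShockSpeed {ρl ul ρr ur : ℝ} (hl : 0 < ρl) :
    ul - deltaShockSpeed ρl ul ρr ur = √ρr * (ul - ur) / (√ρl + √ρr) := by
  have : 0 < √ρl + √ρr := add_pos_of_pos_of_nonneg (Real.sqrt_pos.2 hl) (Real.sqrt_nonneg _)
  rw [deltaShockSpeed]; field_simp; ring

theorem deltaShockSpeed_sub {ρl ul ρr ur : ℝ} (hl : 0 < ρl) :
    deltaShockSpeed ρl ul ρr ur - ur = √ρl * (ul - ur) / (√ρl + √ρr) := by
  have : 0 < √ρl + √ρr := add_pos_of_pos_of_nonneg (Real.sqrt_pos.2 hl) (Real.sqrt_nonneg _)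
  rw [deltaShockSpeed]; field_simp; ring

/-- In the rest frame of the shock the momentum fluxes from its two sides are equal. This is what
keeps its speed constant whatever mass it has gathered. -/
theorem deltaShockSpeed_balance {ρl ul ρr ur : ℝ} (hl : 0 < ρl) (hr : 0 < ρr) :
    ρl * (ul - deltaShockSpeed ρl ul ρr ur) ^ 2 = ρr * (deltaShockSpeed ρl ul ρr ur - ur) ^ 2 := by
  rw [sub_deltaShockSpeed hl, deltaShockSpeed_sub hl, div_pow, div_pow, mul_pow, mul_pow,
    Real.sq_sqrt hl.le, Real.sq_sqrt hr.le]
  ring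

theorem deltaShockSpeed_lt {ρl ul ρr ur : ℝ} (hl : 0 < ρl) (hr : 0 < ρr) (h : ur < ul) :
    deltaShockSpeed ρl ul ρr ur < ul := by
  rw [← sub_pos, sub_deltaShockSpeed hl]
  have := Real.sqrt_pos.2 hl
  have := Real.sqrt_pos.2 hr
  have := sub_pos.2 h
  positivity

theorem lt_deltaShockSpeed {ρl ul ρr ur : ℝ} (hl : 0 < ρl) (h : ur < ul) :
    ur < deltaShockSpeed ρl ul ρr ur := by
  rw [← sub_pos, deltaShockSpeed_sub hl]
  have := Real.sqrt_pos.2 hl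
  have := Real.sqrt_nonneg ρr
  have := sub_pos.2 h
  positivity

theorem deltaShockSpeed_mass {ρl ul ρr ur : ℝ} (hl : 0 < ρl) (hr : 0 < ρr) :
    ρl * (ul - deltaShockSpeed ρl ul ρr ur) + ρr * (deltaShockSpeed ρl ul ρr ur - ur) =
      √(ρl * ρr) * (ul - ur) := by
  have h1 := Real.sqrt_pos.2 hl
  have h2 := Real.sqrt_pos.2 hr
  rw [sub_deltaShockSpeed hl, deltaShockSpeed_sub hl, Real.sqrt_mul hl.le]
  have e1 := Real.sq_sqrt hl.le
  have e2 := Real.sq_sqrt hr.le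
  field_simp
  linear_combination (ul - ur) * (-√ρr * e1 - √ρl * e2)

/-- Twice the energy that the Riemann problem dissipates in unit time. -/
noncomputable def dissipation (ρl ul ρr ur : ℝ) : ℝ :=
  ρl * ρr / (√ρl + √ρr) ^ 2 * max (ul - ur) 0 ^ 3

/-- The loss `ρl (ul - y)³ + ρr (y - ur)³` collapses, by the equality of the momentum fluxes, to `ρl
(ul - y)² (ul - ur)`. -/
theorem deltaShock_energy {ρl ul ρr ur : ℝ} (hl : 0 < ρl) (hr : 0 < ρr) (h : ur < ul) :
    (ρl * ul ^ 2 - ρr * ur ^ 2) * deltaShockSpeed ρl ul ρr ur +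
      (ρl * (ul - deltaShockSpeed ρl ul ρr ur) + ρr * (deltaShockSpeed ρl ul ρr ur - ur)) *
        deltaShockSpeed ρl ul ρr ur ^ 2 =
      ρl * ul ^ 3 - ρr * ur ^ 3 - dissipation ρl ul ρr ur := by
  have hd : dissipation ρl ul ρr ur =
      ρl * (ul - deltaShockSpeed ρl ul ρr ur) ^ 2 * (ul - ur) := by
    have h1 := Real.sqrt_pos.2 hl
    have h2 := Real.sqrt_pos.2 hr
    rw [dissipation, max_eq_left (sub_nonneg.2 h.le), sub_deltaShockSpeed hl, div_pow, mul_pow,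
      Real.sq_sqrt hr.le]
    ring
  have hb := deltaShockSpeed_balance (ul := ul) (ur := ur) hl hr
  rw [hd]
  linear_combination (-(deltaShockSpeed ρl ul ρr ur + ur)) * hb

/-- The contribution to the moments of the fronts that come out of the Riemann problem. -/
noncomputable def riemannTerm (ρl ul ρr ur z s : ℝ) (i : ℕ) (F φ : ℝ → ℝ) : ℝ :=
  if ur < ul then
    (ρl * ul ^ i - ρr * ur ^ i) * F (z + deltaShockSpeed ρl ul ρr ur * s) +
      (ρl * (ul - deltaShockSpeed ρl ul ρr ur) + ρr * (deltaShockSpeed ρl ul ρr ur - ur)) * s *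
        deltaShockSpeed ρl ul ρr ur ^ i * φ (z + deltaShockSpeed ρl ul ρr ur * s)
  else ρl * ul ^ i * F (z + ul * s) - ρr * ur ^ i * F (z + ur * s)

/-- Superfluous fronts of a pattern, with the same state on both sides, can therefore be ignored. -/
theorem riemannTerm_self (ρ u z s : ℝ) (i : ℕ) (F φ : ℝ → ℝ) :
    riemannTerm ρ u ρ u z s i F φ = 0 := by
  simp [riemannTerm]

theorem riemannTerm_zero (ρl ul ρr ur z : ℝ) (i : ℕ) (F φ : ℝ → ℝ) :
    riemannTerm ρl ul ρr ur z 0 i F φ = (ρl * ul ^ i - ρr * ur ^ i) * F z := by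
  simp only [riemannTerm, mul_zero, add_zero]
  split_ifs <;> ring

theorem eventually_mem_near (z v : ℝ) {I : Set ℝ} (hI : IsOpen I) (hz : z ∈ I) :
    ∀ᶠ s in 𝓝[≥] (0 : ℝ), z + v * s ∈ I := by
  have : Tendsto (fun s : ℝ => z + v * s) (𝓝[≥] 0) (𝓝 (z + v * 0)) :=
    ((continuous_const.add (continuous_const.mul continuous_id)).tendsto 0).mono_left
      nhdsWithin_le_nhds
  rw [mul_zero, add_zero] at this
  exact this (hI.mem_nhds hz)

/-- `F` and `φ` stand for the primitive and the values of the indicator of `[-L, L]`. While the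
outgoing fronts stay inside the window, everything is affine in `s`. -/
theorem riemannTerm_energy {ρl ul ρr ur z : ℝ} (hl : 0 < ρl) (hr : 0 < ρr) {L : ℝ}
    (hz : z ∈ Ioo (-L) L) {F φ : ℝ → ℝ} (hF : ∀ x ∈ Ioo (-L) L, F x = x + L)
    (hφ : ∀ x ∈ Ioo (-L) L, φ x = 1) :
    ∀ᶠ s in 𝓝[≥] (0 : ℝ), riemannTerm ρl ul ρr ur z s 2 F φ =
      (ρl * ul ^ 2 - ρr * ur ^ 2) * (z + L) +
        (ρl * ul ^ 3 - ρr * ur ^ 3 - dissipation ρl ul ρr ur) * s := by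
  by_cases h : ur < ul
  · filter_upwards [eventually_mem_near z (deltaShockSpeed ρl ul ρr ur) isOpen_Ioo hz] with s hs
    rw [riemannTerm, if_pos h, hF _ hs, hφ _ hs, ← deltaShock_energy hl hr h]
    ring
  · filter_upwards [eventually_mem_near z ul isOpen_Ioo hz,
      eventually_mem_near z ur isOpen_Ioo hz] with s h1 h2
    rw [riemannTerm, if_neg h, hF _ h1, hF _ h2, dissipation, max_eq_right (by linarith)]
    ring

namespace WavePattern

variable {N : ℕ} {P : WavePattern N} {U : GasFlow} {R : Measure ℝ} {v₀ : ℝ → ℝ}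

/-- The solution of a Riemann problem with positive densities. -/
theorem Represents.block_riemann (hP : P.Represents U) (hU : U.IsWeakSolution R v₀)
    (hE : U.EnergyAdmissible) (hO : P.Overcompressive) {a z : ℝ} (ha : 0 ≤ a)
    {p q : Fin N} (h : P.IsFiber a z p q) {ρl ul ρr ur : ℝ} (hρl : 0 < ρl) (hρr : 0 < ρr)
    (hl : P.stateDensity p.castSucc = ρl ∧ P.stateVelocity p.castSucc = ul)
    (hr : P.stateDensity q.succ = ρr ∧ P.stateVelocity q.succ = ur)
    (hm : ∑ k ∈ Finset.Icc p q, P.strength k a = 0) :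
    ∀ᶠ t in 𝓝[>] a, ∀ (i : ℕ) (F φ : ℝ → ℝ),
      ∑ k ∈ Finset.Icc p q, (P.jump i k * F (P.front k t) +
          P.strength k t * U.velocity t (P.front k t) ^ i * φ (P.front k t)) =
        riemannTerm ρl ul ρr ur z (t - a) i F φ := by
  obtain ⟨rfl, rfl⟩ := hl
  obtain ⟨rfl, rfl⟩ := hr
  by_cases hlt : P.stateVelocity q.succ < P.stateVelocity p.castSucc
  · filter_upwards [hP.block_shock hU hE hO ha h.1 h.2 (Or.inl hm) hρl hρr
      (deltaShockSpeed_lt hρl hρr hlt) (lt_deltaShockSpeed hρl hlt)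
      (deltaShockSpeed_balance hρl hρr)] with t ht i F φ
    rw [ht, hm, riemannTerm, if_pos hlt, zero_add]
  · filter_upwards [hP.block_contact hU hE hO ha h.1 h.2 (Or.inl hm) (fun _ => le_rfl)
      (fun _ => not_lt.1 hlt)] with t ht i F φ
    rw [ht, hm, riemannTerm, if_neg hlt]; ring

end WavePattern

/-! ### The energy rate of the approximate data -/

namespace DeltaRiemannData

/-- `dH/dt` at `0+` for the approximate data with the middle velocity `w`. -/
noncomputable def energyRate (D : DeltaRiemannData) (μ w : ℝ) : ℝ :=
  1 / 2 * (D.ρ₀ * D.u₀ ^ 3 - D.ρ₁ * D.u₁ ^ 3 - dissipation D.ρ₀ D.u₀ (D.ξ / μ) w -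
    dissipation (D.ξ / μ) w D.ρ₁ D.u₁)

variable {D : DeltaRiemannData} {μ w : ℝ}

theorem approx_hasState {U : GasFlow} (hμ : 0 < μ)
    (hU : U.IsWeakSolution (D.approxDensity μ) (D.approxVelocity μ w)) :
    U.HasState 0 (Iio (-(μ / 2))) D.ρ₀ D.u₀ ∧ U.HasState 0 (Ioo (-(μ / 2)) (μ / 2)) (D.ξ / μ) w ∧
      U.HasState 0 (Ioi (μ / 2)) D.ρ₁ D.u₁ := by
  have hres : ∀ (O : Set ℝ), MeasurableSet O → (D.approxDensity μ).restrict O =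
      ENNReal.ofReal D.ρ₀ • volume.restrict (O ∩ Iio (-(μ / 2))) +
      ENNReal.ofReal (D.ξ / μ) • volume.restrict (O ∩ Ioo (-(μ / 2)) (μ / 2)) +
      ENNReal.ofReal D.ρ₁ • volume.restrict (O ∩ Ioi (μ / 2)) := fun O hO => by
    simp [approxDensity, Measure.restrict_restrict hO]
  have hvel : ∀ (O : Set ℝ) (c : ℝ), MeasurableSet O → (∀ x ∈ O, D.approxVelocity μ w x = c) →
      ∀ᵐ x ∂(U.density 0).restrict O, U.velocity 0 x = c := fun O c hO h => by
    rw [hU.density_zero]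
    filter_upwards [ae_restrict_of_ae hU.velocity_zero, ae_restrict_mem hO] with x h1 h2
    rw [h1, h x h2]
  refine ⟨⟨isOpen_Iio, ?_, hvel _ _ measurableSet_Iio fun x hx => ?_⟩,
    ⟨isOpen_Ioo, ?_, hvel _ _ measurableSet_Ioo fun x hx => ?_⟩,
    ⟨isOpen_Ioi, ?_, hvel _ _ measurableSet_Ioi fun x hx => ?_⟩⟩
  · have e1 : Iio (-(μ / 2)) ∩ Ioo (-(μ / 2)) (μ / 2) = ∅ :=
      eq_empty_of_forall_notMem fun x hx => by grind
    have e2 : Iio (-(μ / 2)) ∩ Ioi (μ / 2) = ∅ :=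
      eq_empty_of_forall_notMem fun x hx => by grind
    rw [hU.density_zero, hres _ measurableSet_Iio, e1, e2]; simp
  · exact if_pos hx
  · have e1 : Ioo (-(μ / 2)) (μ / 2) ∩ Iio (-(μ / 2)) = ∅ :=
      eq_empty_of_forall_notMem fun x hx => by grind
    have e2 : Ioo (-(μ / 2)) (μ / 2) ∩ Ioi (μ / 2) = ∅ :=
      eq_empty_of_forall_notMem fun x hx => by grind
    rw [hU.density_zero, hres _ measurableSet_Ioo, e1, e2]; simp
  · rw [approxVelocity, if_neg (not_lt.2 hx.1.le), if_pos hx.2]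
  · have e1 : Ioi (μ / 2) ∩ Iio (-(μ / 2)) = ∅ :=
      eq_empty_of_forall_notMem fun x hx => by grind
    have e2 : Ioi (μ / 2) ∩ Ioo (-(μ / 2)) (μ / 2) = ∅ :=
      eq_empty_of_forall_notMem fun x hx => by grind
    rw [hU.density_zero, hres _ measurableSet_Ioi, e1, e2]; simp
  · rw [mem_Ioi] at hx
    rw [approxVelocity, if_neg (by linarith), if_neg (by linarith)]

theorem approxDensity_singleton (D : DeltaRiemannData) (μ z : ℝ) : D.approxDensity μ {z} = 0 := by
  have h : ∀ s : Set ℝ, (volume.restrict s) {z} = 0 := fun s =>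
    le_antisymm ((Measure.restrict_apply_le _ _).trans (by simp)) zero_le
  simp [approxDensity, h]

/-- For every admissible solution of the approximate problem the energy in `[-L, L]` is
differentiable at `0+` and the derivative depends on the data only. -/
theorem energyOn_hasDerivWithinAt (h₀ : 0 < D.ρ₀) (h₁ : 0 < D.ρ₁) {L : ℝ} (hμ : 0 < μ)
    (hμL : μ < 2 * L) (hμ₀ : D.ρ₀ < D.ξ / μ) (hμ₁ : D.ρ₁ < D.ξ / μ) {U : GasFlow}
    (hU : IsAdmissibleSolution U (D.approxDensity μ) (D.approxVelocity μ w)) :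
    HasDerivWithinAt (U.energyOn L) (D.energyRate μ w) (Ici 0) 0 := by
  obtain ⟨hW, hE, N, P, hP, hO⟩ := hU
  obtain ⟨hs₀, hs, hs₁⟩ := D.approx_hasState hμ hW
  have hr : 0 < D.ξ / μ := h₀.trans hμ₀
  -- The formulas for the moments need only integrability, so the sharp window can replace a test
  -- function.
  set φ : ℝ → ℝ := (Icc (-L) L).indicator 1 with hφ
  have hφi : Integrable φ := (integrable_indicator_iff measurableSet_Icc).2
    continuous_one.integrableOn_Icc
  have hen : ∀ t, U.energyOn L t = 1 / 2 * U.moment 2 φ t := fun t => by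
    rw [GasFlow.energyOn, integral_const_mul, GasFlow.moment, ← integral_indicator measurableSet_Icc]
    congr 2
    ext x
    by_cases hx : x ∈ Icc (-L) L <;> simp [hφ, hx]
  have hφ1 : ∀ x ∈ Ioo (-L) L, φ x = 1 := fun x hx => by simp [hφ, Ioo_subset_Icc_self hx]
  have hF : ∀ x ∈ Ioo (-L) L, primitive φ x = x + L := fun x hx => by
    have : Iic x ∩ Icc (-L) L = Icc (-L) x := by
      ext y; simp only [mem_inter_iff, mem_Iic, mem_Icc]
      exact ⟨fun h => ⟨h.2.1, h.1⟩, fun h => ⟨h.2, h.1, h.2.trans hx.2.le⟩⟩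
    rw [primitive, hφ, setIntegral_indicator measurableSet_Icc, this]
    simp; linarith [hx.1]
  -- the contribution of the fronts
  let g : ℝ → ℝ → ℝ := fun z t =>
    if z = -(μ / 2) then riemannTerm D.ρ₀ D.u₀ (D.ξ / μ) w z t 2 (primitive φ) φ
    else if z = μ / 2 then riemannTerm (D.ξ / μ) w D.ρ₁ D.u₁ z t 2 (primitive φ) φ else 0
  have hmass : ∀ z p q, P.IsFiber 0 z p q → ∑ k ∈ Finset.Icc p q, P.strength k 0 = 0 :=
    fun z p q h => hP.sum_strength_eq le_rfl h le_rfl (by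
      rw [hW.density_zero, approxDensity_singleton]; simp)
  have hstates : ∀ z p q, P.IsFiber 0 z p q →
      (∃ ρ > 0, ∃ u, P.stateDensity p.castSucc = ρ ∧ P.stateVelocity p.castSucc = u ∧
        P.stateDensity q.succ = ρ ∧ P.stateVelocity q.succ = u ∧
        z ≠ -(μ / 2) ∧ z ≠ μ / 2) ∨
      (z = -(μ / 2) ∧ (P.stateDensity p.castSucc = D.ρ₀ ∧ P.stateVelocity p.castSucc = D.u₀) ∧
        P.stateDensity q.succ = D.ξ / μ ∧ P.stateVelocity q.succ = w) ∨
      (z = μ / 2 ∧ (P.stateDensity p.castSucc = D.ξ / μ ∧ P.stateVelocity p.castSucc = w) ∧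
        P.stateDensity q.succ = D.ρ₁ ∧ P.stateVelocity q.succ = D.u₁) := by
    intro z p q h
    rcases lt_trichotomy z (-(μ / 2)) with hz | hz | hz
    · have a1 := hP.left_state le_rfl h hs₀ h₀.le (show z - 1 < z by linarith)
        (fun y hy => hy.2.trans hz)
      have a2 := hP.right_state le_rfl h hs₀ h₀.le hz (fun y hy => hy.2)
      exact Or.inl ⟨_, h₀, _, a1.1, a1.2 h₀, a2.1, a2.2 h₀, hz.ne, by linarith⟩
    · have a1 := hP.left_state le_rfl h hs₀ h₀.le (show z - 1 < z by linarith)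
        (fun y hy => hy.2.trans_eq hz)
      have a2 := hP.right_state le_rfl h hs hr.le (show z < μ / 2 by linarith)
        (fun y hy => ⟨hz.symm.trans_lt hy.1, hy.2⟩)
      exact Or.inr (Or.inl ⟨hz, ⟨a1.1, a1.2 h₀⟩, a2.1, a2.2 hr⟩)
    · rcases lt_trichotomy z (μ / 2) with hz' | hz' | hz'
      · have a1 := hP.left_state le_rfl h hs hr.le hz (fun y hy => ⟨hy.1, hy.2.trans hz'⟩)
        have a2 := hP.right_state le_rfl h hs hr.le hz' (fun y hy => ⟨hz.trans hy.1, hy.2⟩)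
        exact Or.inl ⟨_, hr, _, a1.1, a1.2 hr, a2.1, a2.2 hr, hz.ne', hz'.ne⟩
      · have a1 := hP.left_state le_rfl h hs hr.le hz (fun y hy => ⟨hy.1, hy.2.trans_eq hz'⟩)
        have a2 := hP.right_state le_rfl h hs₁ h₁.le (show z < z + 1 by linarith)
          (fun y hy => hz'.symm.trans_lt hy.1)
        exact Or.inr (Or.inr ⟨hz', ⟨a1.1, a1.2 hr⟩, a2.1, a2.2 h₁⟩)
      · have a1 := hP.left_state le_rfl h hs₁ h₁.le hz' (fun y hy => hy.1)
        have a2 := hP.right_state le_rfl h hs₁ h₁.le (show z < z + 1 by linarith)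
          (fun y hy => hz'.trans hy.1)
        exact Or.inl ⟨_, h₁, _, a1.1, a1.2 h₁, a2.1, a2.2 h₁, hz.ne', hz'.ne'⟩
  have hne : -(μ / 2) ≠ μ / 2 := by linarith
  have hg : ∀ᶠ t in 𝓝[≥] (0 : ℝ), ∀ z p q, P.IsFiber 0 z p q → ∑ k ∈ Finset.Icc p q,
      (P.jump 2 k * primitive φ (P.front k t) +
        P.strength k t * U.velocity t (P.front k t) ^ 2 * φ (P.front k t)) = g z t := by
    -- The one-sided derivative also involves the value at `t = 0`, where the laws for `t > 0` say
    -- nothing; there all strengths are zero.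
    have hsplit : 𝓝[≥] (0 : ℝ) = pure 0 ⊔ 𝓝[>] 0 := by
      rw [← Ici_sdiff_left (a := (0 : ℝ)), ← nhdsWithin_singleton, ← nhdsWithin_union]
      simp
    rw [hsplit, eventually_sup]
    constructor
    · rw [eventually_pure]
      intro z p q h
      have h1 : ∑ k ∈ Finset.Icc p q, (P.jump 2 k * primitive φ (P.front k 0) +
          P.strength k 0 * U.velocity 0 (P.front k 0) ^ 2 * φ (P.front k 0)) =
          (P.stateDensity p.castSucc * P.stateVelocity p.castSucc ^ 2 -
            P.stateDensity q.succ * P.stateVelocity q.succ ^ 2) * primitive φ z := by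
        have hz : ∀ k ∈ Finset.Icc p q, P.front k 0 = z := fun k hk =>
          (h.2 k).2 (Finset.mem_Icc.1 hk)
        have hj := sum_gapJump_mul (fun j => P.stateDensity j * P.stateVelocity j ^ 2)
          (fun _ => primitive φ z) h.1 (fun _ _ _ _ _ => Or.inr rfl)
        rw [sub_mul, ← hj]
        have hk0 := (Finset.sum_eq_zero_iff_of_nonneg
          (fun k _ => hP.strength_nonneg k 0 le_rfl)).1 (hmass z p q h)
        refine Finset.sum_congr rfl fun k hk => ?_
        rw [hk0 k hk, hz k hk, WavePattern.jump]; ring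
      rw [h1]
      rcases hstates z p q h with ⟨ρ, -, u, e1, e2, e3, e4, n1, n2⟩ | ⟨hz, ⟨e1, e2⟩, e3, e4⟩ |
        ⟨hz, ⟨e1, e2⟩, e3, e4⟩
      · simp [g, n1, n2, e1, e2, e3, e4]
      · simp only [g, if_pos hz, riemannTerm_zero, e1, e2, e3, e4]
      · simp only [g, if_neg (show z ≠ -(μ / 2) from hz ▸ hne.symm), if_pos hz, riemannTerm_zero,
          e1, e2, e3, e4]
    · refine WavePattern.eventually_forall_fiber fun z p q h => ?_
      rcases hstates z p q h with ⟨ρ, hρ, u, e1, e2, e3, e4, n1, n2⟩ | ⟨hz, hl, hr'⟩ |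
        ⟨hz, hl, hr'⟩
      · filter_upwards [hP.block_riemann hW hE hO le_rfl h hρ hρ ⟨e1, e2⟩ ⟨e3, e4⟩
          (hmass z p q h)] with t ht
        rw [ht, riemannTerm_self]
        simp [g, n1, n2]
      · filter_upwards [hP.block_riemann hW hE hO le_rfl h h₀ hr hl hr' (hmass z p q h)] with t ht
        rw [ht, sub_zero]
        simp only [g, if_pos hz]
      · filter_upwards [hP.block_riemann hW hE hO le_rfl h hr h₁ hl hr' (hmass z p q h)] with t ht
        rw [ht, sub_zero]
        simp only [g, if_neg (show z ≠ -(μ / 2) from hz ▸ hne.symm), if_pos hz]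
  -- the energy is an affine function
  have hz₀ : ∃ k, P.front k 0 = -(μ / 2) :=
    hP.exists_front_of_jump le_rfl hs₀ hs h₀.le hr.le (show -(μ / 2) - 1 < -(μ / 2) by linarith)
      (fun y hy => hy.2) (show -(μ / 2) < μ / 2 by linarith) (fun y hy => hy) hμ₀.ne
  have hz₁ : ∃ k, P.front k 0 = μ / 2 :=
    hP.exists_front_of_jump le_rfl hs hs₁ hr.le h₁.le (show -(μ / 2) < μ / 2 by linarith)
      (fun y hy => hy) (show μ / 2 < μ / 2 + 1 by linarith) (fun y hy => hy.1) hμ₁.ne'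
  -- Both points occur in the sum because `ξ/μ` exceeds `ρ₀` and `ρ₁`: a jump of the density needs a
  -- front. All other points contribute zero.
  have hsum : ∀ t, ∑ z ∈ Finset.univ.image (fun k => P.front k 0), g z t =
      g (-(μ / 2)) t + g (μ / 2) t := by
    intro t
    rw [← Finset.sum_pair (f := fun z => g z t) hne]
    refine (Finset.sum_subset ?_ fun z _ hz => ?_).symm
    · intro z hz
      rw [Finset.mem_insert, Finset.mem_singleton] at hz
      rcases hz with rfl | rfl
      · obtain ⟨k, hk⟩ := hz₀; exact Finset.mem_image.2 ⟨k, Finset.mem_univ k, hk⟩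
      · obtain ⟨k, hk⟩ := hz₁; exact Finset.mem_image.2 ⟨k, Finset.mem_univ k, hk⟩
    · simp only [Finset.mem_insert, Finset.mem_singleton, not_or] at hz
      simp [g, hz.1, hz.2]
  set C := P.stateDensity (Fin.last N) * P.stateVelocity (Fin.last N) ^ 2 * (∫ x, φ x)
  have haff : U.energyOn L =ᶠ[𝓝[≥] 0] fun t => 1 / 2 * (C +
      (D.ρ₀ * D.u₀ ^ 2 - D.ξ / μ * w ^ 2) * (-(μ / 2) + L) +
      (D.ξ / μ * w ^ 2 - D.ρ₁ * D.u₁ ^ 2) * (μ / 2 + L)) + D.energyRate μ w * t := by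
    filter_upwards [hg, self_mem_nhdsWithin,
      riemannTerm_energy h₀ hr (ul := D.u₀) (ur := w) (L := L) (z := -(μ / 2))
        ⟨by linarith, by linarith⟩ hF hφ1,
      riemannTerm_energy hr h₁ (ul := w) (ur := D.u₁) (L := L) (z := μ / 2)
        ⟨by linarith, by linarith⟩ hF hφ1] with t ht ht0 e1 e2
    rw [hen, hP.moment_eq_sum_fibers le_rfl ht0 hφi (ht), hsum]
    simp only [g, if_true, if_neg hne.symm]
    rw [e1, e2, energyRate]
    ring
  refine HasDerivWithinAt.congr_of_eventuallyEq ?_ haff (haff.eq_of_nhdsWithin self_mem_Ici)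
  have := (((hasDerivAt_id (0 : ℝ)).const_mul (D.energyRate μ w)).const_add (1 / 2 * (C +
      (D.ρ₀ * D.u₀ ^ 2 - D.ξ / μ * w ^ 2) * (-(μ / 2) + L) +
      (D.ξ / μ * w ^ 2 - D.ρ₁ * D.u₁ ^ 2) * (μ / 2 + L)))).hasDerivWithinAt (s := Ici 0)
  simpa using this

end DeltaRiemannData


/-! ### Recovering the flow from its moments, and continuation in time -/

/-- Locally finite measures are determined by the integrals of the test functions. -/
theorem measure_eq_of_integral_test_eq {ρ ρ' : Measure ℝ} [IsLocallyFiniteMeasure ρ]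
    [IsLocallyFiniteMeasure ρ'] (h : ∀ φ, IsTestFunction φ → ∫ x, φ x ∂ρ = ∫ x, φ x ∂ρ') :
    ρ = ρ' := by
  -- With respect to their sum both measures have densities at most one, hence locally integrable,
  -- and the fundamental lemma of the calculus of variations compares these.
  set σ := ρ + ρ' with hσ
  have : IsLocallyFiniteMeasure σ := ⟨fun x => by
    obtain ⟨s, hs, hs'⟩ := ρ.finiteAt_nhds x
    obtain ⟨r, hr, hr'⟩ := ρ'.finiteAt_nhds x
    refine ⟨s ∩ r, inter_mem hs hr, ?_⟩
    rw [hσ, Measure.add_apply]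
    exact ENNReal.add_lt_top.2 ⟨(measure_mono inter_subset_left).trans_lt hs',
      (measure_mono inter_subset_right).trans_lt hr'⟩⟩
  have hle : ρ ≤ σ := Measure.le_add_right le_rfl
  have hle' : ρ' ≤ σ := Measure.le_add_left le_rfl
  have hac := Measure.absolutelyContinuous_of_le hle
  have hac' := Measure.absolutelyContinuous_of_le hle'
  have hloc : ∀ ν : Measure ℝ, ν ≤ σ → SigmaFinite ν →
      LocallyIntegrable (fun x => (ν.rnDeriv σ x).toReal) σ := fun ν hν _ => by
    refine (locallyIntegrable_const (1 : ℝ)).mono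
      (Measure.measurable_rnDeriv ν σ).ennreal_toReal.aestronglyMeasurable ?_
    filter_upwards [Measure.rnDeriv_le_one_of_le hν] with x hx
    simpa using ENNReal.toReal_mono ENNReal.one_ne_top hx
  have hae := ae_eq_of_integral_contDiff_smul_eq (hloc ρ hle inferInstance)
    (hloc ρ' hle' inferInstance) (fun φ h1 h2 => by
      have e1 := integral_rnDeriv_smul hac (f := φ)
      have e2 := integral_rnDeriv_smul hac' (f := φ)
      simp only [smul_eq_mul, mul_comm (φ _)] at e1 e2 ⊢
      rw [e1, e2, h φ ⟨h1, h2⟩])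
  rw [← Measure.withDensity_rnDeriv_eq ρ σ hac, ← Measure.withDensity_rnDeriv_eq ρ' σ hac']
  refine withDensity_congr_ae ?_
  filter_upwards [hae, Measure.rnDeriv_lt_top ρ σ, Measure.rnDeriv_lt_top ρ' σ] with x h1 h2 h3
  exact (ENNReal.toReal_eq_toReal_iff' h2.ne h3.ne).1 h1

namespace GasFlow

/-- The densities and the momenta of the two flows are the same at time `t`. -/
def AgreeAt (U V : GasFlow) (t : ℝ) : Prop :=
  ∀ φ, IsTestFunction φ → U.moment 0 φ t = V.moment 0 φ t ∧ U.moment 1 φ t = V.moment 1 φ t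

variable {U V : GasFlow} {R R' : Measure ℝ} {v v' : ℝ → ℝ}

theorem IsWeakSolution.locallyIntegrable_velocity (hU : U.IsWeakSolution R v) {t : ℝ}
    (ht : 0 ≤ t) : LocallyIntegrable (U.velocity t) (U.density t) := by
  have := hU.locallyFinite t ht
  obtain ⟨K, hK⟩ := hU.bounded
  refine (locallyIntegrable_const K).mono (hU.measurable t ht).aestronglyMeasurable ?_
  filter_upwards [hK t ht] with x hx
  exact hx.trans (le_abs_self K)

/-- Once the densities are known to be equal, both velocities are locally integrable densities of
the momentum with respect to the same measure. -/
theorem IsWeakSolution.eq_of_agreeAt (hU : U.IsWeakSolution R v) (hV : V.IsWeakSolution R' v')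
    {t : ℝ} (ht : 0 ≤ t) (h : U.AgreeAt V t) :
    U.density t = V.density t ∧ U.velocity t =ᵐ[U.density t] V.velocity t := by
  have := hU.locallyFinite t ht
  have := hV.locallyFinite t ht
  have hd : U.density t = V.density t := measure_eq_of_integral_test_eq fun φ hφ => by
    simpa [moment] using (h φ hφ).1
  refine ⟨hd, ae_eq_of_integral_contDiff_smul_eq (hU.locallyIntegrable_velocity ht)
    (hd ▸ hV.locallyIntegrable_velocity ht) fun φ h1 h2 => ?_⟩
  have := (h φ ⟨h1, h2⟩).2
  simp only [moment, pow_one] at this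
  rwa [← hd] at this

theorem Equiv.moment_eq (h : U.Equiv V) (i : ℕ) (φ : ℝ → ℝ) {t : ℝ} (ht : 0 ≤ t) :
    U.moment i φ t = V.moment i φ t := by
  rw [moment, moment, ← (h t ht).1]
  refine integral_congr_ae ?_
  filter_upwards [(h t ht).2] with x hx
  rw [hx]

theorem agreeAt_of_ae (hd : U.density 0 = V.density 0)
    (hv : U.velocity 0 =ᵐ[U.density 0] V.velocity 0) : U.AgreeAt V 0 := by
  have key : ∀ i φ, U.moment i φ 0 = V.moment i φ 0 := fun i φ => by
    rw [moment, moment, ← hd]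
    refine integral_congr_ae ?_
    filter_upwards [hv] with x hx
    rw [hx]
  exact fun φ _ => ⟨key 0 φ, key 1 φ⟩

/-- The weak laws make mass and momentum moments continuous in time, which is why agreement of two
flows is a closed condition. -/
theorem continuousOn_of_integral {f g : ℝ → ℝ} (h : ∀ s t, 0 ≤ s → s ≤ t →
    IntervalIntegrable g volume s t ∧ f t - f s = ∫ τ in s..t, g τ) (T : ℝ) :
    ContinuousOn f (Icc 0 T) := by
  rcases lt_or_ge T 0 with hT | hT
  · simp [Icc_eq_empty (not_le.2 hT)]
  have h1 := intervalIntegral.continuousOn_primitive_interval (μ := volume) (f := g) (a := 0) (b := T)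
    ((intervalIntegrable_iff_integrableOn_Icc_of_le hT).1 (h 0 T le_rfl hT).1 |>.mono_set
      (by rw [uIcc_of_le hT]))
  rw [uIcc_of_le hT] at h1
  refine (h1.const_add (f 0)).congr fun t ht => ?_
  have := (h 0 t le_rfl ht.1).2
  simp only
  linarith

/-- Two solutions with the same data are the same if they remain the same for a short time
whenever they have been the same until then. -/
theorem IsWeakSolution.equiv_of_step (hU : U.IsWeakSolution R v) (hV : V.IsWeakSolution R v)
    (hstep : ∀ a, 0 ≤ a → U.density a = V.density a →
      U.velocity a =ᵐ[U.density a] V.velocity a → ∀ᶠ t in 𝓝[>] a, U.AgreeAt V t) :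
    U.Equiv V := by
  intro T hT
  refine hU.eq_of_agreeAt hV hT ?_
  have hset : {t | U.AgreeAt V t} ∩ Icc 0 T = ⋂ φ : {φ // IsTestFunction φ},
      ({t ∈ Icc 0 T | U.moment 0 φ t = V.moment 0 φ t} ∩
        {t ∈ Icc 0 T | U.moment 1 φ t = V.moment 1 φ t}) := by
    ext t
    simp only [mem_inter_iff, mem_ofPred_eq, mem_iInter, AgreeAt, Subtype.forall]
    exact ⟨fun h φ hφ => ⟨⟨h.2, (h.1 φ hφ).1⟩, h.2, (h.1 φ hφ).2⟩, fun h =>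
      ⟨fun φ hφ => ⟨(h φ hφ).1.2, (h φ hφ).2.2⟩,
        (h (fun _ => 0) ⟨contDiff_const, HasCompactSupport.zero⟩).1.1⟩⟩
  have hclosed : IsClosed ({t | U.AgreeAt V t} ∩ Icc 0 T) := by
    rw [hset]
    refine isClosed_iInter fun φ => IsClosed.inter ?_ ?_
    · exact ((continuousOn_of_integral (hU.mass φ φ.2) T).prodMk
        (continuousOn_of_integral (hV.mass φ φ.2) T)).preimage_isClosed_of_isClosed isClosed_Icc
        (isClosed_diagonal (X := ℝ))
    · exact ((continuousOn_of_integral (hU.momentum φ φ.2) T).prodMk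
        (continuousOn_of_integral (hV.momentum φ φ.2) T)).preimage_isClosed_of_isClosed isClosed_Icc
        (isClosed_diagonal (X := ℝ))
  have h0 : U.AgreeAt V 0 := agreeAt_of_ae (hU.density_zero.trans hV.density_zero.symm) (by
    rw [hU.density_zero]
    exact hU.velocity_zero.trans hV.velocity_zero.symm)
  exact hclosed.Icc_subset_of_forall_mem_nhdsWithin h0 (fun a ha => by
    obtain ⟨hd, hv⟩ := hU.eq_of_agreeAt hV ha.2.1 ha.1
    exact hstep a ha.2.1 hd hv) ⟨hT, le_rfl⟩

end GasFlow


/-! ### From Rankine-Hugoniot conditions to weak laws -/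

theorem hasDerivAt_primitive {φ : ℝ → ℝ} (hφ : IsTestFunction φ) (x : ℝ) :
    HasDerivAt (primitive φ) (φ x) x := by
  have h1 : primitive φ = fun x => (∫ y in (0 : ℝ)..x, φ y) + primitive φ 0 := by
    ext x; rw [← primitive_sub hφ.integrable]; ring
  rw [h1]
  exact (intervalIntegral.integral_hasDerivAt_right (hφ.1.continuous.intervalIntegrable _ _)
    (hφ.1.continuous.stronglyMeasurableAtFilter _ _) hφ.1.continuous.continuousAt).add_const _

/-- During the time interval `[a, b]` the moments `m` are those of fronts `c k` with masses `ξ k` and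
velocities `y k`, where `ρ uⁱ` has the jump `δ i k`, and these satisfy the Rankine-Hugoniot
conditions. -/
structure FrontMotion (m : ℕ → (ℝ → ℝ) → ℝ → ℝ) (a b : ℝ) {M : ℕ} (κ : ℕ → ℝ) (δ : ℕ → Fin M → ℝ)
    (c ξ y : Fin M → ℝ → ℝ) : Prop where
  moment_eq : ∀ t ∈ Icc a b, ∀ i φ, IsTestFunction φ → m i φ t = κ i * (∫ x, φ x) +
    ∑ k, (δ i k * primitive φ (c k t) + ξ k t * y k t ^ i * φ (c k t))
  continuousOn_front : ∀ k, ContinuousOn (c k) (Icc a b)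
  continuousOn_mass : ∀ k, ContinuousOn (ξ k) (Icc a b)
  continuousOn_velocity : ∀ k, ContinuousOn (y k) (Icc a b)
  front : ∀ t ∈ Ioo a b, ∀ k, HasDerivAt (c k) (y k t) t
  mass : ∀ t ∈ Ioo a b, ∀ k, HasDerivAt (ξ k) (δ 1 k - δ 0 k * y k t) t
  momentum : ∀ t ∈ Ioo a b, ∀ k, ∃ y', HasDerivAt (y k) y' t ∧
    ξ k t * y' = δ 2 k - 2 * δ 1 k * y k t + δ 0 k * y k t ^ 2

namespace FrontMotion

variable {m : ℕ → (ℝ → ℝ) → ℝ → ℝ} {a b : ℝ} {M : ℕ} {κ : ℕ → ℝ} {δ : ℕ → Fin M → ℝ} {c ξ y : Fin M → ℝ → ℝ}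

/-- One computation for mass, momentum and energy: in the time derivative of the contribution of a
front, the terms with `φ'` are the flux of its mass and the terms with `φ` are the jump of the flux
up to the defect `σ`. The defect is zero for `i = 0, 1`, and for `i = 2` it is the dissipation. -/
theorem balance (h : FrontMotion m a b κ δ c ξ y) {φ : ℝ → ℝ} (hφ : IsTestFunction φ) (i : ℕ)
    {σ : Fin M → ℝ → ℝ} (hσ : ∀ k, ContinuousOn (σ k) (Icc a b))
    (hi : ∀ t ∈ Ioo a b, ∀ k, ∃ d, HasDerivAt (fun t => ξ k t * y k t ^ i) d t ∧
      δ i k * y k t + d = δ (i + 1) k - σ k t) {s t : ℝ} (hs : s ∈ Icc a b) (ht : t ∈ Icc a b)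
    (hst : s ≤ t) :
    IntervalIntegrable (m (i + 1) (deriv φ)) volume s t ∧
    IntervalIntegrable (fun τ => ∑ k, σ k τ * φ (c k τ)) volume s t ∧
    m i φ t - m i φ s = (∫ τ in s..t, m (i + 1) (deriv φ) τ) -
      ∫ τ in s..t, ∑ k, σ k τ * φ (c k τ) := by
  have hsub : Icc s t ⊆ Icc a b := Icc_subset_Icc hs.1 ht.2
  have hφc := hφ.1.continuous
  have hφc' := hφ.deriv.1.continuous
  have hpc : Continuous (primitive φ) :=
    continuous_iff_continuousAt.2 fun x => (hasDerivAt_primitive hφ x).continuousAt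
  have hc := fun k => (h.continuousOn_front k).mono hsub
  have hξ := fun k => (h.continuousOn_mass k).mono hsub
  have hy := fun k => (h.continuousOn_velocity k).mono hsub
  have hcomp : ∀ (f : ℝ → ℝ) k, Continuous f → ContinuousOn (fun t => f (c k t)) (Icc s t) :=
    fun f k hf => hf.comp_continuousOn (hc k)
  have hm : ContinuousOn (m i φ) (Icc s t) := by
    refine ContinuousOn.congr ?_ fun τ hτ => h.moment_eq τ (hsub hτ) i φ hφ
    refine continuousOn_const.add (continuousOn_finsetSum _ fun k _ => ?_)
    exact (continuousOn_const.mul (hcomp _ k hpc)).add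
      (((hξ k).mul ((hy k).pow i)).mul (hcomp _ k hφc))
  have hfl : ContinuousOn (m (i + 1) (deriv φ)) (Icc s t) := by
    refine ContinuousOn.congr ?_ fun τ hτ => h.moment_eq τ (hsub hτ) (i + 1) _ hφ.deriv
    refine continuousOn_const.add (continuousOn_finsetSum _ fun k _ => ?_)
    simp only [hφ.primitive_deriv]
    exact (continuousOn_const.mul (hcomp _ k hφc)).add
      (((hξ k).mul ((hy k).pow (i + 1))).mul (hcomp _ k hφc'))
  have hsrc : ContinuousOn (fun τ => ∑ k, σ k τ * φ (c k τ)) (Icc s t) :=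
    continuousOn_finsetSum _ fun k _ => ((hσ k).mono hsub).mul (hcomp _ k hφc)
  have h1 := hfl.intervalIntegrable_of_Icc (μ := volume) hst
  have h2 := hsrc.intervalIntegrable_of_Icc (μ := volume) hst
  refine ⟨h1, h2, ?_⟩
  rw [← intervalIntegral.integral_sub h1 h2]
  refine (intervalIntegral.integral_eq_sub_of_hasDerivAt_of_le hst hm (fun τ hτ => ?_)
    (h1.sub h2)).symm
  have hτ' : τ ∈ Ioo a b := ⟨hs.1.trans_lt hτ.1, hτ.2.trans_le ht.2⟩
  have he : m i φ =ᶠ[𝓝 τ] fun t => κ i * (∫ x, φ x) +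
      ∑ k, (δ i k * primitive φ (c k t) + ξ k t * y k t ^ i * φ (c k t)) := by
    filter_upwards [isOpen_Ioo.mem_nhds hτ'] with r hr
    exact h.moment_eq r (Ioo_subset_Icc_self hr) i φ hφ
  refine HasDerivAt.congr_of_eventuallyEq ?_ he
  choose d hd hd' using hi τ hτ'
  have hk : ∀ k ∈ Finset.univ, HasDerivAt
      (fun t => δ i k * primitive φ (c k t) + ξ k t * y k t ^ i * φ (c k t))
      (δ i k * (φ (c k τ) * y k τ) + (d k * φ (c k τ) +
        ξ k τ * y k τ ^ i * (deriv φ (c k τ) * y k τ))) τ := fun k _ => by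
    have hck := h.front τ hτ' k
    exact (((hasDerivAt_primitive hφ _).comp τ hck).const_mul _).add
      ((hd k).mul ((hφ.differentiable _).hasDerivAt.comp τ hck))
  refine ((HasDerivAt.fun_sum hk).const_add _).congr_deriv ?_
  rw [h.moment_eq τ (Ioo_subset_Icc_self hτ') (i + 1) _ hφ.deriv, hφ.integral_deriv, mul_zero,
    zero_add, ← Finset.sum_sub_distrib]
  refine Finset.sum_congr rfl fun k _ => ?_
  rw [hφ.primitive_deriv]
  linear_combination φ (c k τ) * hd' k

theorem mass_law (h : FrontMotion m a b κ δ c ξ y) {φ : ℝ → ℝ} (hφ : IsTestFunction φ)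
    {s t : ℝ} (hs : s ∈ Icc a b) (ht : t ∈ Icc a b) (hst : s ≤ t) :
    IntervalIntegrable (m 1 (deriv φ)) volume s t ∧
    m 0 φ t - m 0 φ s = ∫ τ in s..t, m 1 (deriv φ) τ := by
  have := h.balance hφ 0 (σ := fun _ _ => 0) (fun _ => continuousOn_const) (fun t ht k =>
    ⟨_, by simpa using h.mass t ht k, by ring⟩) hs ht hst
  exact ⟨this.1, by simpa using this.2.2⟩

theorem momentum_law (h : FrontMotion m a b κ δ c ξ y) {φ : ℝ → ℝ} (hφ : IsTestFunction φ)
    {s t : ℝ} (hs : s ∈ Icc a b) (ht : t ∈ Icc a b) (hst : s ≤ t) :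
    IntervalIntegrable (m 2 (deriv φ)) volume s t ∧
    m 1 φ t - m 1 φ s = ∫ τ in s..t, m 2 (deriv φ) τ := by
  have := h.balance hφ 1 (σ := fun _ _ => 0) (fun _ => continuousOn_const) (fun t ht k => by
    obtain ⟨y', hy', he⟩ := h.momentum t ht k
    refine ⟨(δ 1 k - δ 0 k * y k t) * y k t + ξ k t * y', ?_, by linear_combination he⟩
    simp only [pow_one]
    exact (h.mass t ht k).mul hy') hs ht hst
  exact ⟨this.1, by simpa using this.2.2⟩

/-- The energy that the front `k` dissipates in unit time is half of this. -/
theorem energy_balance (h : FrontMotion m a b κ δ c ξ y) {φ : ℝ → ℝ} (hφ : IsTestFunction φ)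
    {s t : ℝ} (hs : s ∈ Icc a b) (ht : t ∈ Icc a b) (hst : s ≤ t) :
    IntervalIntegrable (m 3 (deriv φ)) volume s t ∧
    m 2 φ t - m 2 φ s = (∫ τ in s..t, m 3 (deriv φ) τ) -
      ∫ τ in s..t, ∑ k, (δ 3 k - 3 * δ 2 k * y k τ + 3 * δ 1 k * y k τ ^ 2 - δ 0 k * y k τ ^ 3) *
        φ (c k τ) := by
  have := h.balance hφ 2
    (σ := fun k τ => δ 3 k - 3 * δ 2 k * y k τ + 3 * δ 1 k * y k τ ^ 2 - δ 0 k * y k τ ^ 3)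
    (fun k => by have := h.continuousOn_velocity k; fun_prop) (fun t ht k => by
      obtain ⟨y', hy', he⟩ := h.momentum t ht k
      refine ⟨_, (h.mass t ht k).mul (hy'.pow 2), ?_⟩
      simp only [Nat.cast_ofNat, Nat.add_one_sub_one, pow_one]
      linear_combination 2 * y k t * he) hs ht hst
  exact ⟨this.1, this.2.2⟩

theorem energy_law (h : FrontMotion m a b κ δ c ξ y)
    (hd : ∀ t ∈ Icc a b, ∀ k,
      0 ≤ δ 3 k - 3 * δ 2 k * y k t + 3 * δ 1 k * y k t ^ 2 - δ 0 k * y k t ^ 3)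
    {φ : ℝ → ℝ} (hφ : IsTestFunction φ) (hφ0 : ∀ x, 0 ≤ φ x)
    {s t : ℝ} (hs : s ∈ Icc a b) (ht : t ∈ Icc a b) (hst : s ≤ t) :
    IntervalIntegrable (m 3 (deriv φ)) volume s t ∧
    1 / 2 * m 2 φ t - 1 / 2 * m 2 φ s
      ≤ ∫ τ in s..t, 1 / 2 * m 3 (deriv φ) τ := by
  obtain ⟨h1, h2⟩ := h.energy_balance hφ hs ht hst
  refine ⟨h1, ?_⟩
  rw [intervalIntegral.integral_const_mul, ← mul_sub, h2]
  have : 0 ≤ ∫ τ in s..t, ∑ k, (δ 3 k - 3 * δ 2 k * y k τ + 3 * δ 1 k * y k τ ^ 2 -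
      δ 0 k * y k τ ^ 3) * φ (c k τ) :=
    intervalIntegral.integral_nonneg hst fun τ hτ => Finset.sum_nonneg fun k _ =>
      mul_nonneg (hd τ ⟨hs.1.trans hτ.1, hτ.2.trans ht.2⟩ k) (hφ0 _)
  linarith

theorem energy_conservation (h : FrontMotion m a b κ δ c ξ y)
    (hd : ∀ t ∈ Icc a b, ∀ k,
      δ 3 k - 3 * δ 2 k * y k t + 3 * δ 1 k * y k t ^ 2 - δ 0 k * y k t ^ 3 = 0)
    {φ : ℝ → ℝ} (hφ : IsTestFunction φ)
    {s t : ℝ} (hs : s ∈ Icc a b) (ht : t ∈ Icc a b) (hst : s ≤ t) :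
    IntervalIntegrable (m 3 (deriv φ)) volume s t ∧
    1 / 2 * m 2 φ t - 1 / 2 * m 2 φ s
      = ∫ τ in s..t, 1 / 2 * m 3 (deriv φ) τ := by
  obtain ⟨h1, h2⟩ := h.energy_balance hφ hs ht hst
  refine ⟨h1, ?_⟩
  rw [intervalIntegral.integral_const_mul, ← mul_sub, h2]
  have : ∫ τ in s..t, ∑ k, (δ 3 k - 3 * δ 2 k * y k τ + 3 * δ 1 k * y k τ ^ 2 -
      δ 0 k * y k τ ^ 3) * φ (c k τ) = 0 := by
    rw [intervalIntegral.integral_congr (g := fun _ => 0)]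
    · simp
    · intro τ hτ
      rw [uIcc_of_le hst] at hτ
      simp only
      exact Finset.sum_eq_zero fun k _ => by rw [hd τ ⟨hs.1.trans hτ.1, hτ.2.trans ht.2⟩ k, zero_mul]
  rw [this, sub_zero]

end FrontMotion

namespace GasFlow.Carries

variable {U : GasFlow} {t : ℝ} {N : ℕ} {c ξ : Fin N → ℝ} {r u : Fin (N + 1) → ℝ}

theorem isLocallyFiniteMeasure (h : U.Carries t c ξ r u) :
    IsLocallyFiniteMeasure (U.density t) := by
  refine ⟨fun x => ⟨Metric.ball x 1, Metric.ball_mem_nhds x one_pos, ?_⟩⟩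
  rw [h.density_eq]
  simp only [Measure.coe_add, Pi.add_apply, Measure.coe_finsetSum, Finset.sum_apply,
    Measure.smul_apply, smul_eq_mul]
  refine ENNReal.add_lt_top.2 ⟨ENNReal.sum_lt_top.2 fun j _ => ENNReal.mul_lt_top (by simp) ?_,
    ENNReal.sum_lt_top.2 fun k _ => ENNReal.mul_lt_top (by simp) (measure_lt_top _ _)⟩
  exact (Measure.restrict_apply_le _ _).trans_lt measure_ball_lt_top

theorem ae_density (h : U.Carries t c ξ r u) {p : ℝ → Prop}
    (h1 : ∀ j, 0 < r j → ∀ᵐ x ∂volume.restrict (frontGap c j), p x)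
    (h2 : ∀ k, 0 < ξ k → p (c k)) : ∀ᵐ x ∂U.density t, p x := by
  rw [h.density_eq, ae_add_measure_iff, ae_finsetSum_measure_iff, ae_finsetSum_measure_iff]
  constructor
  · intro j _
    rcases (h.density_nonneg j).eq_or_lt with hj | hj
    · simp [← hj]
    · exact Measure.ae_smul_measure (h1 j hj) _
  · intro k _
    rcases (h.strength_nonneg k).eq_or_lt with hk | hk
    · simp [← hk]
    · exact Measure.ae_smul_measure (by rw [ae_dirac_eq]; exact h2 k hk) _

theorem aemeasurable (h : U.Carries t c ξ r u) : AEMeasurable (U.velocity t) (U.density t) := by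
  rw [h.density_eq]
  refine AEMeasurable.add_measure ?_ ?_
  · rw [← Measure.sum_fintype]
    refine AEMeasurable.sum_measure fun j => ?_
    rcases (h.density_nonneg j).eq_or_lt with hj | hj
    · simp [← hj]
    · exact (aemeasurable_const.congr (EventuallyEq.symm (h.velocity_state j hj))).smul_measure _
  · rw [← Measure.sum_fintype]
    exact AEMeasurable.sum_measure fun k => aemeasurable_dirac.smul_measure _

end GasFlow.Carries

/-- If a law holds up to the time `T` for a continuation and from `T` on then it holds at all
times. -/
theorem law_of_law_of_law {f F g G : ℝ → ℝ} {T : ℝ} (hT : 0 ≤ T) (hf : ∀ t ∈ Ico 0 T, f t = F t)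
    (hfT : f T ≤ F T) (hg : ∀ t ∈ Ico 0 T, g t = G t)
    (h1 : ∀ s t, s ∈ Icc 0 T → t ∈ Icc 0 T → s ≤ t →
      IntervalIntegrable G volume s t ∧ F t - F s ≤ ∫ τ in s..t, G τ)
    (h2 : ∀ s t, T ≤ s → s ≤ t → IntervalIntegrable g volume s t ∧ f t - f s ≤ ∫ τ in s..t, g τ)
    {s t : ℝ} (hs : 0 ≤ s) (hst : s ≤ t) :
    IntervalIntegrable g volume s t ∧ f t - f s ≤ ∫ τ in s..t, g τ := by
  have h3 : ∀ s t, s ∈ Icc 0 T → t ∈ Icc 0 T → s ≤ t →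
      IntervalIntegrable g volume s t ∧ f t - f s ≤ ∫ τ in s..t, g τ := by
    intro s t hs ht hst
    -- The integrands may differ at the single time `T`, which is not seen by the integral.
    have hae : ∀ᵐ τ, τ ∈ uIoc s t → G τ = g τ := by
      filter_upwards [compl_mem_ae_iff.2 (measure_singleton T)] with τ hτ hτ'
      rw [uIoc_of_le hst] at hτ'
      exact (hg τ ⟨hs.1.trans hτ'.1.le, (hτ'.2.trans ht.2).lt_of_ne hτ⟩).symm
    obtain ⟨hG, hF⟩ := h1 s t hs ht hst
    refine ⟨hG.congr_ae ((ae_restrict_iff' measurableSet_uIoc).2 hae), ?_⟩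
    rw [← intervalIntegral.integral_congr_ae hae]
    rcases hst.eq_or_lt with rfl | hlt
    · simp
    · rw [hf s ⟨hs.1, hlt.trans_le ht.2⟩]
      rcases ht.2.eq_or_lt with rfl | hlt'
      · linarith
      · rwa [hf t ⟨ht.1, hlt'⟩]
  rcases le_total t T with htT | htT
  · exact h3 s t ⟨hs, hst.trans htT⟩ ⟨hs.trans hst, htT⟩ hst
  rcases le_total T s with hsT | hsT
  · exact h2 s t hsT hst
  obtain ⟨i1, e1⟩ := h3 s T ⟨hs, hsT⟩ ⟨hT, le_rfl⟩ hsT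
  obtain ⟨i2, e2⟩ := h2 T t le_rfl htT
  refine ⟨i1.trans i2, ?_⟩
  rw [← intervalIntegral.integral_add_adjacent_intervals i1 i2]
  linarith

/-- The inequality version, applied to the functions and to their negatives. -/
theorem law_eq_of_law_of_law {f F g G : ℝ → ℝ} {T : ℝ} (hT : 0 ≤ T)
    (hf : ∀ t ∈ Ico 0 T, f t = F t) (hfT : f T = F T) (hg : ∀ t ∈ Ico 0 T, g t = G t)
    (h1 : ∀ s t, s ∈ Icc 0 T → t ∈ Icc 0 T → s ≤ t →
      IntervalIntegrable G volume s t ∧ F t - F s = ∫ τ in s..t, G τ)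
    (h2 : ∀ s t, T ≤ s → s ≤ t → IntervalIntegrable g volume s t ∧ f t - f s = ∫ τ in s..t, g τ)
    {s t : ℝ} (hs : 0 ≤ s) (hst : s ≤ t) :
    IntervalIntegrable g volume s t ∧ f t - f s = ∫ τ in s..t, g τ := by
  obtain ⟨h3, h4⟩ := law_of_law_of_law hT hf hfT.le hg
    (fun s t a b c => ⟨(h1 s t a b c).1, (h1 s t a b c).2.le⟩)
    (fun s t a b => ⟨(h2 s t a b).1, (h2 s t a b).2.le⟩) hs hst
  have h5 := law_of_law_of_law (f := fun t => -f t) (F := fun t => -F t) (g := fun t => -g t)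
    (G := fun t => -G t) hT (fun t ht => by rw [hf t ht]) (by rw [hfT])
    (fun t ht => by rw [hg t ht])
    (fun s t a b c => ⟨(h1 s t a b c).1.neg, by
      rw [intervalIntegral.integral_neg, ← (h1 s t a b c).2]; linarith⟩)
    (fun s t a b => ⟨(h2 s t a b).1.neg, by
      rw [intervalIntegral.integral_neg, ← (h2 s t a b).2]; linarith⟩) hs hst
  rw [intervalIntegral.integral_neg] at h5
  exact ⟨h3, le_antisymm h4 (by linarith [h5.2])⟩


/-! ### Flows built from patterns; straight fronts -/

namespace WavePattern

variable {N : ℕ} {P : WavePattern N} {U : GasFlow} {R : Measure ℝ} {v₀ : ℝ → ℝ}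

open Classical in
/-- The flow that consists of the waves of the pattern `P` and in which the mass on the front `k`
has the velocity `y k`. -/
noncomputable def flow (P : WavePattern N) (y : Fin N → ℝ → ℝ) : GasFlow where
  density t := ∑ j, ENNReal.ofReal (P.stateDensity j) • volume.restrict (P.gap j t) +
    ∑ i, ENNReal.ofReal (P.strength i t) • Measure.dirac (P.front i t)
  velocity t x :=
    if h : ∃ k, P.front k t = x ∧ 0 < P.strength k t then y h.choose t
    else if h : ∃ j, x ∈ P.gap j t then P.stateVelocity h.choose
    else 0

theorem front_notMem_gap {k : Fin N} {j : Fin (N + 1)} {t : ℝ} : P.front k t ∉ P.gap j t := by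
  intro h
  rcases lt_or_ge (k : ℕ) j with hk | hk
  · exact lt_irrefl _ ((h k).1 hk)
  · exact lt_irrefl _ ((h k).2 hk)

theorem eq_of_mem_gap {j j' : Fin (N + 1)} {t x : ℝ} (hj : x ∈ P.gap j t) (hj' : x ∈ P.gap j' t) :
    j = j' := by
  rcases lt_trichotomy j j' with h | h | h
  · let i : Fin N := ⟨j, by have := Fin.lt_def.1 h; omega⟩
    exact absurd ((hj i).2 le_rfl) (lt_asymm ((hj' i).1 (Fin.lt_def.1 h)))
  · exact h
  · let i : Fin N := ⟨j', by have := Fin.lt_def.1 h; omega⟩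
    exact absurd ((hj' i).2 le_rfl) (lt_asymm ((hj i).1 (Fin.lt_def.1 h)))

theorem flow_velocity_gap (y : Fin N → ℝ → ℝ) {j : Fin (N + 1)} {t x : ℝ} (hx : x ∈ P.gap j t) :
    (P.flow y).velocity t x = P.stateVelocity j := by
  have h1 : ¬ ∃ k, P.front k t = x ∧ 0 < P.strength k t := by
    rintro ⟨k, rfl, -⟩
    exact front_notMem_gap hx
  have h2 : ∃ j, x ∈ P.gap j t := ⟨j, hx⟩
  simp only [flow, dif_neg h1, dif_pos h2]
  rw [eq_of_mem_gap h2.choose_spec hx]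

/-- Where several fronts with mass coincide, the flow takes the velocity of an arbitrary one of
them; the compatibility of the velocities makes the choice irrelevant. -/
theorem flow_velocity_front {y : Fin N → ℝ → ℝ} {t : ℝ}
    (hy : ∀ i k, 0 < P.strength i t → 0 < P.strength k t → P.front i t = P.front k t →
      y i t = y k t) {k : Fin N} (hk : 0 < P.strength k t) :
    (P.flow y).velocity t (P.front k t) = y k t := by
  have h : ∃ l, P.front l t = P.front k t ∧ 0 < P.strength l t := ⟨k, rfl, hk⟩
  simp only [flow, dif_pos h]
  exact hy _ _ h.choose_spec.2 hk h.choose_spec.1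

theorem Represents.isWeakSolution (hP : P.Represents U)
    (hK : ∃ K, ∀ t, 0 ≤ t → ∀ k, 0 < P.strength k t → |U.velocity t (P.front k t)| ≤ K)
    (hR : U.density 0 = R) (hv : U.velocity 0 =ᵐ[R] v₀)
    (hmass : ∀ φ, IsTestFunction φ → ∀ s t, 0 ≤ s → s ≤ t →
      IntervalIntegrable (U.moment 1 (deriv φ)) volume s t ∧
      U.moment 0 φ t - U.moment 0 φ s = ∫ τ in s..t, U.moment 1 (deriv φ) τ)
    (hmom : ∀ φ, IsTestFunction φ → ∀ s t, 0 ≤ s → s ≤ t →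
      IntervalIntegrable (U.moment 2 (deriv φ)) volume s t ∧
      U.moment 1 φ t - U.moment 1 φ s = ∫ τ in s..t, U.moment 2 (deriv φ) τ) :
    U.IsWeakSolution R v₀ where
  density_zero := hR
  velocity_zero := hv
  locallyFinite t ht := (hP.carries ht).isLocallyFiniteMeasure
  measurable t ht := (hP.carries ht).aemeasurable
  bounded := by
    obtain ⟨K, hK⟩ := hK
    refine ⟨max K (∑ j, |P.stateVelocity j|), fun t ht => (hP.carries ht).ae_density
      (fun j hj => ?_) fun k hk => (hK t ht k hk).trans (le_max_left _ _)⟩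
    filter_upwards [hP.velocity_state t ht j hj] with x hx
    rw [hx]
    exact (Finset.single_le_sum (f := fun j => |P.stateVelocity j|) (fun _ _ => abs_nonneg _)
      (Finset.mem_univ j)).trans (le_max_right _ _)
  mass := hmass
  momentum := hmom

theorem jump_eq (P : WavePattern N) (i : ℕ) (k : Fin N) : P.jump i k =
    P.stateDensity k.castSucc * P.stateVelocity k.castSucc ^ i -
      P.stateDensity k.succ * P.stateVelocity k.succ ^ i := rfl

/-- This is how overcompressivity yields the energy inequality: the defect splits into one cube for
each side, and the cube of a vacuum side drops out. -/
theorem dissipation_nonneg {ρl ul ρr ur y : ℝ} (hl : 0 ≤ ρl) (hr : 0 ≤ ρr) (h1 : 0 < ρl → y ≤ ul)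
    (h2 : 0 < ρr → ur ≤ y) :
    0 ≤ (ρl * ul ^ 3 - ρr * ur ^ 3) - 3 * (ρl * ul ^ 2 - ρr * ur ^ 2) * y +
      3 * (ρl * ul ^ 1 - ρr * ur ^ 1) * y ^ 2 - (ρl * ul ^ 0 - ρr * ur ^ 0) * y ^ 3 := by
  have e : (ρl * ul ^ 3 - ρr * ur ^ 3) - 3 * (ρl * ul ^ 2 - ρr * ur ^ 2) * y +
      3 * (ρl * ul ^ 1 - ρr * ur ^ 1) * y ^ 2 - (ρl * ul ^ 0 - ρr * ur ^ 0) * y ^ 3 =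
      ρl * (ul - y) ^ 3 + ρr * (y - ur) ^ 3 := by ring
  rw [e]
  refine add_nonneg ?_ ?_
  · rcases hl.eq_or_lt with h | h
    · simp [← h]
    · exact mul_nonneg hl (pow_nonneg (sub_nonneg.2 (h1 h)) 3)
  · rcases hr.eq_or_lt with h | h
    · simp [← h]
    · exact mul_nonneg hr (pow_nonneg (sub_nonneg.2 (h2 h)) 3)

/-- A pattern of straight fronts whose masses grow linearly, without interactions. -/
noncomputable def straight (z y m n : Fin N → ℝ) (r u : Fin (N + 1) → ℝ) : WavePattern N where
  front k t := z k + y k * t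
  strength k t := m k + n k * t
  stateDensity := r
  stateVelocity := u
  interactionTimes := ∅

/-- The conditions on the data of a pattern of straight fronts under which it is an admissible
solution. -/
structure IsStraightSolution (z y m n : Fin N → ℝ) (r u : Fin (N + 1) → ℝ) : Prop where
  mono : ∀ t, 0 ≤ t → Monotone fun k => z k + y k * t
  separate : ∀ i k t, 0 < t → z i + y i * t = z k + y k * t → z i = z k ∧ y i = y k
  m_nonneg : ∀ k, 0 ≤ m k
  n_nonneg : ∀ k, 0 ≤ n k
  r_nonneg : ∀ j, 0 ≤ r j
  mass : ∀ k, n k = r k.castSucc * (u k.castSucc - y k) + r k.succ * (y k - u k.succ)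
  momentum : ∀ k, r k.castSucc * (u k.castSucc - y k) ^ 2 = r k.succ * (y k - u k.succ) ^ 2
  left : ∀ k, 0 < r k.castSucc → y k ≤ u k.castSucc
  right : ∀ k, 0 < r k.succ → u k.succ ≤ y k

variable {z y m n : Fin N → ℝ} {r u : Fin (N + 1) → ℝ}

theorem IsStraightSolution.hasDerivAt (z y : Fin N → ℝ) (k : Fin N) (t : ℝ) :
    HasDerivAt (fun t => z k + y k * t) (y k) t := by
  simpa using ((hasDerivAt_id t).const_mul (y k)).const_add (z k)

theorem IsStraightSolution.represents (h : IsStraightSolution z y m n r u)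
    (hd : ∀ t, 0 ≤ t → U.density t = ∑ j, ENNReal.ofReal (r j) •
        volume.restrict (frontGap (fun k => z k + y k * t) j) +
      ∑ k, ENNReal.ofReal (m k + n k * t) • Measure.dirac (z k + y k * t))
    (hvs : ∀ t, 0 ≤ t → ∀ j, 0 < r j →
      ∀ x ∈ frontGap (fun k => z k + y k * t) j, U.velocity t x = u j)
    (hvf : ∀ t, 0 ≤ t → ∀ k, 0 < m k + n k * t → U.velocity t (z k + y k * t) = y k) :
    (straight z y m n r u).Represents U where
  ordered := h.mono
  continuous k := by
    simp only [straight]; fun_prop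
  smooth k t _ _ := by
    simp only [straight]; fun_prop
  noInteraction s t hs hst _ i k := by
    constructor <;> intro he
    · obtain ⟨h1, h2⟩ := h.separate i k s hs he
      simp [straight, h1, h2]
    · obtain ⟨h1, h2⟩ := h.separate i k t (hs.trans_le hst) he
      simp [straight, h1, h2]
  strength_nonneg k t ht := add_nonneg (h.m_nonneg k) (mul_nonneg (h.n_nonneg k) ht)
  stateDensity_nonneg := h.r_nonneg
  density_eq := hd
  velocity_state t ht j hj := by
    filter_upwards [ae_restrict_mem (isOpen_frontGap _ j).measurableSet] with x hx
    exact hvs t ht j hj x hx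
  velocity_front k t ht _ hk := by
    rw [show (straight z y m n r u).front k = fun t => z k + y k * t from rfl,
      (IsStraightSolution.hasDerivAt z y k t).deriv]
    exact hvf t ht.le k hk

theorem IsStraightSolution.overcompressive (h : IsStraightSolution z y m n r u) :
    (straight z y m n r u).Overcompressive := by
  intro t _ _ j hj _ i
  rw [show (straight z y m n r u).front i = fun t => z i + y i * t from rfl,
    (IsStraightSolution.hasDerivAt z y i t).deriv]
  constructor
  · intro hij
    have : j = i.succ := Fin.ext (by simp [← hij])
    subst this
    exact h.right i hj
  · intro hij
    have : j = i.castSucc := Fin.ext (by simp [← hij])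
    subst this
    exact h.left i hj

theorem IsStraightSolution.frontMotion (h : IsStraightSolution z y m n r u)
    (hP : (straight z y m n r u).Represents U)
    (hvf : ∀ t, 0 ≤ t → ∀ k, 0 < m k + n k * t → U.velocity t (z k + y k * t) = y k) (T : ℝ) :
    FrontMotion U.moment 0 T (fun i => r (Fin.last N) * u (Fin.last N) ^ i)
      (fun i k => (straight z y m n r u).jump i k) (fun k t => z k + y k * t)
      (fun k t => m k + n k * t) (fun k _ => y k) where
  moment_eq t ht i φ hφ := by
    rw [hP.moment_eq ht.1 hφ.integrable]
    congr 1
    refine Finset.sum_congr rfl fun k _ => ?_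
    congr 2
    have h0 : 0 ≤ m k + n k * t := hP.strength_nonneg k t ht.1
    rcases h0.eq_or_lt with h1 | h1
    · simp [straight, ← h1]
    · simp only [straight]
      rw [hvf t ht.1 k h1]
  continuousOn_front k := by fun_prop
  continuousOn_mass k := by fun_prop
  continuousOn_velocity k := by fun_prop
  front t _ k := IsStraightSolution.hasDerivAt z y k t
  mass t _ k := by
    refine (IsStraightSolution.hasDerivAt m n k t).congr_deriv ?_
    rw [h.mass, jump_eq, jump_eq]
    simp only [straight]; ring
  momentum t _ k := by
    refine ⟨0, hasDerivAt_const t (y k), ?_⟩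
    rw [jump_eq, jump_eq, jump_eq]
    simp only [straight]
    linear_combination -h.momentum k

theorem IsStraightSolution.admissible (h : IsStraightSolution z y m n r u)
    (hP : (straight z y m n r u).Represents U)
    (hvf : ∀ t, 0 ≤ t → ∀ k, 0 < m k + n k * t → U.velocity t (z k + y k * t) = y k)
    (hR : U.density 0 = R) (hv : U.velocity 0 =ᵐ[R] v₀) : IsAdmissibleSolution U R v₀ := by
  refine ⟨hP.isWeakSolution ⟨∑ k, |y k|, fun t ht k hk => ?_⟩ hR hv
    (fun φ hφ s t hs hst => (h.frontMotion hP hvf t).mass_law hφ ⟨hs, hst⟩ ⟨hs.trans hst, le_rfl⟩ hst)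
    (fun φ hφ s t hs hst =>
      (h.frontMotion hP hvf t).momentum_law hφ ⟨hs, hst⟩ ⟨hs.trans hst, le_rfl⟩ hst),
    fun φ hφ hφ0 s t hs hst => (h.frontMotion hP hvf t).energy_law (fun τ _ k => ?_) hφ hφ0
      ⟨hs, hst⟩ ⟨hs.trans hst, le_rfl⟩ hst, N, _, hP, h.overcompressive⟩
  · have := hvf t ht k hk
    simp only [straight]
    rw [this]
    exact Finset.single_le_sum (f := fun k => |y k|) (fun _ _ => abs_nonneg _) (Finset.mem_univ k)
  · exact dissipation_nonneg (h.r_nonneg _) (h.r_nonneg _) (h.left k) (h.right k)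

end WavePattern


/-! ### The two explicit solutions are admissible -/

theorem frontGap_one (c : Fin 1 → ℝ) : frontGap c 0 = Iio (c 0) ∧ frontGap c 1 = Ioi (c 0) := by
  constructor <;> ext x <;> simp [frontGap]

theorem frontGap_zero {N : ℕ} {c : Fin (N + 1) → ℝ} (hc : Monotone c) :
    frontGap c 0 = Iio (c 0) := by
  ext x
  simp only [frontGap, mem_ofPred_eq, mem_Iio]
  exact ⟨fun h => (h 0).2 le_rfl, fun h i => ⟨fun hi => by simp at hi,
    fun _ => h.trans_le (hc (Fin.zero_le i))⟩⟩

theorem frontGap_last {N : ℕ} {c : Fin (N + 1) → ℝ} (hc : Monotone c) :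
    frontGap c (Fin.last (N + 1)) = Ioi (c (Fin.last N)) := by
  ext x
  simp only [frontGap, mem_ofPred_eq, mem_Ioi]
  exact ⟨fun h => (h (Fin.last N)).1 (by simp), fun h i => ⟨fun _ => (hc (Fin.le_last i)).trans_lt h,
    fun hi => absurd i.2 (not_lt.2 (by simpa using hi))⟩⟩

namespace DeltaRiemannData

variable {D : DeltaRiemannData}

theorem shockSpeed_eq (D : DeltaRiemannData) :
    D.shockSpeed = deltaShockSpeed D.ρ₀ D.u₀ D.ρ₁ D.u₁ := rfl

theorem isStraightSolution_deltaShock (h₀ : 0 < D.ρ₀) (h₁ : 0 < D.ρ₁) (hξ : 0 < D.ξ)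
    (h : D.u₁ < D.u₀) : WavePattern.IsStraightSolution (![0] : Fin 1 → ℝ) ![D.shockSpeed] ![D.ξ]
      ![√(D.ρ₀ * D.ρ₁) * (D.u₀ - D.u₁)] ![D.ρ₀, D.ρ₁] ![D.u₀, D.u₁] where
  mono t _ := Subsingleton.monotone _
  separate i k t _ _ := by rw [Subsingleton.elim i k]; exact ⟨rfl, rfl⟩
  m_nonneg k := by simpa using hξ.le
  n_nonneg k := by
    have : 0 ≤ √(D.ρ₀ * D.ρ₁) * (D.u₀ - D.u₁) := mul_nonneg (Real.sqrt_nonneg _) (by linarith)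
    simpa using this
  r_nonneg := by simpa [Fin.forall_fin_two] using ⟨h₀.le, h₁.le⟩
  mass k := by
    simpa [Fin.fin_one_eq_zero k, shockSpeed_eq] using (deltaShockSpeed_mass (ul := D.u₀) (ur := D.u₁) h₀ h₁).symm
  momentum k := by
    simpa [Fin.fin_one_eq_zero k, shockSpeed_eq] using deltaShockSpeed_balance (ul := D.u₀) (ur := D.u₁) h₀ h₁
  left k := by simpa [Fin.fin_one_eq_zero k, shockSpeed_eq] using fun _ => (deltaShockSpeed_lt h₀ h₁ h).le
  right k := by simpa [Fin.fin_one_eq_zero k, shockSpeed_eq] using fun _ => (lt_deltaShockSpeed h₀ h).le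

theorem deltaShock_represents (h₀ : 0 < D.ρ₀) (h₁ : 0 < D.ρ₁) (hξ : 0 < D.ξ) (h : D.u₁ < D.u₀) :
    (WavePattern.straight (![0] : Fin 1 → ℝ) ![D.shockSpeed] ![D.ξ]
      ![√(D.ρ₀ * D.ρ₁) * (D.u₀ - D.u₁)] ![D.ρ₀, D.ρ₁] ![D.u₀, D.u₁]).Represents D.deltaShock := by
  have hg := fun t => frontGap_one fun k =>
    (![0] : Fin 1 → ℝ) k + (![D.shockSpeed] : Fin 1 → ℝ) k * t
  refine (isStraightSolution_deltaShock h₀ h₁ hξ h).represents (fun t _ => ?_)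
    (fun t _ j _ x hx => ?_) (fun t _ k _ => ?_)
  · rw [Fin.sum_univ_two, (hg t).1, (hg t).2]
    simp [deltaShock]
  · fin_cases j
    · rw [show (⟨0, _⟩ : Fin 2) = 0 from rfl, (hg t).1] at hx
      have : x < D.shockSpeed * t := by simpa using hx
      simp [deltaShock, this]
    · rw [show (⟨1, _⟩ : Fin 2) = 1 from rfl, (hg t).2] at hx
      have : D.shockSpeed * t < x := by simpa using hx
      simp [deltaShock, this.not_gt, this.ne']
  · simp [Fin.fin_one_eq_zero k, deltaShock]

theorem deltaShock_admissible (h₀ : 0 < D.ρ₀) (h₁ : 0 < D.ρ₁) (hξ : 0 < D.ξ) (h : D.u₁ < D.u₀) :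
    IsAdmissibleSolution D.deltaShock D.initialDensity (D.initialVelocity D.shockSpeed) := by
  refine (isStraightSolution_deltaShock h₀ h₁ hξ h).admissible (deltaShock_represents h₀ h₁ hξ h)
    (fun t _ k _ => ?_) ?_ (.of_forall fun x => ?_)
  · simp [Fin.fin_one_eq_zero k, deltaShock]
  · simp [deltaShock, initialDensity]
  · simp [deltaShock, initialVelocity]

theorem contactSpeed_eq (h : D.u₀ ≤ D.u₁) : D.contactSpeed =
    if 0 ≤ D.u₀ then D.u₀ else if D.u₁ ≤ 0 then D.u₁ else 0 := by
  unfold contactSpeed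
  rw [min_eq_left h, max_eq_right h]
  split_ifs <;> first | rfl | grind

theorem contactSpeed_mem (h : D.u₀ ≤ D.u₁) : D.contactSpeed ∈ Icc D.u₀ D.u₁ := by
  rw [contactSpeed_eq h]
  split_ifs <;> constructor <;> linarith

/-- The contact speed is the point of `[u₀, u₁]` closest to `0`, and on an interval this point is
unique. -/
theorem contactSpeed_sq_le (h : D.u₀ ≤ D.u₁) {w : ℝ} (hw : w ∈ Icc D.u₀ D.u₁) :
    D.contactSpeed ^ 2 ≤ w ^ 2 ∧ (D.contactSpeed ^ 2 = w ^ 2 → w = D.contactSpeed) := by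
  rw [contactSpeed_eq h]
  obtain ⟨hw1, hw2⟩ := hw
  split_ifs with h1 h2
  · refine ⟨by nlinarith, fun he => ?_⟩
    rcases sq_eq_sq_iff_eq_or_eq_neg.1 he with h3 | h3 <;> linarith
  · refine ⟨by nlinarith, fun he => ?_⟩
    rcases sq_eq_sq_iff_eq_or_eq_neg.1 he with h3 | h3 <;> linarith
  · exact ⟨by nlinarith, fun he => by simpa using he.symm⟩

/-- The mass travels on the middle of three fronts, between two vacuum states whose velocity entries
`0` are placeholders. -/
theorem isStraightSolution_deltaContact (h₀ : 0 < D.ρ₀) (h₁ : 0 < D.ρ₁) (hξ : 0 < D.ξ)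
    (h : D.u₀ ≤ D.u₁) : WavePattern.IsStraightSolution (![0, 0, 0] : Fin 3 → ℝ)
      ![D.u₀, D.contactSpeed, D.u₁] ![0, D.ξ, 0] ![0, 0, 0] ![D.ρ₀, 0, 0, D.ρ₁]
      ![D.u₀, 0, 0, D.u₁] where
  mono t ht := by
    obtain ⟨h1, h2⟩ := contactSpeed_mem h
    rw [Fin.monotone_iff_le_succ]
    intro k
    fin_cases k <;> simp <;> gcongr
  separate i k t ht he := by
    fin_cases i <;> fin_cases k <;> simp [ht.ne'] at he ⊢ <;> exact he
  m_nonneg := by simpa [Fin.forall_fin_succ] using hξ.le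
  n_nonneg := by simp [Fin.forall_fin_succ]
  r_nonneg := by simpa [Fin.forall_fin_succ] using ⟨h₀.le, h₁.le⟩
  mass := by simp [Fin.forall_fin_succ]
  momentum := by simp [Fin.forall_fin_succ]
  left := by simp [Fin.forall_fin_succ]
  right := by simp [Fin.forall_fin_succ]

section Contact

variable (D) (t : ℝ)

theorem deltaContact_density (h : D.u₀ ≤ D.u₁) (ht : 0 ≤ t) : D.deltaContact.density t =
    ∑ j, ENNReal.ofReal ((![D.ρ₀, 0, 0, D.ρ₁] : Fin 4 → ℝ) j) • volume.restrict (frontGap (fun k =>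
      (![0, 0, 0] : Fin 3 → ℝ) k + (![D.u₀, D.contactSpeed, D.u₁] : Fin 3 → ℝ) k * t) j) +
    ∑ k, ENNReal.ofReal ((![0, D.ξ, 0] : Fin 3 → ℝ) k + (![0, 0, 0] : Fin 3 → ℝ) k * t) •
      Measure.dirac ((![0, 0, 0] : Fin 3 → ℝ) k +
        (![D.u₀, D.contactSpeed, D.u₁] : Fin 3 → ℝ) k * t) := by
  obtain ⟨h1, h2⟩ := contactSpeed_mem h
  have hc : Monotone fun k => (![0, 0, 0] : Fin 3 → ℝ) k +
      (![D.u₀, D.contactSpeed, D.u₁] : Fin 3 → ℝ) k * t := by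
    rw [Fin.monotone_iff_le_succ]
    intro k
    fin_cases k <;> simp <;> gcongr
  rw [Fin.sum_univ_four, Fin.sum_univ_three, frontGap_zero hc,
    show (3 : Fin 4) = Fin.last 3 from rfl, frontGap_last hc]
  simp [deltaContact, Fin.last]

theorem deltaContact_velocity_state (h : D.u₀ ≤ D.u₁) (ht : 0 ≤ t) (j : Fin 4)
    (hj : 0 < (![D.ρ₀, 0, 0, D.ρ₁] : Fin 4 → ℝ) j) (x : ℝ) (hx : x ∈ frontGap (fun k =>
      (![0, 0, 0] : Fin 3 → ℝ) k + (![D.u₀, D.contactSpeed, D.u₁] : Fin 3 → ℝ) k * t) j) :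
    D.deltaContact.velocity t x = (![D.u₀, 0, 0, D.u₁] : Fin 4 → ℝ) j := by
  obtain ⟨h1, h2⟩ := contactSpeed_mem h
  have e1 : D.u₀ * t ≤ D.contactSpeed * t := by gcongr
  have e2 : D.contactSpeed * t ≤ D.u₁ * t := by gcongr
  fin_cases j
  · have : x < D.u₀ * t := by simpa using (hx 0).2 le_rfl
    simp [deltaContact, this, (this.trans_le e1).ne]
  · simp at hj
  · simp at hj
  · have : D.u₁ * t < x := by simpa using (hx 2).1 (by simp)
    simp [deltaContact, this, (e2.trans_lt this).ne', ((e1.trans e2).trans_lt this).not_gt]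

theorem deltaContact_velocity_front (k : Fin 3)
    (hk : 0 < (![0, D.ξ, 0] : Fin 3 → ℝ) k + (![0, 0, 0] : Fin 3 → ℝ) k * t) :
    D.deltaContact.velocity t ((![0, 0, 0] : Fin 3 → ℝ) k +
      (![D.u₀, D.contactSpeed, D.u₁] : Fin 3 → ℝ) k * t) =
      (![D.u₀, D.contactSpeed, D.u₁] : Fin 3 → ℝ) k := by
  fin_cases k
  · simp at hk
  · simp [deltaContact]
  · simp at hk

end Contact

theorem deltaContact_represents (h₀ : 0 < D.ρ₀) (h₁ : 0 < D.ρ₁) (hξ : 0 < D.ξ) (h : D.u₀ ≤ D.u₁) :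
    (WavePattern.straight (![0, 0, 0] : Fin 3 → ℝ) ![D.u₀, D.contactSpeed, D.u₁] ![0, D.ξ, 0]
      ![0, 0, 0] ![D.ρ₀, 0, 0, D.ρ₁] ![D.u₀, 0, 0, D.u₁]).Represents D.deltaContact :=
  (isStraightSolution_deltaContact h₀ h₁ hξ h).represents (fun t => D.deltaContact_density t h)
    (fun t => D.deltaContact_velocity_state t h) fun t _ => D.deltaContact_velocity_front t

theorem deltaContact_admissible (h₀ : 0 < D.ρ₀) (h₁ : 0 < D.ρ₁) (hξ : 0 < D.ξ) (h : D.u₀ ≤ D.u₁) :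
    IsAdmissibleSolution D.deltaContact D.initialDensity (D.initialVelocity D.contactSpeed) := by
  refine (isStraightSolution_deltaContact h₀ h₁ hξ h).admissible
    (deltaContact_represents h₀ h₁ hξ h) (fun t _ => D.deltaContact_velocity_front t) ?_ (.of_forall fun x => ?_)
  · simp [deltaContact, initialDensity]
  · simp only [deltaContact, initialVelocity, mul_zero]
    split_ifs with h1 h2 h3 h4 <;> first | rfl | grind

/-- Each front has vacuum on a side or moves with the velocity of the matter there, so both cubes in
the energy defect vanish. -/
theorem deltaContact_locallyConservesEnergy (h₀ : 0 < D.ρ₀) (h₁ : 0 < D.ρ₁) (hξ : 0 < D.ξ)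
    (h : D.u₀ ≤ D.u₁) : D.deltaContact.LocallyConservesEnergy := by
  intro φ hφ s t hs hst
  refine ((isStraightSolution_deltaContact h₀ h₁ hξ h).frontMotion (deltaContact_represents h₀ h₁ hξ h)
    (fun t _ => D.deltaContact_velocity_front t) t).energy_conservation (fun τ _ k => ?_) hφ ⟨hs, hst⟩
    ⟨hs.trans hst, le_rfl⟩ hst
  fin_cases k <;> simp [WavePattern.jump_eq, WavePattern.straight] <;> ring

end DeltaRiemannData


/-! ### Uniqueness for the delta Riemann problem -/

namespace GasFlow

variable {U V : GasFlow} {t : ℝ}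

theorem Carries.hasState {N : ℕ} {c ξ : Fin N → ℝ} {r u : Fin (N + 1) → ℝ}
    (h : U.Carries t c ξ r u) (j : Fin (N + 1)) : U.HasState t (frontGap c j) (r j) (u j) := by
  have hd : (U.density t).restrict (frontGap c j) =
      ENNReal.ofReal (r j) • volume.restrict (frontGap c j) := by
    ext s hs
    rw [Measure.restrict_apply hs, h.density_apply (hs.inter (isOpen_frontGap c j).measurableSet)
      inter_subset_right, Measure.smul_apply, Measure.restrict_apply hs, smul_eq_mul]
  refine ⟨isOpen_frontGap c j, hd, ?_⟩
  rw [hd]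
  rcases (h.density_nonneg j).eq_or_lt with hj | hj
  · simp [← hj]
  · exact Measure.ae_smul_measure (h.velocity_state j hj) _

theorem velocity_eq_of_ae (hv : U.velocity t =ᵐ[U.density t] V.velocity t) {z : ℝ}
    (hz : U.density t {z} ≠ 0) : U.velocity t z = V.velocity t z := by
  by_contra h
  exact hz (measure_mono_null (singleton_subset_iff.2 h) hv)

end GasFlow

namespace DeltaRiemannData

variable {D : DeltaRiemannData} {U : GasFlow}

/-- The delta shock is the only admissible solution when its speed is the initial velocity of the
mass at the origin. -/
theorem equiv_deltaShock (h₀ : 0 < D.ρ₀) (h₁ : 0 < D.ρ₁) (hξ : 0 < D.ξ) (h : D.u₁ < D.u₀)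
    (hU : IsAdmissibleSolution U D.initialDensity (D.initialVelocity D.shockSpeed)) :
    U.Equiv D.deltaShock := by
  have hV := deltaShock_admissible h₀ h₁ hξ h
  have hQ := deltaShock_represents h₀ h₁ hξ h
  obtain ⟨hW, hE, N, P, hP, hO⟩ := hU
  refine hW.equiv_of_step hV.1 fun a ha hd hv => ?_
  set y := D.shockSpeed with hy
  have hs₀ : U.HasState a (Iio (y * a)) D.ρ₀ D.u₀ := by
    have := ((hQ.carries ha).hasState 0).congr hd.symm (hd ▸ hv.symm)
    rw [(frontGap_one _).1] at this
    simpa [WavePattern.straight] using this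
  have hs₁ : U.HasState a (Ioi (y * a)) D.ρ₁ D.u₁ := by
    have := ((hQ.carries ha).hasState 1).congr hd.symm (hd ▸ hv.symm)
    rw [(frontGap_one _).2] at this
    simpa [WavePattern.straight] using this
  set n := √(D.ρ₀ * D.ρ₁) * (D.u₀ - D.u₁) with hn
  have hn0 : 0 ≤ n := mul_nonneg (Real.sqrt_nonneg _) (by linarith)
  have hm0 : 0 < D.ξ + n * a := by positivity
  have hm : U.density a {y * a} = ENNReal.ofReal (D.ξ + n * a) := by
    rw [hd, (hQ.carries ha).density_singleton (y * a) (B := {0}) (by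
      intro k; simp [WavePattern.straight, Fin.fin_one_eq_zero k])]
    simp [WavePattern.straight]
  have hmne : U.density a {y * a} ≠ 0 := by rw [hm]; simpa using hm0
  have hvy : U.velocity a (y * a) = y := by
    rw [GasFlow.velocity_eq_of_ae hv hmne]
    simp [deltaShock, hy]
  -- Away from `y a` a fiber has equal states on both sides and no mass, so it is a trivial contact
  -- with `v` the velocity of that state. At `y a` the balanced compression applies.
  have hg : ∀ᶠ t in 𝓝[>] a, ∀ z p q, P.IsFiber a z p q → ∀ (i : ℕ) (F φ : ℝ → ℝ),
      ∑ k ∈ Finset.Icc p q, (P.jump i k * F (P.front k t) +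
        P.strength k t * U.velocity t (P.front k t) ^ i * φ (P.front k t)) =
      if z = y * a then (D.ρ₀ * D.u₀ ^ i - D.ρ₁ * D.u₁ ^ i) * F (y * t) +
        (D.ξ + n * t) * y ^ i * φ (y * t) else 0 := by
    refine WavePattern.eventually_forall_fiber fun z p q hz => ?_
    rcases lt_trichotomy z (y * a) with hlt | heq | hlt
    · have a1 := hP.left_state ha hz hs₀ h₀.le (show z - 1 < z by linarith)
        (fun x hx => hx.2.trans hlt)
      have a2 := hP.right_state ha hz hs₀ h₀.le hlt (fun x hx => hx.2)
      have am := hP.sum_strength_eq ha hz le_rfl (by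
        rw [hs₀.density_singleton hlt, ENNReal.ofReal_zero])
      filter_upwards [hP.block_contact hW hE hO ha hz.1 hz.2 (v := D.u₀) (Or.inl am)
        (fun _ => (a1.2 h₀).le) (fun _ => (a2.2 h₀).ge)] with t ht i F φ
      rw [ht, am, a1.1, a1.2 h₀, a2.1, a2.2 h₀, if_neg hlt.ne]; ring
    · have a1 := hP.left_state ha hz hs₀ h₀.le (show z - 1 < z by linarith)
        (fun x hx => hx.2.trans_eq heq)
      have a2 := hP.right_state ha hz hs₁ h₁.le (show z < z + 1 by linarith)
        (fun x hx => heq.symm.trans_lt hx.1)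
      have am := hP.sum_strength_eq ha hz hm0.le (by rw [heq, hm])
      filter_upwards [hP.block_shock hW hE hO ha hz.1 hz.2 (v := y) (Or.inr (by rw [heq, hvy]))
        (by rw [a1.1]; exact h₀) (by rw [a2.1]; exact h₁)
        (by rw [a1.2 h₀]; exact deltaShockSpeed_lt h₀ h₁ h)
        (by rw [a2.2 h₁]; exact lt_deltaShockSpeed h₀ h)
        (by rw [a1.1, a2.1, a1.2 h₀, a2.2 h₁]; exact deltaShockSpeed_balance h₀ h₁)] with t ht i F φ
      rw [ht, am, a1.1, a1.2 h₀, a2.1, a2.2 h₁, if_pos heq, heq,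
        show D.ρ₀ * (D.u₀ - y) + D.ρ₁ * (y - D.u₁) = n from deltaShockSpeed_mass h₀ h₁,
        show y * a + y * (t - a) = y * t by ring,
        show D.ξ + n * a + n * (t - a) = D.ξ + n * t by ring]
    · have a1 := hP.left_state ha hz hs₁ h₁.le hlt (fun x hx => hx.1)
      have a2 := hP.right_state ha hz hs₁ h₁.le (show z < z + 1 by linarith)
        (fun x hx => hlt.trans hx.1)
      have am := hP.sum_strength_eq ha hz le_rfl (by
        rw [hs₁.density_singleton hlt, ENNReal.ofReal_zero])
      filter_upwards [hP.block_contact hW hE hO ha hz.1 hz.2 (v := D.u₁) (Or.inl am)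
        (fun _ => (a1.2 h₁).le) (fun _ => (a2.2 h₁).ge)] with t ht i F φ
      rw [ht, am, a1.1, a1.2 h₁, a2.1, a2.2 h₁, if_neg hlt.ne']; ring
  have hlast := hP.last_state ha hs₁ h₁.le (fun x hx => hx)
  have hmem : y * a ∈ Finset.univ.image (fun k => P.front k a) := by
    obtain ⟨k, hk⟩ := hP.exists_front_of_mass ha hmne
    exact Finset.mem_image.2 ⟨k, Finset.mem_univ k, hk⟩
  filter_upwards [hg, self_mem_nhdsWithin] with t ht hat φ hφ
  have ht0 : 0 ≤ t := ha.trans (le_of_lt hat)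
  have key : ∀ i, U.moment i φ t = D.deltaShock.moment i φ t := fun i => by
    rw [hP.moment_eq_sum_fibers ha ht0 hφ.integrable fun z p q hz => ht z p q hz i _ _,
      Finset.sum_ite_eq', if_pos hmem, hQ.moment_eq ht0 hφ.integrable, hlast.1, hlast.2 h₁,
      Fin.sum_univ_one, WavePattern.jump_eq]
    simp [WavePattern.straight, deltaShock, hy, hn]
  exact ⟨key 0, key 1⟩

/-- The delta contact discontinuity is the only admissible solution when its speed is the initial
velocity of the mass at the origin. -/
theorem equiv_deltaContact (h₀ : 0 < D.ρ₀) (h₁ : 0 < D.ρ₁) (hξ : 0 < D.ξ) (h : D.u₀ ≤ D.u₁)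
    (hU : IsAdmissibleSolution U D.initialDensity (D.initialVelocity D.contactSpeed)) :
    U.Equiv D.deltaContact := by
  have hV := deltaContact_admissible h₀ h₁ hξ h
  have hQ := deltaContact_represents h₀ h₁ hξ h
  obtain ⟨hW, hE, N, P, hP, hO⟩ := hU
  refine hW.equiv_of_step hV.1 fun a ha hd hv => ?_
  obtain ⟨hw1, hw2⟩ := contactSpeed_mem h
  set w := D.contactSpeed with hw
  have e1 : D.u₀ * a ≤ w * a := by gcongr
  have e2 : w * a ≤ D.u₁ * a := by gcongr
  have hst : ∀ j, U.HasState a _ _ _ := fun j =>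
    ((hQ.carries ha).hasState j).congr hd.symm (hd ▸ hv.symm)
  have hs₀ : U.HasState a (Iio (D.u₀ * a)) D.ρ₀ D.u₀ := (hst 0).mono isOpen_Iio fun x hx => by
    have : x < D.u₀ * a := hx
    simp [frontGap, WavePattern.straight, Fin.forall_fin_succ, this, this.trans_le e1,
      this.trans_le (e1.trans e2)]
  have hsl : U.HasState a (Ioo (D.u₀ * a) (w * a)) 0 0 := (hst 1).mono isOpen_Ioo fun x hx => by
    simp [frontGap, WavePattern.straight, Fin.forall_fin_succ, hx.1, hx.2, hx.2.trans_le e2]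
  have hsr : U.HasState a (Ioo (w * a) (D.u₁ * a)) 0 0 := (hst 2).mono isOpen_Ioo fun x hx => by
    simp [frontGap, WavePattern.straight, Fin.forall_fin_succ, hx.1, hx.2, e1.trans_lt hx.1]
  have hs₁ : U.HasState a (Ioi (D.u₁ * a)) D.ρ₁ D.u₁ := (hst 3).mono isOpen_Ioi fun x hx => by
    have : D.u₁ * a < x := hx
    simp [frontGap, WavePattern.straight, Fin.forall_fin_succ, this, e2.trans_lt this,
      (e1.trans e2).trans_lt this]
  clear hst
  have hm : ∀ z, U.density a {z} = ENNReal.ofReal (if z = w * a then D.ξ else 0) := fun z => by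
    classical
    rw [hd, (hQ.carries ha).density_singleton z (B := Finset.univ.filter fun k =>
      (WavePattern.straight (![0, 0, 0] : Fin 3 → ℝ) ![D.u₀, D.contactSpeed, D.u₁] ![0, D.ξ, 0]
      ![0, 0, 0] ![D.ρ₀, 0, 0, D.ρ₁] ![D.u₀, 0, 0, D.u₁]).front k a = z) (fun k => by simp [hw]),
      Finset.sum_filter, Fin.sum_univ_three]
    simp [WavePattern.straight, hw, eq_comm]
  have hmne : U.density a {w * a} ≠ 0 := by rw [hm]; simpa using hξ
  have hvw : U.velocity a (w * a) = w := by
    rw [GasFlow.velocity_eq_of_ae hv hmne]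
    simp [deltaContact, hw]
  -- The points `u₀ a`, `w a`, `u₁ a` may coincide, and all do at `a = 0`. A sum of three
  -- conditional terms covers every coincidence at once.
  have hg : ∀ᶠ t in 𝓝[>] a, ∀ z p q, P.IsFiber a z p q → ∀ (i : ℕ) (F φ : ℝ → ℝ),
      ∑ k ∈ Finset.Icc p q, (P.jump i k * F (P.front k t) +
        P.strength k t * U.velocity t (P.front k t) ^ i * φ (P.front k t)) =
      (if z = D.u₀ * a then D.ρ₀ * D.u₀ ^ i * F (D.u₀ * t) else 0) -
        (if z = D.u₁ * a then D.ρ₁ * D.u₁ ^ i * F (D.u₁ * t) else 0) +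
        (if z = w * a then D.ξ * w ^ i * φ (w * t) else 0) := by
    refine WavePattern.eventually_forall_fiber fun z p q hz => ?_
    have am := hP.sum_strength_eq ha hz (by split_ifs <;> [exact hξ.le; exact le_rfl]) (hm z)
    rcases lt_or_ge z (D.u₀ * a) with hlt | hge
    · have a1 := hP.left_state ha hz hs₀ h₀.le (show z - 1 < z by linarith)
        (fun x hx => hx.2.trans hlt)
      have a2 := hP.right_state ha hz hs₀ h₀.le hlt (fun x hx => hx.2)
      rw [if_neg (hlt.trans_le e1).ne] at am
      filter_upwards [hP.block_contact hW hE hO ha hz.1 hz.2 (v := D.u₀) (Or.inl am)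
        (fun _ => (a1.2 h₀).le) (fun _ => (a2.2 h₀).ge)] with t ht i F φ
      rw [ht, am, a1.1, a1.2 h₀, a2.1, a2.2 h₀, if_neg hlt.ne,
        if_neg (hlt.trans_le (e1.trans e2)).ne, if_neg (hlt.trans_le e1).ne]; ring
    rcases lt_or_ge (D.u₁ * a) z with hlt | hle
    · have a1 := hP.left_state ha hz hs₁ h₁.le hlt (fun x hx => hx.1)
      have a2 := hP.right_state ha hz hs₁ h₁.le (show z < z + 1 by linarith)
        (fun x hx => hlt.trans hx.1)
      rw [if_neg (e2.trans_lt hlt).ne'] at am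
      filter_upwards [hP.block_contact hW hE hO ha hz.1 hz.2 (v := D.u₁) (Or.inl am)
        (fun _ => (a1.2 h₁).le) (fun _ => (a2.2 h₁).ge)] with t ht i F φ
      rw [ht, am, a1.1, a1.2 h₁, a2.1, a2.2 h₁, if_neg hlt.ne',
        if_neg ((e1.trans e2).trans_lt hlt).ne', if_neg (e2.trans_lt hlt).ne']; ring
    -- For `z` in `[u₀ a, u₁ a]` there is matter immediately to the left only if `z` is the left
    -- end. Otherwise the gap on the left lies in one of the two vacuum intervals.
    have hl : P.stateDensity p.castSucc = (if z = D.u₀ * a then D.ρ₀ else 0) ∧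
        (z = D.u₀ * a → P.stateVelocity p.castSucc = D.u₀) := by
      rcases hge.eq_or_lt with heq | hlt
      · have := hP.left_state ha hz hs₀ h₀.le (show z - 1 < z by linarith)
          (fun x hx => hx.2.trans_eq heq.symm)
        rw [if_pos heq.symm]
        exact ⟨this.1, fun _ => this.2 h₀⟩
      · rw [if_neg hlt.ne']
        refine ⟨?_, fun h => absurd h hlt.ne'⟩
        rcases le_or_gt z (w * a) with h' | h'
        · exact (hP.left_state ha hz hsl le_rfl hlt
            (fun x hx => ⟨hx.1, hx.2.trans_le h'⟩)).1
        · exact (hP.left_state ha hz hsr le_rfl h'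
            (fun x hx => ⟨hx.1, hx.2.trans_le hle⟩)).1
    have hr : P.stateDensity q.succ = (if z = D.u₁ * a then D.ρ₁ else 0) ∧
        (z = D.u₁ * a → P.stateVelocity q.succ = D.u₁) := by
      rcases hle.eq_or_lt with heq | hlt
      · have := hP.right_state ha hz hs₁ h₁.le (show z < z + 1 by linarith)
          (fun x hx => heq.symm.trans_lt hx.1)
        rw [if_pos heq]
        exact ⟨this.1, fun _ => this.2 h₁⟩
      · rw [if_neg hlt.ne]
        refine ⟨?_, fun h => absurd h hlt.ne⟩
        rcases le_or_gt (w * a) z with h' | h'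
        · exact (hP.right_state ha hz hsr le_rfl hlt
            (fun x hx => ⟨h'.trans_lt hx.1, hx.2⟩)).1
        · exact (hP.right_state ha hz hsl le_rfl h'
            (fun x hx => ⟨hge.trans_lt hx.1, hx.2⟩)).1
    filter_upwards [hP.block_contact hW hE hO ha hz.1 hz.2 (v := w) (by
        by_cases hzw : z = w * a
        · exact Or.inr (by rw [hzw, hvw])
        · exact Or.inl (by rw [am, if_neg hzw]))
      (fun h' => by
        rw [hl.1] at h'
        by_cases hzu : z = D.u₀ * a
        · rw [hl.2 hzu]; exact hw1
        · simp [hzu] at h')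
      (fun h' => by
        rw [hr.1] at h'
        by_cases hzu : z = D.u₁ * a
        · rw [hr.2 hzu]; exact hw2
        · simp [hzu] at h')] with t ht i F φ
    rw [ht, am, hl.1, hr.1]
    congr 1
    · congr 1
      · split_ifs with h'
        · rw [hl.2 h', h']; ring_nf
        · ring
      · split_ifs with h'
        · rw [hr.2 h', h']; ring_nf
        · ring
    · split_ifs with h'
      · rw [h']; ring_nf
      · ring
  have hlast := hP.last_state ha hs₁ h₁.le (fun x hx => hx)
  have hmem : ∀ z, (∃ k, P.front k a = z) → z ∈ Finset.univ.image (fun k => P.front k a) := by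
    rintro z ⟨k, hk⟩
    exact Finset.mem_image.2 ⟨k, Finset.mem_univ k, hk⟩
  have hmemw := hmem _ (hP.exists_front_of_mass ha hmne)
  have hmem₀ : D.u₀ * a ∈ Finset.univ.image (fun k => P.front k a) := by
    rcases e1.eq_or_lt with heq | hlt
    · rw [heq]; exact hmemw
    · exact hmem _ (hP.exists_front_of_jump ha hs₀ hsl h₀.le le_rfl
        (show D.u₀ * a - 1 < D.u₀ * a by linarith) (fun x hx => hx.2) hlt (fun x hx => hx) h₀.ne')
  have hmem₁ : D.u₁ * a ∈ Finset.univ.image (fun k => P.front k a) := by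
    rcases e2.eq_or_lt with heq | hlt
    · rw [← heq]; exact hmemw
    · exact hmem _ (hP.exists_front_of_jump ha hsr hs₁ le_rfl h₁.le hlt (fun x hx => hx)
        (show D.u₁ * a < D.u₁ * a + 1 by linarith) (fun x hx => hx.1) h₁.ne)
  filter_upwards [hg, self_mem_nhdsWithin] with t ht hat φ hφ
  have ht0 : 0 ≤ t := ha.trans (le_of_lt hat)
  have key : ∀ i, U.moment i φ t = D.deltaContact.moment i φ t := fun i => by
    rw [hP.moment_eq_sum_fibers ha ht0 hφ.integrable fun z p q hz => ht z p q hz i _ _,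
      Finset.sum_add_distrib, Finset.sum_sub_distrib, Finset.sum_ite_eq', Finset.sum_ite_eq',
      Finset.sum_ite_eq', if_pos hmemw, if_pos hmem₀, if_pos hmem₁, hQ.moment_eq ht0 hφ.integrable,
      hlast.1, hlast.2 h₁, Fin.sum_univ_three]
    simp [WavePattern.jump_eq, WavePattern.straight, deltaContact, hw]
    ring
  exact ⟨key 0, key 1⟩

end DeltaRiemannData


/-! ### Invariance under equivalence, and the selection principle -/

namespace GasFlow

variable {U V : GasFlow} {R : Measure ℝ} {v : ℝ → ℝ}

theorem Equiv.velocity_ae (h : U.Equiv V) {t : ℝ} (ht : 0 ≤ t) :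
    U.velocity t =ᵐ[V.density t] V.velocity t := (h t ht).1 ▸ (h t ht).2

theorem Equiv.intervalIntegrable_moment (h : U.Equiv V) {i : ℕ} {φ : ℝ → ℝ} {s t : ℝ} (hs : 0 ≤ s)
    (hst : s ≤ t) (hV : IntervalIntegrable (V.moment i φ) volume s t) :
    IntervalIntegrable (U.moment i φ) volume s t :=
  hV.congr fun τ hτ => by
    rw [uIoc_of_le hst] at hτ
    exact (h.moment_eq i φ (hs.trans hτ.1.le)).symm

theorem Equiv.integral_moment (h : U.Equiv V) (c : ℝ) (i : ℕ) (φ : ℝ → ℝ) {s t : ℝ} (hs : 0 ≤ s)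
    (hst : s ≤ t) : ∫ τ in s..t, c * U.moment i φ τ = ∫ τ in s..t, c * V.moment i φ τ :=
  intervalIntegral.integral_congr fun τ hτ => by
    rw [uIcc_of_le hst] at hτ
    simp only [h.moment_eq i φ (hs.trans hτ.1)]

theorem Equiv.isWeakSolution (h : U.Equiv V) (hV : V.IsWeakSolution R v) :
    U.IsWeakSolution R v where
  density_zero := (h 0 le_rfl).1.trans hV.density_zero
  velocity_zero := (hV.density_zero ▸ h.velocity_ae le_rfl).trans hV.velocity_zero
  locallyFinite t ht := (h t ht).1 ▸ hV.locallyFinite t ht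
  measurable t ht := by
    rw [(h t ht).1]
    exact (hV.measurable t ht).congr (h.velocity_ae ht).symm
  bounded := by
    obtain ⟨K, hK⟩ := hV.bounded
    refine ⟨K, fun t ht => ?_⟩
    rw [(h t ht).1]
    filter_upwards [hK t ht, h.velocity_ae ht] with x h1 h2
    rwa [h2]
  mass φ hφ s t hs hst := by
    obtain ⟨h1, h2⟩ := hV.mass φ hφ s t hs hst
    refine ⟨h.intervalIntegrable_moment hs hst h1, ?_⟩
    have := h.integral_moment 1 1 (deriv φ) hs hst
    simp only [one_mul] at this
    rw [h.moment_eq _ _ hs, h.moment_eq _ _ (hs.trans hst), h2, this]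
  momentum φ hφ s t hs hst := by
    obtain ⟨h1, h2⟩ := hV.momentum φ hφ s t hs hst
    refine ⟨h.intervalIntegrable_moment hs hst h1, ?_⟩
    have := h.integral_moment 1 2 (deriv φ) hs hst
    simp only [one_mul] at this
    rw [h.moment_eq _ _ hs, h.moment_eq _ _ (hs.trans hst), h2, this]

theorem Equiv.energyAdmissible (h : U.Equiv V) (hV : V.EnergyAdmissible) :
    U.EnergyAdmissible := by
  intro φ hφ hφ0 s t hs hst
  obtain ⟨h1, h2⟩ := hV φ hφ hφ0 s t hs hst
  refine ⟨h.intervalIntegrable_moment hs hst h1, ?_⟩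
  rwa [h.moment_eq _ _ hs, h.moment_eq _ _ (hs.trans hst), h.integral_moment _ _ _ hs hst]

theorem Equiv.represents (h : U.Equiv V) {N : ℕ} {P : WavePattern N} (hP : P.Represents V) :
    P.Represents U where
  ordered := hP.ordered
  continuous := hP.continuous
  smooth := hP.smooth
  noInteraction := hP.noInteraction
  strength_nonneg := hP.strength_nonneg
  stateDensity_nonneg := hP.stateDensity_nonneg
  density_eq t ht := (h t ht).1.trans (hP.density_eq t ht)
  velocity_state t ht j hj := by
    have h1 := h.velocity_ae ht
    rw [hP.density_eq t ht, EventuallyEq, ae_add_measure_iff, ae_finsetSum_measure_iff] at h1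
    have h2 := h1.1 j (Finset.mem_univ j)
    rw [Measure.ae_ennreal_smul_measure_iff (by simpa using hj)] at h2
    filter_upwards [h2, hP.velocity_state t ht j hj] with x e1 e2
    rw [e1, e2]
  velocity_front k t ht hI hk := by
    rw [← hP.velocity_front k t ht hI hk]
    refine velocity_eq_of_ae (h t ht.le).2 fun h0 => ?_
    rw [hP.density_eq t ht.le |> (h t ht.le).1.trans] at h0
    simp only [Measure.coe_add, Pi.add_apply, Measure.coe_finsetSum, Finset.sum_apply,
      Measure.smul_apply, smul_eq_mul, add_eq_zero, Finset.sum_eq_zero_iff] at h0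
    have := h0.2 k (Finset.mem_univ k)
    simp at this
    linarith

theorem Equiv.isAdmissibleSolution (h : U.Equiv V) (hV : IsAdmissibleSolution V R v) :
    IsAdmissibleSolution U R v := by
  obtain ⟨h1, h2, N, P, hP, hO⟩ := hV
  exact ⟨h.isWeakSolution h1, h.energyAdmissible h2, N, P, h.represents hP, hO⟩

end GasFlow

/-- The mean of a function over a shrinking interval tends to its value at the centre. -/
theorem tendsto_symmetric_difference {F : ℝ → ℝ} {f x : ℝ} (h : HasDerivAt F f x) (ξ : ℝ) :
    Tendsto (fun μ => ξ / μ * (F (x + μ / 2) - F (x - μ / 2))) (𝓝[>] 0) (𝓝 (ξ * f)) := by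
  have h1 : HasDerivAt (fun μ => F (x + μ / 2) - F (x - μ / 2)) f 0 := by
    have e1 : HasDerivAt (fun μ : ℝ => x + μ / 2) (1 / 2) 0 :=
      ((hasDerivAt_id (0 : ℝ)).div_const 2).const_add x
    have e2 : HasDerivAt (fun μ : ℝ => x - μ / 2) (-(1 / 2)) 0 :=
      ((hasDerivAt_id (0 : ℝ)).div_const 2).const_sub x
    have := (HasDerivAt.comp (0 : ℝ) (by simpa using h) e1).sub
      (HasDerivAt.comp (0 : ℝ) (by simpa using h) e2)
    exact this.congr_deriv (by ring)
  have h2 := (h1.tendsto_slope_zero_right).const_mul ξ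
  refine h2.congr fun μ => ?_
  simp
  ring

namespace DeltaRiemannData

variable {D : DeltaRiemannData} {U V : GasFlow} {L μ w : ℝ}

theorem approxVelocity_ae {v : ℝ → ℝ} (hμ : 0 < μ) (h1 : ∀ x, x < -(μ / 2) → v x = D.u₀)
    (h2 : ∀ x ∈ Ioo (-(μ / 2)) (μ / 2), v x = w) (h3 : ∀ x, μ / 2 < x → v x = D.u₁) :
    v =ᵐ[D.approxDensity μ] D.approxVelocity μ w := by
  rw [approxDensity, EventuallyEq, ae_add_measure_iff, ae_add_measure_iff]
  refine ⟨⟨Measure.ae_smul_measure ?_ _, Measure.ae_smul_measure ?_ _⟩,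
    Measure.ae_smul_measure ?_ _⟩
  · filter_upwards [ae_restrict_mem measurableSet_Iio] with x hx
    rw [h1 x hx, approxVelocity, if_pos (mem_Iio.1 hx)]
  · filter_upwards [ae_restrict_mem measurableSet_Ioo] with x hx
    rw [h2 x hx, approxVelocity, if_neg hx.1.not_gt, if_pos hx.2]
  · filter_upwards [ae_restrict_mem measurableSet_Ioi] with x hx
    have hx' : μ / 2 < x := hx
    rw [h3 x hx, approxVelocity, if_neg (by linarith), if_neg (by linarith)]

/-- Only the middle state depends on `w`, and quadratically, so comparing initial energies is
comparing `w²`. -/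
theorem initialEnergy_eq (hξ : 0 < D.ξ) (hμ : 0 < μ) (L w : ℝ) : D.initialEnergy L μ w =
    D.initialEnergy L μ 0 + D.ξ / μ * volume.real (Ioo (-(μ / 2)) (μ / 2) ∩ Icc (-L) L) *
      (1 / 2 * w ^ 2) := by
  have key : ∀ w, D.initialEnergy L μ w =
      (∫ x in Icc (-L) L, 1 / 2 * D.u₀ ^ 2 ∂(ENNReal.ofReal D.ρ₀ • volume.restrict (Iio (-(μ / 2))))) +
      (∫ x in Icc (-L) L, 1 / 2 * w ^ 2
        ∂(ENNReal.ofReal (D.ξ / μ) • volume.restrict (Ioo (-(μ / 2)) (μ / 2)))) +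
      ∫ x in Icc (-L) L, 1 / 2 * D.u₁ ^ 2 ∂(ENNReal.ofReal D.ρ₁ • volume.restrict (Ioi (μ / 2))) := by
    intro w
    have hae : ∀ {ρ : ℝ} {S : Set ℝ} (c : ℝ), MeasurableSet S →
        (∀ x ∈ S, D.approxVelocity μ w x = c) →
        (fun x => 1 / 2 * D.approxVelocity μ w x ^ 2)
          =ᵐ[(ENNReal.ofReal ρ • volume.restrict S).restrict (Icc (-L) L)] fun _ => 1 / 2 * c ^ 2 := by
      intro ρ S c hS h
      refine ae_restrict_of_ae (Measure.ae_smul_measure ?_ _)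
      filter_upwards [ae_restrict_mem hS] with x hx
      rw [h x hx]
    have hInt : ∀ (ρ c : ℝ) (S : Set ℝ), Integrable (fun _ : ℝ => 1 / 2 * c ^ 2)
        ((ENNReal.ofReal ρ • volume.restrict S).restrict (Icc (-L) L)) := by
      intro ρ c S
      rw [Measure.restrict_smul]
      have : IsFiniteMeasure ((volume.restrict S).restrict (Icc (-L) L)) :=
        ⟨by rw [Measure.restrict_apply_univ]
            exact (Measure.restrict_apply_le _ _).trans_lt isCompact_Icc.measure_lt_top⟩
      exact (integrable_const _).smul_measure ENNReal.ofReal_ne_top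
    have e1 := hae (ρ := D.ρ₀) D.u₀ (measurableSet_Iio (a := -(μ / 2))) fun x (hx : x < _) => by
      rw [approxVelocity, if_pos hx]
    have e2 := hae (ρ := D.ξ / μ) w (measurableSet_Ioo (a := -(μ / 2)) (b := μ / 2)) fun x hx => by
      rw [approxVelocity, if_neg hx.1.not_gt, if_pos hx.2]
    have e3 := hae (ρ := D.ρ₁) D.u₁ (measurableSet_Ioi (a := μ / 2)) fun x (hx : μ / 2 < x) => by
      rw [approxVelocity, if_neg (by linarith), if_neg (by linarith)]
    have i1 := (hInt D.ρ₀ D.u₀ _).congr e1.symm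
    have i2 := (hInt (D.ξ / μ) w _).congr e2.symm
    have i3 := (hInt D.ρ₁ D.u₁ _).congr e3.symm
    rw [initialEnergy, approxDensity, Measure.restrict_add, Measure.restrict_add,
      integral_add_measure (i1.add_measure i2) i3, integral_add_measure i1 i2,
      integral_congr_ae e1, integral_congr_ae e2, integral_congr_ae e3]
  have hmid : ∀ w, (∫ x in Icc (-L) L, 1 / 2 * w ^ 2
        ∂(ENNReal.ofReal (D.ξ / μ) • volume.restrict (Ioo (-(μ / 2)) (μ / 2)))) =
      D.ξ / μ * volume.real (Ioo (-(μ / 2)) (μ / 2) ∩ Icc (-L) L) * (1 / 2 * w ^ 2) := by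
    intro w
    rw [Measure.restrict_smul, integral_smul_measure, ENNReal.toReal_ofReal (by positivity),
      Measure.restrict_restrict measurableSet_Icc, setIntegral_const, smul_eq_mul, smul_eq_mul,
      inter_comm]
    ring
  rw [key w, key 0, hmid, hmid]
  ring

theorem initialEnergy_mono (hξ : 0 < D.ξ) (hμ : 0 < μ) (L : ℝ) {w w' : ℝ} (h : w ^ 2 ≤ w' ^ 2) :
    D.initialEnergy L μ w ≤ D.initialEnergy L μ w' := by
  rw [initialEnergy_eq hξ hμ L w, initialEnergy_eq hξ hμ L w']
  gcongr

theorem initialEnergy_strictMono (hξ : 0 < D.ξ) (hμ : 0 < μ) (hL : 0 < L) {w w' : ℝ}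
    (h : w ^ 2 < w' ^ 2) : D.initialEnergy L μ w < D.initialEnergy L μ w' := by
  rw [initialEnergy_eq hξ hμ L w, initialEnergy_eq hξ hμ L w']
  have : 0 < volume.real (Ioo (-(μ / 2)) (μ / 2) ∩ Icc (-L) L) := by
    have hsub : Ioo (-(min (μ / 2) L)) (min (μ / 2) L) ⊆ Ioo (-(μ / 2)) (μ / 2) ∩ Icc (-L) L := by
      intro x hx
      have := min_le_left (μ / 2) L
      have := min_le_right (μ / 2) L
      exact ⟨⟨by linarith [hx.1], by linarith [hx.2]⟩, ⟨by linarith [hx.1], by linarith [hx.2]⟩⟩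
    refine lt_of_lt_of_le ?_ (measureReal_mono hsub
      ((measure_mono inter_subset_left).trans_lt measure_Ioo_lt_top).ne)
    have : 0 < min (μ / 2) L := lt_min (by linarith) hL
    rw [Real.volume_real_Ioo_of_le (by linarith)]
    linarith
  gcongr

theorem energyOn_zero (hU : U.IsWeakSolution (D.approxDensity μ) (D.approxVelocity μ w)) :
    U.energyOn L 0 = D.initialEnergy L μ w := by
  rw [GasFlow.energyOn, hU.density_zero, initialEnergy]
  refine integral_congr_ae (ae_restrict_of_ae ?_)
  filter_upwards [hU.velocity_zero] with x hx
  rw [hx]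

/-- If a middle velocity maximizes the energy rate, and minimizes strictly the initial energy
among all maximizers, then it is selected, and no other is. -/
theorem isSelected_iff (h₀ : 0 < D.ρ₀) (h₁ : 0 < D.ρ₁) (hμ : 0 < μ)
    (hμL : μ < 2 * L) (hμ₀ : D.ρ₀ < D.ξ / μ) (hμ₁ : D.ρ₁ < D.ξ / μ)
    (hV : IsAdmissibleSolution V (D.approxDensity μ) (D.approxVelocity μ w))
    (hrate : ∀ w', D.energyRate μ w' ≤ D.energyRate μ w)
    (hmin : ∀ w', D.energyRate μ w' = D.energyRate μ w → w' ≠ w →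
      D.initialEnergy L μ w < D.initialEnergy L μ w') {w' : ℝ} :
    D.IsSelected L μ w' U ↔
      IsAdmissibleSolution U (D.approxDensity μ) (D.approxVelocity μ w') ∧ w' = w := by
  have hderiv : ∀ {U w' d}, IsAdmissibleSolution U (D.approxDensity μ) (D.approxVelocity μ w') →
      HasDerivWithinAt (U.energyOn L) d (Ici 0) 0 → d = D.energyRate μ w' := fun hU hd =>
    (uniqueDiffOn_Ici (0 : ℝ) 0 self_mem_Ici).eq_deriv _ hd
      (energyOn_hasDerivWithinAt h₀ h₁ hμ hμL hμ₀ hμ₁ hU)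
  have hLD : ∀ {w' U}, D.HasLeastDissipation L μ w' U ↔
      IsAdmissibleSolution U (D.approxDensity μ) (D.approxVelocity μ w') ∧
        D.energyRate μ w' = D.energyRate μ w := by
    intro w' U
    constructor
    · rintro ⟨hU, d, hd, hmax⟩
      -- `V` is the competitor that realizes the greatest rate; without an admissible solution for
      -- `w` this bound would not be available.
      have := hmax w V _ hV (energyOn_hasDerivWithinAt h₀ h₁ hμ hμL hμ₀ hμ₁ hV)
      rw [hderiv hU hd] at this
      exact ⟨hU, le_antisymm (hrate w') this⟩
    · rintro ⟨hU, he⟩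
      refine ⟨hU, _, energyOn_hasDerivWithinAt h₀ h₁ hμ hμL hμ₀ hμ₁ hU, fun w'' U' d' hU' hd' => ?_⟩
      rw [hderiv hU' hd', he]
      exact hrate w''
  constructor
  · rintro ⟨h1, h2⟩
    obtain ⟨hU, he⟩ := hLD.1 h1
    refine ⟨hU, by_contra fun hne => ?_⟩
    have := h2 w V (hLD.2 ⟨hV, rfl⟩)
    rw [energyOn_zero hU.1, energyOn_zero hV.1] at this
    exact this.not_gt (hmin w' he hne)
  · rintro ⟨hU, rfl⟩
    refine ⟨hLD.2 ⟨hU, rfl⟩, fun w'' U' h => ?_⟩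
    obtain ⟨hU', he⟩ := hLD.1 h
    rw [energyOn_zero hU.1, energyOn_zero hU'.1]
    by_cases hne : w'' = w'
    · rw [hne]
    · exact (hmin w'' he hne).le

/-- The values of `μ` that are small enough for the selection to be determined by the data. -/
theorem eventually_small (hξ : 0 < D.ξ) (hL : 0 < L) :
    ∀ᶠ μ in 𝓝[>] (0 : ℝ), 0 < μ ∧ μ < 2 * L ∧ D.ρ₀ < D.ξ / μ ∧ D.ρ₁ < D.ξ / μ := by
  have h1 : Tendsto (fun μ => D.ξ / μ) (𝓝[>] 0) atTop := by
    simp only [div_eq_mul_inv]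
    exact tendsto_inv_nhdsGT_zero.const_mul_atTop hξ
  filter_upwards [self_mem_nhdsWithin, nhdsWithin_le_nhds (Iio_mem_nhds (show 0 < 2 * L by linarith)),
    h1.eventually_gt_atTop D.ρ₀, h1.eventually_gt_atTop D.ρ₁] with μ e1 e2 e3 e4
  exact ⟨e1, e2, e3, e4⟩

/-- Two selected families have, for small `μ`, the same data, hence the same limit at time `0`. This
limit fixes the velocity of the point mass, and uniqueness for the delta Riemann problem with that
velocity does the rest. The later times of the given family are not used. -/
theorem satisfiesBackwardEnergyCondition_iff {E : GasFlow} {wE : ℝ} {w : ℝ → ℝ} {V : ℝ → GasFlow}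
    (hE : IsAdmissibleSolution E D.initialDensity (D.initialVelocity wE))
    (huniq : ∀ U, IsAdmissibleSolution U D.initialDensity (D.initialVelocity wE) → U.Equiv E)
    (hsel : ∀ᶠ μ in 𝓝[>] (0 : ℝ),
      IsAdmissibleSolution (V μ) (D.approxDensity μ) (D.approxVelocity μ (w μ)) ∧
      ∀ w' U', D.IsSelected L μ w' U' ↔
        IsAdmissibleSolution U' (D.approxDensity μ) (D.approxVelocity μ w') ∧ w' = w μ)
    (hconv : GasFlow.ConvergesTo V E) (U : GasFlow) :
    D.SatisfiesBackwardEnergyCondition L U ↔ U.Equiv E := by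
  constructor
  · rintro ⟨⟨w₁, hU⟩, w', V', hV', hconv'⟩
    have h0 : U.AgreeAt E 0 := by
      intro φ hφ
      have hag : ∀ᶠ μ in 𝓝[>] (0 : ℝ), (V μ).AgreeAt (V' μ) 0 := by
        filter_upwards [hsel, hV'] with μ h1 h2
        obtain ⟨h3, h4⟩ := (h1.2 _ _).1 h2
        rw [h4] at h3
        refine GasFlow.agreeAt_of_ae (h1.1.1.density_zero.trans h3.1.density_zero.symm) ?_
        rw [h1.1.1.density_zero]
        exact h1.1.1.velocity_zero.trans h3.1.velocity_zero.symm
      exact ⟨tendsto_nhds_unique (hconv' 0 le_rfl φ hφ).1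
          ((hconv 0 le_rfl φ hφ).1.congr' (hag.mono fun μ h => (h φ hφ).1)),
        tendsto_nhds_unique (hconv' 0 le_rfl φ hφ).2
          ((hconv 0 le_rfl φ hφ).2.congr' (hag.mono fun μ h => (h φ hφ).2))⟩
    obtain ⟨-, hv⟩ := hU.1.eq_of_agreeAt hE.1 le_rfl h0
    rw [hU.1.density_zero] at hv
    exact huniq U ⟨{ hU.1 with velocity_zero := hv.trans hE.1.velocity_zero }, hU.2⟩
  · intro h
    refine ⟨⟨wE, h.isAdmissibleSolution hE⟩, w, V, ?_, fun t ht φ hφ => ?_⟩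
    · filter_upwards [hsel] with μ hμ
      exact (hμ.2 _ _).2 ⟨hμ.1, rfl⟩
    · rw [h.moment_eq _ _ ht, h.moment_eq _ _ ht]
      exact hconv t ht φ hφ

end DeltaRiemannData


/-! ### The case `u₀ ≤ u₁`: contact discontinuities -/

namespace DeltaRiemannData

variable {D : DeltaRiemannData} {L μ w : ℝ}

/-- For `u₀ ≤ w ≤ u₁` the approximate problem is solved by four contact discontinuities. -/
noncomputable def contactPattern (D : DeltaRiemannData) (μ w : ℝ) : WavePattern 4 :=
  .straight ![-(μ / 2), -(μ / 2), μ / 2, μ / 2] ![D.u₀, w, w, D.u₁] 0 0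
    ![D.ρ₀, 0, D.ξ / μ, 0, D.ρ₁] ![D.u₀, 0, w, 0, D.u₁]

/-- No front carries mass, so the front velocities handed to `flow` are irrelevant. -/
noncomputable def contactFlow (D : DeltaRiemannData) (μ w : ℝ) : GasFlow :=
  (D.contactPattern μ w).flow 0

theorem isStraightSolution_contactPattern (h₀ : 0 < D.ρ₀) (h₁ : 0 < D.ρ₁) (hξ : 0 < D.ξ)
    (hμ : 0 < μ) (hw : w ∈ Icc D.u₀ D.u₁) : WavePattern.IsStraightSolution
      ![-(μ / 2), -(μ / 2), μ / 2, μ / 2] ![D.u₀, w, w, D.u₁] 0 0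
      ![D.ρ₀, 0, D.ξ / μ, 0, D.ρ₁] ![D.u₀, 0, w, 0, D.u₁] where
  mono t ht := by
    obtain ⟨h1, h2⟩ := hw
    have e1 : D.u₀ * t ≤ w * t := by gcongr
    have e2 : w * t ≤ D.u₁ * t := by gcongr
    rw [Fin.monotone_iff_le_succ]
    intro k
    fin_cases k <;> simp <;> linarith
  separate i k t ht he := by
    obtain ⟨h1, h2⟩ := hw
    have e1 : D.u₀ * t ≤ w * t := by gcongr
    have e2 : w * t ≤ D.u₁ * t := by gcongr
    fin_cases i <;> fin_cases k <;> simp [ht.ne'] at he ⊢ <;> first | exact he | linarith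
  m_nonneg := by simp
  n_nonneg := by simp
  r_nonneg := by
    have : 0 ≤ D.ξ / μ := by positivity
    simpa [Fin.forall_fin_succ] using ⟨h₀.le, this, h₁.le⟩
  mass := by simp [Fin.forall_fin_succ]
  momentum := by simp [Fin.forall_fin_succ]
  left := by simp [Fin.forall_fin_succ]
  right := by simp [Fin.forall_fin_succ]

theorem contactFlow_velocity (t : ℝ) (j : Fin 5) (x : ℝ)
    (hx : x ∈ frontGap (fun k => (D.contactPattern μ w).front k t) j) :
    (D.contactFlow μ w).velocity t x = (D.contactPattern μ w).stateVelocity j :=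
  WavePattern.flow_velocity_gap 0 hx

theorem contactFlow_represents (h₀ : 0 < D.ρ₀) (h₁ : 0 < D.ρ₁) (hξ : 0 < D.ξ)
    (hμ : 0 < μ) (hw : w ∈ Icc D.u₀ D.u₁) :
    (D.contactPattern μ w).Represents (D.contactFlow μ w) :=
  (isStraightSolution_contactPattern h₀ h₁ hξ hμ hw).represents (fun t _ => rfl)
    (fun t _ j _ x hx => contactFlow_velocity t j x hx) (fun t _ k hk => by simp at hk)

theorem contactPattern_gap_zero (hμ : 0 < μ) :
    frontGap (fun k => (D.contactPattern μ w).front k 0) 0 = Iio (-(μ / 2)) ∧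
    frontGap (fun k => (D.contactPattern μ w).front k 0) 2 = Ioo (-(μ / 2)) (μ / 2) ∧
    frontGap (fun k => (D.contactPattern μ w).front k 0) 4 = Ioi (μ / 2) := by
  refine ⟨?_, ?_, ?_⟩ <;> ext x <;>
    simp [frontGap, contactPattern, WavePattern.straight, Fin.forall_fin_succ] <;> grind

theorem contactFlow_admissible (h₀ : 0 < D.ρ₀) (h₁ : 0 < D.ρ₁) (hξ : 0 < D.ξ)
    (hμ : 0 < μ) (hw : w ∈ Icc D.u₀ D.u₁) :
    IsAdmissibleSolution (D.contactFlow μ w) (D.approxDensity μ) (D.approxVelocity μ w) := by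
  have hv0 := contactFlow_velocity (D := D) (μ := μ) (w := w) 0
  obtain ⟨g0, g2, g4⟩ := contactPattern_gap_zero (D := D) (w := w) hμ
  refine (isStraightSolution_contactPattern h₀ h₁ hξ hμ hw).admissible
    (contactFlow_represents h₀ h₁ hξ hμ hw) (fun t _ k hk => by simp at hk) ?_
    (approxVelocity_ae hμ (fun x hx => hv0 0 x (g0.symm ▸ hx)) (fun x hx => hv0 2 x (g2.symm ▸ hx))
      fun x hx => hv0 4 x (g4.symm ▸ hx))
  change ∑ j, ENNReal.ofReal ((D.contactPattern μ w).stateDensity j) •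
      volume.restrict (frontGap (fun k => (D.contactPattern μ w).front k 0) j) + _ = _
  rw [Fin.sum_univ_five, g0, g2, g4]
  simp [contactPattern, WavePattern.straight, approxDensity]

/-- The last term is `ξ` times a symmetric difference quotient of the primitive; as `μ → 0` it
becomes the point mass. -/
theorem contactFlow_moment (h₀ : 0 < D.ρ₀) (h₁ : 0 < D.ρ₁) (hξ : 0 < D.ξ)
    (hμ : 0 < μ) (hw : w ∈ Icc D.u₀ D.u₁) (i : ℕ) {φ : ℝ → ℝ} (hφ : IsTestFunction φ) {t : ℝ}
    (ht : 0 ≤ t) : (D.contactFlow μ w).moment i φ t = D.ρ₁ * D.u₁ ^ i * (∫ x, φ x) +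
      D.ρ₀ * D.u₀ ^ i * primitive φ (D.u₀ * t - μ / 2) -
      D.ρ₁ * D.u₁ ^ i * primitive φ (D.u₁ * t + μ / 2) +
      w ^ i * (D.ξ / μ * (primitive φ (w * t + μ / 2) - primitive φ (w * t - μ / 2))) := by
  rw [(contactFlow_represents h₀ h₁ hξ hμ hw).moment_eq ht hφ.integrable, Fin.sum_univ_four]
  simp [WavePattern.jump_eq, contactPattern, WavePattern.straight, Fin.last]
  ring_nf

theorem contactFlow_convergesTo (h₀ : 0 < D.ρ₀) (h₁ : 0 < D.ρ₁) (hξ : 0 < D.ξ)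
    (h : D.u₀ ≤ D.u₁) :
    GasFlow.ConvergesTo (fun μ => D.contactFlow μ D.contactSpeed) D.deltaContact := by
  have hw := contactSpeed_mem h
  intro t ht φ hφ
  have key : ∀ i, Tendsto (fun μ => (D.contactFlow μ D.contactSpeed).moment i φ t) (𝓝[>] 0)
      (𝓝 (D.deltaContact.moment i φ t)) := by
    intro i
    have hF : ∀ x, ContinuousAt (primitive φ) x := fun x => (hasDerivAt_primitive hφ x).continuousAt
    have e1 : Tendsto (fun μ => primitive φ (D.u₀ * t - μ / 2)) (𝓝[>] 0)
        (𝓝 (primitive φ (D.u₀ * t))) := by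
      refine (hF _).tendsto.comp (Tendsto.mono_left ?_ nhdsWithin_le_nhds)
      exact (by fun_prop : Continuous fun μ : ℝ => D.u₀ * t - μ / 2).tendsto' _ _ (by simp)
    have e2 : Tendsto (fun μ => primitive φ (D.u₁ * t + μ / 2)) (𝓝[>] 0)
        (𝓝 (primitive φ (D.u₁ * t))) := by
      refine (hF _).tendsto.comp (Tendsto.mono_left ?_ nhdsWithin_le_nhds)
      exact (by fun_prop : Continuous fun μ : ℝ => D.u₁ * t + μ / 2).tendsto' _ _ (by simp)
    have e3 := tendsto_symmetric_difference (hasDerivAt_primitive hφ (D.contactSpeed * t)) D.ξ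
    have e4 := (((e1.const_mul (D.ρ₀ * D.u₀ ^ i)).const_add (D.ρ₁ * D.u₁ ^ i * ∫ x, φ x)).sub
      (e2.const_mul (D.ρ₁ * D.u₁ ^ i))).add (e3.const_mul (D.contactSpeed ^ i))
    have e5 : D.deltaContact.moment i φ t = D.ρ₁ * D.u₁ ^ i * (∫ x, φ x) +
        D.ρ₀ * D.u₀ ^ i * primitive φ (D.u₀ * t) - D.ρ₁ * D.u₁ ^ i * primitive φ (D.u₁ * t) +
        D.contactSpeed ^ i * (D.ξ * φ (D.contactSpeed * t)) := by
      rw [(deltaContact_represents h₀ h₁ hξ h).moment_eq ht hφ.integrable, Fin.sum_univ_three]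
      simp [WavePattern.jump_eq, WavePattern.straight, deltaContact, Fin.last]
      ring
    rw [e5]
    refine e4.congr' ?_
    filter_upwards [self_mem_nhdsWithin] with μ hμ
    rw [contactFlow_moment h₀ h₁ hξ hμ hw i hφ ht]
  exact ⟨key 0, key 1⟩

theorem dissipation_nonneg {ρl ul ρr ur : ℝ} (hl : 0 < ρl) (hr : 0 < ρr) :
    0 ≤ dissipation ρl ul ρr ur := by
  unfold dissipation; positivity

theorem dissipation_eq_zero_iff {ρl ul ρr ur : ℝ} (hl : 0 < ρl) (hr : 0 < ρr) :
    dissipation ρl ul ρr ur = 0 ↔ ul ≤ ur := by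
  have : 0 < ρl * ρr / (√ρl + √ρr) ^ 2 := by positivity
  rw [dissipation, mul_eq_zero, or_iff_right this.ne', pow_eq_zero_iff three_ne_zero,
    max_eq_right_iff, sub_nonpos]

/-- The rate is a constant minus two nonnegative dissipations, which vanish together exactly on
`[u₀, u₁]`. All of this interval is maximal, so the initial energy has to decide. -/
theorem energyRate_le_iff (h₀ : 0 < D.ρ₀) (h₁ : 0 < D.ρ₁) (hξ : 0 < D.ξ) (hμ : 0 < μ)
    (hw : w ∈ Icc D.u₀ D.u₁) (w' : ℝ) : D.energyRate μ w' ≤ D.energyRate μ w ∧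
      (D.energyRate μ w' = D.energyRate μ w → w' ∈ Icc D.u₀ D.u₁) := by
  have hr : 0 < D.ξ / μ := by positivity
  have e1 := (dissipation_eq_zero_iff h₀ hr).2 hw.1
  have e2 := (dissipation_eq_zero_iff hr h₁).2 hw.2
  have e3 := dissipation_nonneg (ul := D.u₀) (ur := w') h₀ hr
  have e4 := dissipation_nonneg (ul := w') (ur := D.u₁) hr h₁
  unfold energyRate
  rw [e1, e2]
  refine ⟨by linarith, fun he => ⟨(dissipation_eq_zero_iff h₀ hr).1 ?_,
    (dissipation_eq_zero_iff hr h₁).1 ?_⟩⟩ <;> linarith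

theorem satisfiesBackwardEnergyCondition_iff_deltaContact (h₀ : 0 < D.ρ₀) (h₁ : 0 < D.ρ₁)
    (hξ : 0 < D.ξ) (hL : 0 < L) (h : D.u₀ ≤ D.u₁) (U : GasFlow) :
    D.SatisfiesBackwardEnergyCondition L U ↔ U.Equiv D.deltaContact := by
  have hw := contactSpeed_mem h
  refine satisfiesBackwardEnergyCondition_iff (w := fun _ => D.contactSpeed)
    (deltaContact_admissible h₀ h₁ hξ h) (fun U => equiv_deltaContact h₀ h₁ hξ h) ?_
    (contactFlow_convergesTo h₀ h₁ hξ h) U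
  filter_upwards [D.eventually_small hξ hL] with μ ⟨hμ, hμL, hμ₀, hμ₁⟩
  have hV := contactFlow_admissible h₀ h₁ hξ hμ hw
  refine ⟨hV, fun w' U' => isSelected_iff h₀ h₁ hμ hμL hμ₀ hμ₁ hV
    (fun w' => (energyRate_le_iff h₀ h₁ hξ hμ hw w').1) fun w' he hne => ?_⟩
  obtain ⟨h1, h2⟩ := contactSpeed_sq_le h ((energyRate_le_iff h₀ h₁ hξ hμ hw w').2 he)
  exact initialEnergy_strictMono hξ hμ hL (h1.lt_of_ne fun h3 => hne (h2 h3))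

end DeltaRiemannData


/-! ### The barycenter equation -/

/-- The root `Y` of `ρ₁ (l₁ + Y)² - ρ₀ (l₀ - Y)² + 2 ξ Y = 0` that lies in `[-l₁, l₀]`.  When a mass
`ξ` that was at rest has absorbed the matter of the densities `ρ₀` and `ρ₁` from its two sides,
which without it would have advanced to `l₀` and `-l₁`, then this is its position. -/
noncomputable def absorbedShift (ρ₀ ρ₁ ξ l₀ l₁ : ℝ) : ℝ :=
  -(ρ₁ * l₁ ^ 2 - ρ₀ * l₀ ^ 2) / (ρ₁ * l₁ + ρ₀ * l₀ + ξ +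
    √(ρ₀ * ρ₁ * (l₀ + l₁) ^ 2 + 2 * ξ * (ρ₁ * l₁ + ρ₀ * l₀) + ξ ^ 2))

section AbsorbedShift

variable {ρ₀ ρ₁ ξ l₀ l₁ : ℝ}

theorem absorbedShift_disc_pos (h₀ : 0 < ρ₀) (h₁ : 0 < ρ₁) (hξ : 0 < ξ) (hl₀ : 0 ≤ l₀)
    (hl₁ : 0 ≤ l₁) :
    0 < ρ₀ * ρ₁ * (l₀ + l₁) ^ 2 + 2 * ξ * (ρ₁ * l₁ + ρ₀ * l₀) + ξ ^ 2 := by positivity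

theorem absorbedShift_denom_pos (h₀ : 0 < ρ₀) (h₁ : 0 < ρ₁) (hξ : 0 < ξ) (hl₀ : 0 ≤ l₀)
    (hl₁ : 0 ≤ l₁) : 0 < ρ₁ * l₁ + ρ₀ * l₀ + ξ +
    √(ρ₀ * ρ₁ * (l₀ + l₁) ^ 2 + 2 * ξ * (ρ₁ * l₁ + ρ₀ * l₀) + ξ ^ 2) := by positivity

/-- The quadratic formula with the square root moved to the denominator. This form also covers `ρ₀ =
ρ₁`, where the equation is linear, and its positive denominator and discriminant give smoothness. -/
theorem absorbedShift_spec (h₀ : 0 < ρ₀) (h₁ : 0 < ρ₁) (hξ : 0 < ξ) (hl₀ : 0 ≤ l₀)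
    (hl₁ : 0 ≤ l₁) :
    ρ₁ * (l₁ + absorbedShift ρ₀ ρ₁ ξ l₀ l₁) ^ 2 - ρ₀ * (l₀ - absorbedShift ρ₀ ρ₁ ξ l₀ l₁) ^ 2 +
      2 * ξ * absorbedShift ρ₀ ρ₁ ξ l₀ l₁ = 0 := by
  have hd := absorbedShift_denom_pos h₀ h₁ hξ hl₀ hl₁
  have hs := Real.sq_sqrt (absorbedShift_disc_pos h₀ h₁ hξ hl₀ hl₁).le
  unfold absorbedShift
  set s := √(ρ₀ * ρ₁ * (l₀ + l₁) ^ 2 + 2 * ξ * (ρ₁ * l₁ + ρ₀ * l₀) + ξ ^ 2)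
  set n := ρ₁ * l₁ + ρ₀ * l₀ + ξ + s with hn
  set q := ρ₁ * l₁ ^ 2 - ρ₀ * l₀ ^ 2 with hq
  have e1 : ρ₁ * (l₁ + -q / n) ^ 2 - ρ₀ * (l₀ - -q / n) ^ 2 + 2 * ξ * (-q / n) =
      q * ((ρ₁ - ρ₀) * q - 2 * (n - s) * n + n ^ 2) / n ^ 2 := by
    field_simp
    rw [hq, hn]; ring
  rw [e1, show (ρ₁ - ρ₀) * q - 2 * (n - s) * n + n ^ 2 = 0 by rw [hn, hq]; linear_combination hs]
  simp

theorem absorbedShift_le (h₀ : 0 < ρ₀) (h₁ : 0 < ρ₁) (hξ : 0 < ξ) (hl₀ : 0 ≤ l₀)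
    (hl₁ : 0 ≤ l₁) : absorbedShift ρ₀ ρ₁ ξ l₀ l₁ ≤ l₀ := by
  rw [absorbedShift, div_le_iff₀ (absorbedShift_denom_pos h₀ h₁ hξ hl₀ hl₁)]
  have h2 := Real.sqrt_nonneg (ρ₀ * ρ₁ * (l₀ + l₁) ^ 2 + 2 * ξ * (ρ₁ * l₁ + ρ₀ * l₀) + ξ ^ 2)
  have : 0 ≤ l₀ * (ρ₁ * l₁ + ξ +
    √(ρ₀ * ρ₁ * (l₀ + l₁) ^ 2 + 2 * ξ * (ρ₁ * l₁ + ρ₀ * l₀) + ξ ^ 2)) := by positivity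
  have : 0 ≤ ρ₁ * l₁ ^ 2 := by positivity
  linarith

theorem neg_le_absorbedShift (h₀ : 0 < ρ₀) (h₁ : 0 < ρ₁) (hξ : 0 < ξ) (hl₀ : 0 ≤ l₀)
    (hl₁ : 0 ≤ l₁) : -l₁ ≤ absorbedShift ρ₀ ρ₁ ξ l₀ l₁ := by
  rw [absorbedShift, le_div_iff₀ (absorbedShift_denom_pos h₀ h₁ hξ hl₀ hl₁)]
  have : 0 ≤ l₁ * (ρ₀ * l₀ + ξ +
    √(ρ₀ * ρ₁ * (l₀ + l₁) ^ 2 + 2 * ξ * (ρ₁ * l₁ + ρ₀ * l₀) + ξ ^ 2)) := by positivity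
  have : 0 ≤ ρ₀ * l₀ ^ 2 := by positivity
  linarith

theorem absorbedShift_contDiffAt (h₀ : 0 < ρ₀) (h₁ : 0 < ρ₁) (hξ : 0 < ξ) (hl₀ : 0 ≤ l₀)
    (hl₁ : 0 ≤ l₁) {E : Type*} [NormedAddCommGroup E] [NormedSpace ℝ E]
    {f g : E → ℝ} {x : E} (hf : ContDiffAt ℝ 1 f x) (hg : ContDiffAt ℝ 1 g x)
    (hfx : f x = l₀) (hgx : g x = l₁) :
    ContDiffAt ℝ 1 (fun t => absorbedShift ρ₀ ρ₁ ξ (f t) (g t)) x := by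
  unfold absorbedShift
  have hsq : ContDiffAt ℝ 1 (fun t => ρ₀ * ρ₁ * (f t + g t) ^ 2 +
      2 * ξ * (ρ₁ * g t + ρ₀ * f t) + ξ ^ 2) x := by fun_prop
  refine ContDiffAt.div (by fun_prop) (ContDiffAt.add (by fun_prop) (hsq.sqrt ?_)) ?_
  · rw [hfx, hgx]; exact (absorbedShift_disc_pos h₀ h₁ hξ hl₀ hl₁).ne'
  · rw [hfx, hgx]; exact (absorbedShift_denom_pos h₀ h₁ hξ hl₀ hl₁).ne'

end AbsorbedShift

/-- Equal pushes leave the mass in place. This is used at the moment of collision and again in the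
limit `μ → 0`. -/
theorem absorbedShift_eq_zero {ρ₀ ρ₁ ξ l₀ l₁ : ℝ} (h : ρ₁ * l₁ ^ 2 = ρ₀ * l₀ ^ 2) :
    absorbedShift ρ₀ ρ₁ ξ l₀ l₁ = 0 := by
  simp [absorbedShift, h]

/-! ### Two delta shocks that collide and merge -/

/-- The data of two delta shocks that start from `±σ T` with the velocities `w ± σ` on the two
sides of a state `(r, w)` and meet at the time `T`. -/
structure ShockCollision where
  ρ₀ : ℝ
  ρ₁ : ℝ
  r : ℝ
  u₀ : ℝ
  u₁ : ℝ
  w : ℝ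
  σ : ℝ
  T : ℝ
  ρ₀_pos : 0 < ρ₀
  ρ₁_pos : 0 < ρ₁
  r_pos : 0 < r
  σ_pos : 0 < σ
  T_pos : 0 < T
  lt_u₀ : w + σ < u₀
  u₁_lt : u₁ < w - σ
  balance₀ : ρ₀ * (u₀ - (w + σ)) ^ 2 = r * σ ^ 2
  balance₁ : ρ₁ * ((w - σ) - u₁) ^ 2 = r * σ ^ 2

namespace ShockCollision

variable (C : ShockCollision) {t : ℝ}

/-- The mass between the shocks at the time `0`. -/
noncomputable def ξ : ℝ := 2 * C.σ * C.T * C.r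

/-- The displacement of the merged shock from the line `x = w t`. In the frame moving with `w`, the
edges of the outer states start at `∓σ T` and without the shock would be at `(u₀ - w) t - σ T` and
`σ T - (w - u₁) t`. -/
noncomputable def shift (t : ℝ) : ℝ :=
  absorbedShift C.ρ₀ C.ρ₁ C.ξ ((C.u₀ - C.w) * t - C.σ * C.T) ((C.w - C.u₁) * t - C.σ * C.T)

/-- The widths of the parts of the outer states which the shocks have absorbed, at a time after the
collision. -/
noncomputable def absorbed₀ (t : ℝ) : ℝ := (C.u₀ - C.w) * t - C.σ * C.T - C.shift t

noncomputable def absorbed₁ (t : ℝ) : ℝ := (C.w - C.u₁) * t - C.σ * C.T + C.shift t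

/-- The mass, the momentum and the velocity of the merged shock. -/
noncomputable def mergedMass (t : ℝ) : ℝ := C.ρ₀ * C.absorbed₀ t + C.ξ + C.ρ₁ * C.absorbed₁ t

noncomputable def mergedMomentum (t : ℝ) : ℝ :=
  C.ρ₀ * C.u₀ * C.absorbed₀ t + C.ξ * C.w + C.ρ₁ * C.u₁ * C.absorbed₁ t

noncomputable def mergedVelocity (t : ℝ) : ℝ := C.mergedMomentum t / C.mergedMass t

theorem ξ_pos : 0 < C.ξ := by
  have := C.σ_pos; have := C.T_pos; have := C.r_pos
  unfold ξ; positivity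

theorem left_pos (ht : C.T ≤ t) : 0 < (C.u₀ - C.w) * t - C.σ * C.T := by
  nlinarith [C.lt_u₀, C.T_pos, C.σ_pos]

theorem right_pos (ht : C.T ≤ t) : 0 < (C.w - C.u₁) * t - C.σ * C.T := by
  nlinarith [C.u₁_lt, C.T_pos, C.σ_pos]

theorem shift_contDiffAt (ht : C.T ≤ t) : ContDiffAt ℝ 1 C.shift t :=
  absorbedShift_contDiffAt C.ρ₀_pos C.ρ₁_pos C.ξ_pos (C.left_pos ht).le (C.right_pos ht).le
    (by fun_prop) (by fun_prop) rfl rfl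

theorem absorbed₀_nonneg (ht : C.T ≤ t) : 0 ≤ C.absorbed₀ t :=
  sub_nonneg.2 (absorbedShift_le C.ρ₀_pos C.ρ₁_pos C.ξ_pos (C.left_pos ht).le (C.right_pos ht).le)

theorem absorbed₁_nonneg (ht : C.T ≤ t) : 0 ≤ C.absorbed₁ t :=
  neg_le_iff_add_nonneg'.1
    (neg_le_absorbedShift C.ρ₀_pos C.ρ₁_pos C.ξ_pos (C.left_pos ht).le (C.right_pos ht).le)

theorem shift_T : C.shift C.T = 0 := by
  refine absorbedShift_eq_zero ?_
  linear_combination C.T ^ 2 * (C.balance₁ - C.balance₀)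

theorem mergedMass_pos (ht : C.T ≤ t) : 0 < C.mergedMass t := by
  have := C.absorbed₀_nonneg ht; have := C.absorbed₁_nonneg ht
  have := C.ρ₀_pos; have := C.ρ₁_pos; have := C.ξ_pos
  unfold mergedMass; positivity

theorem mergedVelocity_mul (ht : C.T ≤ t) :
    C.mergedMass t * C.mergedVelocity t = C.mergedMomentum t := by
  rw [mergedVelocity, mul_div_cancel₀ _ (C.mergedMass_pos ht).ne']

/-- The velocity is a mean of `u₀`, `w`, `u₁` weighted by masses; this makes the merged shock
overcompressive. -/
theorem mergedVelocity_mem (ht : C.T ≤ t) : C.mergedVelocity t ∈ Icc C.u₁ C.u₀ := by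
  have := C.absorbed₀_nonneg ht; have := C.absorbed₁_nonneg ht
  have := C.ρ₀_pos; have := C.ρ₁_pos; have := C.ξ_pos
  have h1 : 0 ≤ C.u₀ - C.w := by linarith [C.lt_u₀, C.σ_pos]
  have h2 : 0 ≤ C.w - C.u₁ := by linarith [C.u₁_lt, C.σ_pos]
  have h3 : 0 ≤ C.u₀ - C.u₁ := by linarith
  rw [mem_Icc, mergedVelocity, div_le_iff₀ (C.mergedMass_pos ht), le_div_iff₀ (C.mergedMass_pos ht)]
  unfold mergedMass mergedMomentum
  constructor
  · have : 0 ≤ C.ρ₀ * C.absorbed₀ t * (C.u₀ - C.u₁) + C.ξ * (C.w - C.u₁) := by positivity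
    linarith
  · have : 0 ≤ C.ρ₁ * C.absorbed₁ t * (C.u₀ - C.u₁) + C.ξ * (C.u₀ - C.w) := by positivity
    linarith

theorem absorbed_hasDerivAt {Y' : ℝ} (hY : HasDerivAt C.shift Y' t) :
    HasDerivAt C.absorbed₀ (C.u₀ - C.w - Y') t ∧ HasDerivAt C.absorbed₁ (C.w - C.u₁ + Y') t :=
  ⟨((((hasDerivAt_id t).const_mul (C.u₀ - C.w)).sub_const (C.σ * C.T)).sub hY).congr_deriv (by ring),
    ((((hasDerivAt_id t).const_mul (C.w - C.u₁)).sub_const (C.σ * C.T)).add hY).congr_deriv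
      (by ring)⟩

/-- Implicit differentiation of the barycenter equation, in which the coefficient of the unknown
derivative is twice the merged mass. So the barycenter moves with the velocity momentum over mass.
-/
theorem shift_hasDerivAt (ht : C.T < t) : HasDerivAt C.shift (C.mergedVelocity t - C.w) t := by
  obtain ⟨Y', hY⟩ : ∃ Y', HasDerivAt C.shift Y' t :=
    ⟨_, ((C.shift_contDiffAt ht.le).differentiableAt one_ne_zero).hasDerivAt⟩
  have hM := C.mergedMass_pos ht.le
  suffices Y' = C.mergedVelocity t - C.w by rwa [← this]
  obtain ⟨e0, e1⟩ := C.absorbed_hasDerivAt hY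
  have hq : (fun t => C.ρ₁ * C.absorbed₁ t ^ 2 - C.ρ₀ * C.absorbed₀ t ^ 2 + 2 * C.ξ * C.shift t)
      =ᶠ[𝓝 t] fun _ => 0 := by
    filter_upwards [lt_mem_nhds ht] with s hs
    exact absorbedShift_spec C.ρ₀_pos C.ρ₁_pos C.ξ_pos (C.left_pos (le_of_lt hs)).le
      (C.right_pos (le_of_lt hs)).le
  have hd := (((e1.pow 2).const_mul C.ρ₁).sub ((e0.pow 2).const_mul C.ρ₀)).add
    (hY.const_mul (2 * C.ξ))
  have h0 := hd.unique ((hasDerivAt_const t (0 : ℝ)).congr_of_eventuallyEq hq)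
  simp only [Nat.cast_ofNat, Nat.add_one_sub_one, pow_one] at h0
  refine mul_left_cancel₀ hM.ne' ?_
  rw [mul_sub, C.mergedVelocity_mul ht.le]
  unfold mergedMass mergedMomentum
  linear_combination h0 / 2

theorem merged_hasDerivAt (ht : C.T < t) :
    HasDerivAt C.mergedMass (C.ρ₀ * C.u₀ - C.ρ₁ * C.u₁ - (C.ρ₀ - C.ρ₁) * C.mergedVelocity t) t ∧
    HasDerivAt C.mergedMomentum (C.ρ₀ * C.u₀ ^ 2 - C.ρ₁ * C.u₁ ^ 2 -
      (C.ρ₀ * C.u₀ - C.ρ₁ * C.u₁) * C.mergedVelocity t) t := by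
  obtain ⟨e0, e1⟩ := C.absorbed_hasDerivAt (C.shift_hasDerivAt ht)
  constructor
  · exact (((e0.const_mul C.ρ₀).add_const C.ξ).add (e1.const_mul C.ρ₁)).congr_deriv (by ring)
  · exact (((e0.const_mul (C.ρ₀ * C.u₀)).add_const (C.ξ * C.w)).add
      (e1.const_mul (C.ρ₁ * C.u₁))).congr_deriv (by ring)

theorem mergedVelocity_hasDerivAt (ht : C.T < t) : ∃ y', HasDerivAt C.mergedVelocity y' t ∧
    C.mergedMass t * y' = (C.ρ₀ * C.u₀ ^ 2 - C.ρ₁ * C.u₁ ^ 2) -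
      2 * (C.ρ₀ * C.u₀ - C.ρ₁ * C.u₁) * C.mergedVelocity t +
      (C.ρ₀ - C.ρ₁) * C.mergedVelocity t ^ 2 := by
  obtain ⟨h1, h2⟩ := C.merged_hasDerivAt ht
  have hM := (C.mergedMass_pos ht.le).ne'
  refine ⟨_, h2.div h1 hM, ?_⟩
  rw [← C.mergedVelocity_mul ht.le]
  field_simp
  ring

theorem continuousOn_shift : ContinuousOn C.shift (Ici C.T) := fun _ ht =>
  (C.shift_contDiffAt ht).continuousAt.continuousWithinAt

theorem continuousOn_mergedMass : ContinuousOn C.mergedMass (Ici C.T) := by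
  have := C.continuousOn_shift
  unfold mergedMass absorbed₀ absorbed₁
  fun_prop

theorem continuousOn_mergedVelocity : ContinuousOn C.mergedVelocity (Ici C.T) := by
  have := C.continuousOn_shift
  refine ContinuousOn.div ?_ C.continuousOn_mergedMass fun t ht => (C.mergedMass_pos ht).ne'
  unfold mergedMomentum absorbed₀ absorbed₁
  fun_prop

/-- The masses of the two shocks grow at these rates before the collision. -/
noncomputable def growth₀ : ℝ := C.ρ₀ * (C.u₀ - (C.w + C.σ)) + C.r * C.σ

noncomputable def growth₁ : ℝ := C.r * C.σ + C.ρ₁ * ((C.w - C.σ) - C.u₁)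

theorem growth₀_pos : 0 < C.growth₀ := by
  have := C.ρ₀_pos; have := C.r_pos; have := C.σ_pos; have := sub_pos.2 C.lt_u₀
  unfold growth₀; positivity

theorem growth₁_pos : 0 < C.growth₁ := by
  have := C.ρ₁_pos; have := C.r_pos; have := C.σ_pos; have := sub_pos.2 C.u₁_lt
  unfold growth₁; positivity

theorem mergedMass_T : C.mergedMass C.T = C.growth₀ * C.T + C.growth₁ * C.T := by
  rw [mergedMass, absorbed₀, absorbed₁, shift_T, growth₀, growth₁, ξ]; ring

theorem mergedMomentum_T : C.mergedMomentum C.T =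
    C.growth₀ * C.T * (C.w + C.σ) + C.growth₁ * C.T * (C.w - C.σ) := by
  rw [mergedMomentum, absorbed₀, absorbed₁, shift_T, growth₀, growth₁, ξ]
  linear_combination C.T * (C.balance₀ - C.balance₁)

/-- An inelastic collision loses energy: with `V` the common velocity, the difference of the two
sides is the sum of the masses times the squares of `V - (w ± σ)`. -/
theorem mergedEnergy_T_le : C.mergedMass C.T * C.mergedVelocity C.T ^ 2 ≤
    C.growth₀ * C.T * (C.w + C.σ) ^ 2 + C.growth₁ * C.T * (C.w - C.σ) ^ 2 := by
  have h1 := C.mergedVelocity_mul le_rfl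
  have hM := C.mergedMass_T
  have hp := C.mergedMomentum_T
  have h0 := mul_pos C.growth₀_pos C.T_pos
  have h2 := mul_pos C.growth₁_pos C.T_pos
  set V := C.mergedVelocity C.T
  rw [hM, hp] at h1
  rw [hM]
  have h3 := mul_nonneg h0.le (sq_nonneg (V - (C.w + C.σ)))
  have h4 := mul_nonneg h2.le (sq_nonneg (V - (C.w - C.σ)))
  linear_combination h3 + h4 + 2 * V * h1

end ShockCollision


namespace ShockCollision

variable (C : ShockCollision) {t : ℝ}

noncomputable def front (k : Fin 2) (t : ℝ) : ℝ :=
  if t ≤ C.T then (![-(C.σ * C.T), C.σ * C.T] : Fin 2 → ℝ) k +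
    (![C.w + C.σ, C.w - C.σ] : Fin 2 → ℝ) k * t
  else C.w * t + C.shift t

/-- After the collision the whole mass is put on the first front, and the second one accompanies it
with strength zero. -/
noncomputable def strength (k : Fin 2) (t : ℝ) : ℝ :=
  if t ≤ C.T then (![C.growth₀, C.growth₁] : Fin 2 → ℝ) k * t
  else (![C.mergedMass t, 0] : Fin 2 → ℝ) k

/-- The inequality is strict here, unlike for `strength`: at time `T` both fronts carry mass at the
same point and must already share the merged velocity. -/
noncomputable def frontVelocity (k : Fin 2) (t : ℝ) : ℝ :=
  if t < C.T then (![C.w + C.σ, C.w - C.σ] : Fin 2 → ℝ) k else C.mergedVelocity t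

/-- Two delta shocks which meet and merge to one. -/
noncomputable def pattern : WavePattern 2 where
  front := C.front
  strength := C.strength
  stateDensity := ![C.ρ₀, C.r, C.ρ₁]
  stateVelocity := ![C.u₀, C.w, C.u₁]
  interactionTimes := {C.T}

noncomputable def flow : GasFlow := C.pattern.flow C.frontVelocity

theorem front_of_le (ht : t ≤ C.T) (k : Fin 2) : C.front k t =
    (![-(C.σ * C.T), C.σ * C.T] : Fin 2 → ℝ) k + (![C.w + C.σ, C.w - C.σ] : Fin 2 → ℝ) k * t :=
  if_pos ht

theorem front_of_ge (ht : C.T ≤ t) (k : Fin 2) : C.front k t = C.w * t + C.shift t := by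
  rcases ht.eq_or_lt with rfl | h
  · rw [C.front_of_le le_rfl, shift_T]
    fin_cases k <;> simp <;> ring
  · exact if_neg h.not_ge

theorem front_lt_front (ht : t < C.T) : C.front 0 t < C.front 1 t := by
  have := mul_lt_mul_of_pos_left ht C.σ_pos
  simp only [C.front_of_le ht.le, Matrix.cons_val_zero, Matrix.cons_val_one]
  linarith

theorem hasDerivAt_front (ht : t ≠ C.T) (k : Fin 2) :
    HasDerivAt (C.front k) (C.frontVelocity k t) t ∧ ContDiffAt ℝ 1 (C.front k) t := by
  rcases ht.lt_or_gt with h | h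
  · have he : C.front k =ᶠ[𝓝 t] fun t => (![-(C.σ * C.T), C.σ * C.T] : Fin 2 → ℝ) k +
        (![C.w + C.σ, C.w - C.σ] : Fin 2 → ℝ) k * t := by
      filter_upwards [gt_mem_nhds h] with s hs using C.front_of_le (le_of_lt hs) k
    rw [frontVelocity, if_pos h]
    exact ⟨(WavePattern.IsStraightSolution.hasDerivAt _ _ k t).congr_of_eventuallyEq he,
      ContDiffAt.congr_of_eventuallyEq (by fun_prop) he⟩
  · have he : C.front k =ᶠ[𝓝 t] fun t => C.w * t + C.shift t := by
      filter_upwards [lt_mem_nhds h] with s hs using C.front_of_ge (le_of_lt hs) k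
    rw [frontVelocity, if_neg h.not_gt]
    have := C.shift_contDiffAt h.le
    refine ⟨HasDerivAt.congr_of_eventuallyEq ?_ he, ContDiffAt.congr_of_eventuallyEq (by fun_prop) he⟩
    exact (((hasDerivAt_id t).const_mul C.w).add (C.shift_hasDerivAt h)).congr_deriv (by ring)

theorem continuousOn_front (k : Fin 2) : ContinuousOn (C.front k) (Ici 0) := by
  rw [← Icc_union_Ici_eq_Ici C.T_pos.le]
  refine ContinuousOn.union_of_isClosed ?_ ?_ isClosed_Icc isClosed_Ici
  · exact ContinuousOn.congr (by fun_prop) fun t ht => C.front_of_le ht.2 k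
  · have := C.continuousOn_shift
    exact ContinuousOn.congr (by fun_prop) fun t ht => C.front_of_ge ht k

theorem strength_nonneg (k : Fin 2) (ht : 0 ≤ t) : 0 ≤ C.strength k t := by
  have := C.growth₀_pos; have := C.growth₁_pos
  unfold strength
  split_ifs with h
  · fin_cases k <;> simp <;> positivity
  · have := (C.mergedMass_pos (not_le.1 h).le).le
    fin_cases k <;> simp [this]

theorem velocity_front {k : Fin 2} (hk : 0 < C.strength k t) :
    C.flow.velocity t (C.front k t) = C.frontVelocity k t := by
  refine WavePattern.flow_velocity_front (P := C.pattern) (fun i k hi hk he => ?_) hk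
  rcases lt_or_ge t C.T with h | h
  · have hlt := C.front_lt_front h
    change C.front i t = C.front k t at he
    fin_cases i <;> fin_cases k <;> first | rfl | (simp at he; linarith)
  · simp [frontVelocity, h.not_gt]

theorem represents : C.pattern.Represents C.flow where
  ordered t ht := by
    refine Fin.monotone_iff_le_succ.2 fun k => ?_
    rw [Fin.fin_one_eq_zero k]
    rcases lt_or_ge t C.T with h | h
    · exact (C.front_lt_front h).le
    · exact ((C.front_of_ge h 0).trans (C.front_of_ge h 1).symm).le
  continuous := C.continuousOn_front
  smooth k t _ h := (C.hasDerivAt_front (by simpa [pattern] using h) k).2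
  noInteraction s t _ hst h i k := by
    have hT : t < C.T ∨ C.T ≤ s := by
      by_contra! hc
      exact h C.T (by simp [pattern]) ⟨hc.2.le, hc.1⟩
    change C.front i s = C.front k s ↔ C.front i t = C.front k t
    rcases hT with hT | hT
    · have h1 := C.front_lt_front (hst.trans_lt hT)
      have h2 := C.front_lt_front hT
      fin_cases i <;> fin_cases k <;> simp [h1.ne, h2.ne, h1.ne', h2.ne']
    · simp [C.front_of_ge hT, C.front_of_ge (hT.trans hst)]
  strength_nonneg k t ht := C.strength_nonneg k ht
  stateDensity_nonneg := by
    simpa [Fin.forall_fin_succ, pattern] using ⟨C.ρ₀_pos.le, C.r_pos.le, C.ρ₁_pos.le⟩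
  density_eq t _ := rfl
  velocity_state t ht j hj := by
    filter_upwards [ae_restrict_mem (isOpen_frontGap _ j).measurableSet] with x hx
    exact WavePattern.flow_velocity_gap _ hx
  velocity_front k t _ h hk := by
    change _ = deriv (C.front k) t
    rw [((C.hasDerivAt_front (by simpa [pattern] using h) k).1).deriv]
    exact C.velocity_front hk

theorem frontVelocity_mem (k : Fin 2) (t : ℝ) : C.frontVelocity k t ∈ Icc C.u₁ C.u₀ := by
  unfold frontVelocity
  split_ifs with h
  · have := C.lt_u₀; have := C.u₁_lt; have := C.σ_pos
    fin_cases k <;> simp <;> constructor <;> linarith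
  · exact C.mergedVelocity_mem (not_lt.1 h)

theorem overcompressive : C.pattern.Overcompressive := by
  intro t _ h j _ hne i
  have hT : t ≠ C.T := by simpa [pattern] using h
  change (_ → _ ≤ deriv (C.front i) t) ∧ (_ → deriv (C.front i) t ≤ _)
  rw [(C.hasDerivAt_front hT i).1.deriv]
  have hm := C.frontVelocity_mem i t
  have hσ := C.σ_pos
  have hmid : j = 1 → t < C.T := by
    rintro rfl
    by_contra! hc
    obtain ⟨x, hx⟩ := hne
    have h1 := (hx 0).1 (by simp)
    have h2 := (hx 1).2 (by simp)
    change C.front 0 t < x at h1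
    change x < C.front 1 t at h2
    rw [C.front_of_ge hc] at h1 h2
    exact lt_asymm h1 h2
  fin_cases j <;> fin_cases i <;> simp [pattern]
  · exact hm.2
  · rw [frontVelocity, if_pos (hmid rfl)]; simpa using hσ.le
  · rw [frontVelocity, if_pos (hmid rfl)]; simpa using hσ.le
  · exact hm.1

/-- The moments which the two shocks had before the collision. -/
noncomputable def earlyMoment (i : ℕ) (φ : ℝ → ℝ) (t : ℝ) : ℝ :=
  C.ρ₁ * C.u₁ ^ i * (∫ x, φ x) + ∑ k, (C.pattern.jump i k * primitive φ
    ((![-(C.σ * C.T), C.σ * C.T] : Fin 2 → ℝ) k + (![C.w + C.σ, C.w - C.σ] : Fin 2 → ℝ) k * t) +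
    (![C.growth₀, C.growth₁] : Fin 2 → ℝ) k * t * (![C.w + C.σ, C.w - C.σ] : Fin 2 → ℝ) k ^ i * φ
    ((![-(C.σ * C.T), C.σ * C.T] : Fin 2 → ℝ) k + (![C.w + C.σ, C.w - C.σ] : Fin 2 → ℝ) k * t))

/-- The moments are continued formally up to `T`, because `FrontMotion` needs velocities continuous
on the closed interval while those of the flow jump at `T`. -/
theorem early_frontMotion : FrontMotion C.earlyMoment 0 C.T (fun i => C.ρ₁ * C.u₁ ^ i)
    C.pattern.jump
    (fun k t => (![-(C.σ * C.T), C.σ * C.T] : Fin 2 → ℝ) k +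
      (![C.w + C.σ, C.w - C.σ] : Fin 2 → ℝ) k * t)
    (fun k t => (![C.growth₀, C.growth₁] : Fin 2 → ℝ) k * t)
    (fun k _ => (![C.w + C.σ, C.w - C.σ] : Fin 2 → ℝ) k) where
  moment_eq t _ i φ _ := rfl
  continuousOn_front k := by fun_prop
  continuousOn_mass k := by fun_prop
  continuousOn_velocity k := by fun_prop
  front t _ k := WavePattern.IsStraightSolution.hasDerivAt _ _ k t
  mass t _ k := by
    refine ((hasDerivAt_id t).const_mul _).congr_deriv ?_
    fin_cases k <;> simp [WavePattern.jump_eq, pattern, growth₀, growth₁] <;> ring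
  momentum t _ k := by
    refine ⟨0, hasDerivAt_const t _, ?_⟩
    have h0 := C.balance₀
    have h1 := C.balance₁
    fin_cases k <;> simp [WavePattern.jump_eq, pattern]
    · linear_combination -h0
    · linear_combination h1

theorem moment_of_lt (i : ℕ) {φ : ℝ → ℝ} (hφ : IsTestFunction φ) (ht : t ∈ Ico 0 C.T) :
    C.flow.moment i φ t = C.earlyMoment i φ t := by
  rw [C.represents.moment_eq ht.1 hφ.integrable, earlyMoment]
  congr 1
  refine Finset.sum_congr rfl fun k _ => ?_
  change _ * primitive φ (C.front k t) + C.strength k t * C.flow.velocity t (C.front k t) ^ i *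
    φ (C.front k t) = _
  rcases (C.strength_nonneg k ht.1).eq_or_lt with h | h
  · rw [← h, ← C.front_of_le ht.2.le]
    rw [strength, if_pos ht.2.le] at h
    rw [← h]; ring
  · rw [C.velocity_front h, ← C.front_of_le ht.2.le, frontVelocity, if_pos ht.2, strength,
      if_pos ht.2.le]

theorem moment_of_ge (i : ℕ) {φ : ℝ → ℝ} (hφ : IsTestFunction φ) (ht : C.T ≤ t) :
    C.flow.moment i φ t = C.ρ₁ * C.u₁ ^ i * (∫ x, φ x) +
      ((C.ρ₀ * C.u₀ ^ i - C.ρ₁ * C.u₁ ^ i) * primitive φ (C.w * t + C.shift t) +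
        C.mergedMass t * C.mergedVelocity t ^ i * φ (C.w * t + C.shift t)) := by
  have ht0 := C.T_pos.le.trans ht
  rw [C.represents.moment_eq ht0 hφ.integrable]
  have hk : ∀ k, C.pattern.strength k t * C.flow.velocity t (C.pattern.front k t) ^ i =
      C.strength k t * C.mergedVelocity t ^ i := by
    intro k
    change C.strength k t * C.flow.velocity t (C.front k t) ^ i = _
    rcases (C.strength_nonneg k ht0).eq_or_lt with h | h
    · rw [← h]; ring
    · rw [C.velocity_front h, frontVelocity, if_neg ht.not_gt]
  have hs : C.strength 0 t + C.strength 1 t = C.mergedMass t := by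
    rcases ht.eq_or_lt with rfl | h
    · simp [strength, mergedMass_T]
    · simp [strength, h.not_ge]
  simp only [hk]
  rw [Fin.sum_univ_two, ← hs]
  change _ + ((_ * primitive φ (C.front 0 t) + _ * φ (C.front 0 t)) +
    (_ * primitive φ (C.front 1 t) + _ * φ (C.front 1 t))) = _
  rw [C.front_of_ge ht, C.front_of_ge ht]
  simp [WavePattern.jump_eq, pattern, Fin.last]
  ring

theorem late_frontMotion (b : ℝ) : FrontMotion (M := 1) C.flow.moment C.T b
    (fun i => C.ρ₁ * C.u₁ ^ i) (fun i _ => C.ρ₀ * C.u₀ ^ i - C.ρ₁ * C.u₁ ^ i)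
    (fun _ t => C.w * t + C.shift t) (fun _ => C.mergedMass) (fun _ => C.mergedVelocity) where
  moment_eq t ht i φ hφ := by rw [C.moment_of_ge i hφ ht.1, Fin.sum_univ_one]
  continuousOn_front k := by
    have := C.continuousOn_shift.mono (Icc_subset_Ici_self : Icc C.T b ⊆ _)
    fun_prop
  continuousOn_mass k := C.continuousOn_mergedMass.mono Icc_subset_Ici_self
  continuousOn_velocity k := C.continuousOn_mergedVelocity.mono Icc_subset_Ici_self
  front t ht _ := (((hasDerivAt_id t).const_mul C.w).add
    (C.shift_hasDerivAt ht.1)).congr_deriv (by ring)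
  mass t ht _ := (C.merged_hasDerivAt ht.1).1.congr_deriv (by ring)
  momentum t ht _ := by
    obtain ⟨y', h1, h2⟩ := C.mergedVelocity_hasDerivAt ht.1
    exact ⟨y', h1, by linear_combination h2⟩

theorem earlyMoment_T (i : ℕ) (φ : ℝ → ℝ) : C.earlyMoment i φ C.T =
    C.ρ₁ * C.u₁ ^ i * (∫ x, φ x) +
      ((C.ρ₀ * C.u₀ ^ i - C.ρ₁ * C.u₁ ^ i) * primitive φ (C.w * C.T) +
        (C.growth₀ * C.T * (C.w + C.σ) ^ i + C.growth₁ * C.T * (C.w - C.σ) ^ i) *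
          φ (C.w * C.T)) := by
  have h0 : -(C.σ * C.T) + (C.w + C.σ) * C.T = C.w * C.T := by ring
  have h1 : C.σ * C.T + (C.w - C.σ) * C.T = C.w * C.T := by ring
  rw [earlyMoment, Fin.sum_univ_two]
  simp [WavePattern.jump_eq, pattern, h0, h1]
  ring

theorem isAdmissibleSolution {R : Measure ℝ} {v₀ : ℝ → ℝ} (hR : C.flow.density 0 = R)
    (hv : C.flow.velocity 0 =ᵐ[R] v₀) : IsAdmissibleSolution C.flow R v₀ := by
  have hT := C.T_pos.le
  have hl := fun b => C.late_frontMotion b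
  have he := C.early_frontMotion
  refine ⟨C.represents.isWeakSolution ⟨|C.u₁| + |C.u₀|, fun t ht k hk => ?_⟩ hR hv
    (fun φ hφ s t hs hst => ?_) (fun φ hφ s t hs hst => ?_), fun φ hφ hφ0 s t hs hst => ?_,
    2, _, C.represents, C.overcompressive⟩
  · rw [show C.flow.velocity t (C.pattern.front k t) = _ from C.velocity_front hk]
    obtain ⟨h1, h2⟩ := C.frontVelocity_mem k t
    rw [abs_le]
    constructor <;> linarith [neg_abs_le C.u₁, le_abs_self C.u₀, abs_nonneg C.u₁, abs_nonneg C.u₀]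
  · refine law_eq_of_law_of_law hT (F := C.earlyMoment 0 φ) (G := C.earlyMoment 1 (deriv φ))
      (fun t ht => C.moment_of_lt 0 hφ ht) ?_ (fun t ht => C.moment_of_lt 1 hφ.deriv ht)
      (fun s t hs ht hst => he.mass_law hφ hs ht hst)
      (fun s t hs hst => (hl t).mass_law hφ ⟨hs, hst⟩ ⟨hs.trans hst, le_rfl⟩ hst) hs hst
    rw [C.moment_of_ge 0 hφ le_rfl, C.earlyMoment_T, shift_T, mergedMass_T, add_zero]
    ring
  · refine law_eq_of_law_of_law hT (F := C.earlyMoment 1 φ) (G := C.earlyMoment 2 (deriv φ))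
      (fun t ht => C.moment_of_lt 1 hφ ht) ?_ (fun t ht => C.moment_of_lt 2 hφ.deriv ht)
      (fun s t hs ht hst => he.momentum_law hφ hs ht hst)
      (fun s t hs hst => (hl t).momentum_law hφ ⟨hs, hst⟩ ⟨hs.trans hst, le_rfl⟩ hst) hs hst
    rw [C.moment_of_ge 1 hφ le_rfl, C.earlyMoment_T, shift_T, pow_one (C.mergedVelocity C.T),
      C.mergedVelocity_mul le_rfl, mergedMomentum_T, add_zero]
    ring
  -- At `T` the energy of the flow is only bounded by that of the continued shocks; this is where
  -- the energy lost in the merging enters, with the right sign.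
  · have key := law_of_law_of_law hT (f := fun t => 1 / 2 * C.flow.moment 2 φ t)
      (F := fun t => 1 / 2 * C.earlyMoment 2 φ t)
      (g := fun t => 1 / 2 * C.flow.moment 3 (deriv φ) t)
      (G := fun t => 1 / 2 * C.earlyMoment 3 (deriv φ) t)
      (fun t ht => by rw [C.moment_of_lt 2 hφ ht]) ?_
      (fun t ht => by rw [C.moment_of_lt 3 hφ.deriv ht]) (fun s t hs ht hst => ?_)
      (fun s t hs hst => ?_) hs hst
    · exact ⟨by simpa [← mul_assoc] using key.1.const_mul 2, key.2⟩
    · have h1 := mul_le_mul_of_nonneg_right C.mergedEnergy_T_le (hφ0 (C.w * C.T))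
      rw [C.moment_of_ge 2 hφ le_rfl, C.earlyMoment_T, shift_T, add_zero]
      linarith
    · have := he.energy_law (fun t _ k => ?_) hφ hφ0 hs ht hst
      · exact ⟨this.1.const_mul _, this.2⟩
      · have h1 := C.lt_u₀; have h2 := C.u₁_lt; have h3 := C.σ_pos
        have h4 := C.ρ₀_pos.le; have h5 := C.r_pos.le; have h6 := C.ρ₁_pos.le
        fin_cases k
        · exact WavePattern.dissipation_nonneg h4 h5 (fun _ => h1.le) fun _ => by
            change C.w ≤ C.w + C.σ; linarith
        · exact WavePattern.dissipation_nonneg h5 h6 (fun _ => by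
            change C.w - C.σ ≤ C.w; linarith) fun _ => h2.le
    · have := (hl t).energy_law (fun τ hτ k => WavePattern.dissipation_nonneg C.ρ₀_pos.le C.ρ₁_pos.le
        (fun _ => (C.mergedVelocity_mem hτ.1).2) fun _ => (C.mergedVelocity_mem hτ.1).1) hφ hφ0
        ⟨hs, hst⟩ ⟨hs.trans hst, le_rfl⟩ hst
      exact ⟨this.1.const_mul _, this.2⟩

end ShockCollision


/-! ### The case `u₁ < u₀`: least dissipation -/

/-- The cube of the positive part lies strictly above its tangent at `a > 0`, except at `a`; for `x
≥ 0` the difference is `(x - a)² (x + 2 a)`. -/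
theorem max_zero_cube_gt {x a : ℝ} (ha : 0 < a) (h : x ≠ a) :
    a ^ 3 + 3 * a ^ 2 * (x - a) < max x 0 ^ 3 := by
  rcases le_total 0 x with hx | hx
  · rw [max_eq_left hx]
    have := sub_ne_zero.2 h
    have : 0 < (x - a) ^ 2 * (x + 2 * a) := by positivity
    linarith
  · rw [max_eq_right hx]
    have : 0 < a ^ 3 := by positivity
    have : a ^ 2 * x ≤ 0 := mul_nonpos_of_nonneg_of_nonpos (sq_nonneg a) hx
    linarith

/-- Up to the factor `3`, the left side is the slope of a dissipation with coefficient `K` at the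
relative velocity `a`. It depends only on the speed `σ` of the shock relative to the middle state,
so the slopes of the two dissipations balance when the shocks have the speeds `w ± σ`. -/
theorem coefficient_mul_sq {ρ r a σ : ℝ} (hρ : 0 < ρ) (hr : 0 < r) (hσ : 0 < σ) (ha : σ < a)
    (h : ρ * (a - σ) ^ 2 = r * σ ^ 2) : ρ * r / (√ρ + √r) ^ 2 * a ^ 2 = r * σ ^ 2 := by
  have h1 : √ρ * (a - σ) = √r * σ := by
    have h2 := sub_pos.2 ha
    rw [← Real.sqrt_sq h2.le, ← Real.sqrt_mul hρ.le, h, Real.sqrt_mul hr.le, Real.sqrt_sq hσ.le]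
  have h3 : √ρ * a = σ * (√ρ + √r) := by linarith
  have h4 : ρ * a ^ 2 = (σ * (√ρ + √r)) ^ 2 := by
    rw [← h3, mul_pow, Real.sq_sqrt hρ.le]
  have : 0 < √ρ + √r := by positivity
  field_simp
  linear_combination h4

namespace DeltaRiemannData

variable {D : DeltaRiemannData} {L μ : ℝ}

/-- The middle velocity for which the shocks at `-μ/2` and `μ/2` dissipate the least energy, as a
function of `x = √μ`. -/
noncomputable def leastVelocity (D : DeltaRiemannData) (x : ℝ) : ℝ :=
  (√D.ρ₀ * (√D.ρ₁ * x + √D.ξ) * D.u₀ + √D.ρ₁ * (√D.ρ₀ * x + √D.ξ) * D.u₁) /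
    (√D.ρ₀ * (√D.ρ₁ * x + √D.ξ) + √D.ρ₁ * (√D.ρ₀ * x + √D.ξ))

/-- The values of `w` and `σ` solve `√ρ₀ (u₀ - w - σ) = √(ξ/μ) σ = √ρ₁ (w - σ - u₁)`, and `T` is
chosen so that `σ T = μ/2`. -/
noncomputable def collision (h₀ : 0 < D.ρ₀) (h₁ : 0 < D.ρ₁) (hξ : 0 < D.ξ) (h : D.u₁ < D.u₀)
    (hμ : 0 < μ) : ShockCollision where
  ρ₀ := D.ρ₀
  ρ₁ := D.ρ₁
  r := D.ξ / μ
  u₀ := D.u₀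
  u₁ := D.u₁
  w := D.leastVelocity √μ
  σ := √μ * √D.ρ₀ * √D.ρ₁ * (D.u₀ - D.u₁) /
    (√D.ρ₀ * (√D.ρ₁ * √μ + √D.ξ) + √D.ρ₁ * (√D.ρ₀ * √μ + √D.ξ))
  T := √μ * ((√D.ρ₀ * (√D.ρ₁ * √μ + √D.ξ) + √D.ρ₁ * (√D.ρ₀ * √μ + √D.ξ)) /
    (2 * √D.ρ₀ * √D.ρ₁ * (D.u₀ - D.u₁)))
  ρ₀_pos := h₀
  ρ₁_pos := h₁
  r_pos := by positivity
  σ_pos := by have := sub_pos.2 h; positivity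
  T_pos := by have := sub_pos.2 h; positivity
  lt_u₀ := by
    have := sub_pos.2 h
    rw [leastVelocity, ← add_div, div_lt_iff₀ (by positivity), ← sub_pos]
    have : 0 < √D.ρ₁ * √D.ξ * (D.u₀ - D.u₁) := by positivity
    linarith
  u₁_lt := by
    have := sub_pos.2 h
    rw [leastVelocity, ← sub_div, lt_div_iff₀ (by positivity), ← sub_pos]
    have : 0 < √D.ρ₀ * √D.ξ * (D.u₀ - D.u₁) := by positivity
    linarith
  balance₀ := by
    have e0 := Real.sq_sqrt h₀.le
    have e1 := Real.sq_sqrt hξ.le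
    have e2 := Real.sq_sqrt hμ.le
    have hp : 0 < √μ := by positivity
    rw [leastVelocity]
    set a := √D.ρ₀
    set b := √D.ρ₁
    set c := √D.ξ
    set x := √μ
    rw [← e0, ← e1, ← e2]
    have : 0 < a * (b * x + c) + b * (a * x + c) := by positivity
    field_simp
    ring
  balance₁ := by
    have e0 := Real.sq_sqrt h₁.le
    have e1 := Real.sq_sqrt hξ.le
    have e2 := Real.sq_sqrt hμ.le
    have hp : 0 < √μ := by positivity
    rw [leastVelocity]
    set a := √D.ρ₀
    set b := √D.ρ₁
    set c := √D.ξ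
    set x := √μ
    rw [← e0, ← e1, ← e2]
    have : 0 < a * (b * x + c) + b * (a * x + c) := by positivity
    field_simp
    ring

section Collision

variable (h₀ : 0 < D.ρ₀) (h₁ : 0 < D.ρ₁) (hξ : 0 < D.ξ) (h : D.u₁ < D.u₀) (hμ : 0 < μ)

theorem collision_σ_mul_T :
    (collision h₀ h₁ hξ h hμ).σ * (collision h₀ h₁ hξ h hμ).T = μ / 2 := by
  have := sub_pos.2 h
  simp only [collision]
  field_simp
  exact Real.sq_sqrt hμ.le

theorem collision_ξ : (collision h₀ h₁ hξ h hμ).ξ = D.ξ := by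
  rw [ShockCollision.ξ, mul_assoc, mul_assoc, mul_comm (collision h₀ h₁ hξ h hμ).T, ← mul_assoc 2,
    ← mul_assoc, mul_right_comm, mul_assoc 2, collision_σ_mul_T]
  simp only [collision]
  field_simp

theorem collision_admissible : IsAdmissibleSolution (collision h₀ h₁ hξ h hμ).flow
    (D.approxDensity μ) (D.approxVelocity μ (D.leastVelocity √μ)) := by
  set C := collision h₀ h₁ hξ h hμ with hC
  have hσT := collision_σ_mul_T h₀ h₁ hξ h hμ
  have hT := C.T_pos
  have f0 : C.front 0 0 = -(μ / 2) := by rw [C.front_of_le hT.le]; simp [hσT, hC]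
  have f1 : C.front 1 0 = μ / 2 := by rw [C.front_of_le hT.le]; simp [hσT, hC]
  have g0 : C.pattern.gap 0 0 = Iio (-(μ / 2)) := by
    ext x
    simp only [WavePattern.gap, ShockCollision.pattern, Fin.forall_fin_two, f0, f1]
    simp; intros; linarith
  have g1 : C.pattern.gap 1 0 = Ioo (-(μ / 2)) (μ / 2) := by
    ext x
    simp [WavePattern.gap, ShockCollision.pattern, Fin.forall_fin_two, f0, f1]
  have g2 : C.pattern.gap 2 0 = Ioi (μ / 2) := by
    ext x
    simp only [WavePattern.gap, ShockCollision.pattern, Fin.forall_fin_two, f0, f1]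
    simp; intros; linarith
  have hv : ∀ j x, x ∈ C.pattern.gap j 0 → C.flow.velocity 0 x = C.pattern.stateVelocity j :=
    fun j x hx => WavePattern.flow_velocity_gap _ hx
  have hs : ∀ k, C.strength k 0 = 0 := fun k => by rw [ShockCollision.strength, if_pos hT.le, mul_zero]
  refine C.isAdmissibleSolution ?_ (approxVelocity_ae hμ
    (fun x hx => hv 0 x (by rwa [g0])) (fun x hx => hv 1 x (by rwa [g1]))
    (fun x hx => hv 2 x (by rwa [g2])))
  change ∑ j, ENNReal.ofReal (C.pattern.stateDensity j) • volume.restrict (C.pattern.gap j 0) +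
    ∑ k, ENNReal.ofReal (C.strength k 0) • Measure.dirac _ = _
  rw [Fin.sum_univ_three, g0, g1, g2]
  simp only [hs]
  simp [ShockCollision.pattern, approxDensity, hC, collision]

/-- Both dissipations are bounded from below by their tangents at the least velocity. By
`coefficient_mul_sq` the two slopes in `w'` are opposite, so the linear terms cancel in the sum. -/
theorem energyRate_lt (h₀ : 0 < D.ρ₀) (h₁ : 0 < D.ρ₁) (hξ : 0 < D.ξ) (h : D.u₁ < D.u₀)
    (hμ : 0 < μ) (w' : ℝ) (hw' : w' ≠ D.leastVelocity √μ) :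
    D.energyRate μ w' < D.energyRate μ (D.leastVelocity √μ) := by
  set C := collision h₀ h₁ hξ h hμ with hC
  set w := D.leastVelocity √μ
  have hr : 0 < D.ξ / μ := C.r_pos
  have hlt₀ : w + C.σ < D.u₀ := C.lt_u₀
  have hlt₁ : D.u₁ < w - C.σ := C.u₁_lt
  have hσ := C.σ_pos
  have c0 := coefficient_mul_sq (a := D.u₀ - w) h₀ hr hσ (by linarith)
    (by rw [← show D.ρ₀ * (D.u₀ - (w + C.σ)) ^ 2 = D.ξ / μ * C.σ ^ 2 from C.balance₀]; ring)
  have c1 := coefficient_mul_sq (a := w - D.u₁) h₁ hr hσ (by linarith)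
    (by rw [← show D.ρ₁ * ((w - C.σ) - D.u₁) ^ 2 = D.ξ / μ * C.σ ^ 2 from C.balance₁]; ring)
  have m0 := max_zero_cube_gt (x := D.u₀ - w') (a := D.u₀ - w) (by linarith)
    (fun e => hw' (by linarith))
  have m1 := max_zero_cube_gt (x := w' - D.u₁) (a := w - D.u₁) (by linarith)
    (fun e => hw' (by linarith))
  have p0 : 0 < D.ρ₀ * (D.ξ / μ) / (√D.ρ₀ + √(D.ξ / μ)) ^ 2 := by positivity
  have p1 : 0 < D.ρ₁ * (D.ξ / μ) / (√D.ρ₁ + √(D.ξ / μ)) ^ 2 := by positivity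
  have k0 := mul_lt_mul_of_pos_left m0 p0
  have k1 := mul_lt_mul_of_pos_left m1 p1
  unfold energyRate dissipation
  rw [mul_comm (D.ξ / μ) D.ρ₁, add_comm √(D.ξ / μ) √D.ρ₁, max_eq_left (show 0 ≤ D.u₀ - w by linarith),
    max_eq_left (show 0 ≤ w - D.u₁ by linarith)]
  set K := D.ρ₀ * (D.ξ / μ) / (√D.ρ₀ + √(D.ξ / μ)) ^ 2
  set K' := D.ρ₁ * (D.ξ / μ) / (√D.ρ₁ + √(D.ξ / μ)) ^ 2
  have e0 : K * ((D.u₀ - w) ^ 3 + 3 * (D.u₀ - w) ^ 2 * (D.u₀ - w' - (D.u₀ - w))) =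
      K * (D.u₀ - w) ^ 3 + 3 * (D.ξ / μ * C.σ ^ 2) * (w - w') := by
    rw [← c0]; ring
  have e1 : K' * ((w - D.u₁) ^ 3 + 3 * (w - D.u₁) ^ 2 * (w' - D.u₁ - (w - D.u₁))) =
      K' * (w - D.u₁) ^ 3 + 3 * (D.ξ / μ * C.σ ^ 2) * (w' - w) := by
    rw [← c1]; ring
  linarith

end Collision

end DeltaRiemannData


/-! ### The limit of the colliding shocks -/

namespace DeltaRiemannData

variable {D : DeltaRiemannData} {L : ℝ}

theorem tendsto_sqrt_zero : Tendsto Real.sqrt (𝓝[>] 0) (𝓝 0) :=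
  (Real.continuous_sqrt.tendsto' 0 0 Real.sqrt_zero).mono_left nhdsWithin_le_nhds

theorem tendsto_leastVelocity (h₀ : 0 < D.ρ₀) (h₁ : 0 < D.ρ₁) (hξ : 0 < D.ξ) :
    Tendsto (fun μ => D.leastVelocity √μ) (𝓝[>] 0) (𝓝 D.shockSpeed) := by
  have hc : ContinuousAt D.leastVelocity 0 := by
    unfold leastVelocity
    refine ContinuousAt.div (by fun_prop) (by fun_prop) ?_
    have : 0 < √D.ρ₀ * (√D.ρ₁ * 0 + √D.ξ) + √D.ρ₁ * (√D.ρ₀ * 0 + √D.ξ) := by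
      simp only [mul_zero, zero_add]; positivity
    exact this.ne'
  have h0 : D.leastVelocity 0 = D.shockSpeed := by
    rw [leastVelocity, shockSpeed]
    simp only [mul_zero, zero_add]
    have : 0 < √D.ρ₀ + √D.ρ₁ := by positivity
    have : 0 < √D.ρ₀ * √D.ξ + √D.ρ₁ * √D.ξ := by positivity
    have : 0 < √D.ξ := by positivity
    field_simp
  rw [← h0]
  exact hc.tendsto.comp tendsto_sqrt_zero

theorem deltaShock_moment (h₀ : 0 < D.ρ₀) (h₁ : 0 < D.ρ₁) (hξ : 0 < D.ξ) (h : D.u₁ < D.u₀) (i : ℕ)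
    {φ : ℝ → ℝ} (hφ : IsTestFunction φ) {t : ℝ} (ht : 0 ≤ t) :
    D.deltaShock.moment i φ t = D.ρ₁ * D.u₁ ^ i * (∫ x, φ x) +
      ((D.ρ₀ * D.u₀ ^ i - D.ρ₁ * D.u₁ ^ i) * primitive φ (D.shockSpeed * t) +
        (D.ξ + √(D.ρ₀ * D.ρ₁) * (D.u₀ - D.u₁) * t) * D.shockSpeed ^ i *
          φ (D.shockSpeed * t)) := by
  rw [(deltaShock_represents h₀ h₁ hξ h).moment_eq ht hφ.integrable, Fin.sum_univ_one,
    WavePattern.jump_eq]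
  simp [WavePattern.straight, deltaShock]

open Classical in
/-- The solutions of the approximate problems with the middle velocities of least dissipation. -/
noncomputable def shockFlow (h₀ : 0 < D.ρ₀) (h₁ : 0 < D.ρ₁) (hξ : 0 < D.ξ) (h : D.u₁ < D.u₀)
    (μ : ℝ) : GasFlow :=
  if hμ : 0 < μ then (collision h₀ h₁ hξ h hμ).flow else D.deltaShock

section Convergence

variable (h₀ : 0 < D.ρ₀) (h₁ : 0 < D.ρ₁) (hξ : 0 < D.ξ) (h : D.u₁ < D.u₀)

/-- Time `0` precedes the collision for every `μ`, so here the moments before the collision are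
needed, and the mass at the origin arises from the middle state. -/
theorem tendsto_shockFlow_moment_zero (i : ℕ) {φ : ℝ → ℝ} (hφ : IsTestFunction φ) :
    Tendsto (fun μ => (shockFlow h₀ h₁ hξ h μ).moment i φ 0) (𝓝[>] 0)
      (𝓝 (D.deltaShock.moment i φ 0)) := by
  have hw := tendsto_leastVelocity h₀ h₁ hξ
  have hF := (hasDerivAt_primitive hφ 0).continuousAt
  have e1 : Tendsto (fun μ : ℝ => primitive φ (0 - μ / 2)) (𝓝[>] 0) (𝓝 (primitive φ 0)) := by
    refine hF.tendsto.comp (Tendsto.mono_left ?_ nhdsWithin_le_nhds)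
    exact (by fun_prop : Continuous fun μ : ℝ => 0 - μ / 2).tendsto' _ _ (by simp)
  have e2 : Tendsto (fun μ : ℝ => primitive φ (0 + μ / 2)) (𝓝[>] 0) (𝓝 (primitive φ 0)) := by
    refine hF.tendsto.comp (Tendsto.mono_left ?_ nhdsWithin_le_nhds)
    exact (by fun_prop : Continuous fun μ : ℝ => 0 + μ / 2).tendsto' _ _ (by simp)
  have e3 := tendsto_symmetric_difference (hasDerivAt_primitive hφ 0) D.ξ
  have e4 := (((e1.const_mul (D.ρ₀ * D.u₀ ^ i)).sub (e2.const_mul (D.ρ₁ * D.u₁ ^ i))).add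
    ((hw.pow i).mul e3)).const_add (D.ρ₁ * D.u₁ ^ i * ∫ x, φ x)
  rw [deltaShock_moment h₀ h₁ hξ h i hφ le_rfl, mul_zero]
  refine (e4.congr' ?_).trans_eq (by congr 1; ring)
  filter_upwards [self_mem_nhdsWithin] with μ hμ
  have hμ' : 0 < μ := hμ
  have hT := (collision h₀ h₁ hξ h hμ').T_pos
  have hσT := collision_σ_mul_T h₀ h₁ hξ h hμ'
  rw [shockFlow, dif_pos hμ', ShockCollision.moment_of_lt _ i hφ ⟨le_rfl, hT⟩,
    ShockCollision.earlyMoment, Fin.sum_univ_two, WavePattern.jump_eq, WavePattern.jump_eq]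
  simp only [Matrix.cons_val_zero, Matrix.cons_val_one, hσT, mul_zero, zero_mul, add_zero, zero_sub,
    zero_add]
  simp [ShockCollision.pattern, collision]
  ring

/-- A fixed `t > 0` is later than the collision for all small `μ`. For `i = 0, 1` the factor mass
times a power of the velocity is the merged mass or momentum, so no limit of a quotient is needed.
-/
theorem tendsto_shockFlow_moment {i : ℕ} (hi : i = 0 ∨ i = 1) {φ : ℝ → ℝ} (hφ : IsTestFunction φ)
    {t : ℝ} (ht : 0 < t) :
    Tendsto (fun μ => (shockFlow h₀ h₁ hξ h μ).moment i φ t) (𝓝[>] 0)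
      (𝓝 (D.deltaShock.moment i φ t)) := by
  have hw := tendsto_leastVelocity h₀ h₁ hξ
  set y := D.shockSpeed with hy
  have hy₀ : y < D.u₀ := deltaShockSpeed_lt h₀ h₁ h
  have hy₁ : D.u₁ < y := lt_deltaShockSpeed h₀ h
  have hbal : D.ρ₀ * (D.u₀ - y) ^ 2 = D.ρ₁ * (y - D.u₁) ^ 2 := deltaShockSpeed_balance h₀ h₁
  have hmass : D.ρ₀ * (D.u₀ - y) + D.ρ₁ * (y - D.u₁) = √(D.ρ₀ * D.ρ₁) * (D.u₀ - D.u₁) :=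
    deltaShockSpeed_mass h₀ h₁
  have hμ2 : Tendsto (fun μ : ℝ => μ / 2) (𝓝[>] 0) (𝓝 0) :=
    ((by fun_prop : Continuous fun μ : ℝ => μ / 2).tendsto' 0 0 (by simp)).mono_left
      nhdsWithin_le_nhds
  have hl₀ : Tendsto (fun μ => (D.u₀ - D.leastVelocity √μ) * t - μ / 2) (𝓝[>] 0)
      (𝓝 ((D.u₀ - y) * t)) := by
    simpa using ((hw.const_sub D.u₀).mul_const t).sub hμ2
  have hl₁ : Tendsto (fun μ => (D.leastVelocity √μ - D.u₁) * t - μ / 2) (𝓝[>] 0)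
      (𝓝 ((y - D.u₁) * t)) := by
    simpa using ((hw.sub_const D.u₁).mul_const t).sub hμ2
  let Y : ℝ → ℝ := fun μ => absorbedShift D.ρ₀ D.ρ₁ D.ξ
    ((D.u₀ - D.leastVelocity √μ) * t - μ / 2) ((D.leastVelocity √μ - D.u₁) * t - μ / 2)
  -- The closed form is continuous in `(l₀, l₁)`, and at the limit point the momentum fluxes into
  -- the delta shock balance, so the shift is zero there.
  have hY : Tendsto Y (𝓝[>] 0) (𝓝 0) := by
    have h2 := (absorbedShift_contDiffAt h₀ h₁ hξ (mul_nonneg (sub_nonneg.2 hy₀.le) ht.le)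
      (mul_nonneg (sub_nonneg.2 hy₁.le) ht.le) (E := ℝ × ℝ) (f := Prod.fst) (g := Prod.snd)
      (x := ((D.u₀ - y) * t, (y - D.u₁) * t)) (by fun_prop) (by fun_prop) rfl rfl).continuousAt
    have h3 : absorbedShift D.ρ₀ D.ρ₁ D.ξ ((D.u₀ - y) * t) ((y - D.u₁) * t) = 0 :=
      absorbedShift_eq_zero (by linear_combination -t ^ 2 * hbal)
    have h4 := h2.tendsto.comp (hl₀.prodMk_nhds hl₁)
    simp only [h3] at h4
    exact h4
  have hc : Tendsto (fun μ => D.leastVelocity √μ * t + Y μ) (𝓝[>] 0) (𝓝 (y * t)) := by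
    simpa using (hw.mul_const t).add hY
  have hA := hl₀.sub hY
  have hB := hl₁.add hY
  have hM := ((hA.const_mul D.ρ₀).add_const D.ξ).add (hB.const_mul D.ρ₁)
  have hp := ((hA.const_mul (D.ρ₀ * D.u₀)).add (hw.const_mul D.ξ)).add
    (hB.const_mul (D.ρ₁ * D.u₁))
  have hF := (hasDerivAt_primitive hφ (y * t)).continuousAt.tendsto.comp hc
  have hφc := hφ.1.continuous.continuousAt.tendsto.comp hc
  have hT : ∀ᶠ μ in 𝓝[>] (0 : ℝ), √μ * ((√D.ρ₀ * (√D.ρ₁ * √μ + √D.ξ) + √D.ρ₁ * (√D.ρ₀ * √μ + √D.ξ)) /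
      (2 * √D.ρ₀ * √D.ρ₁ * (D.u₀ - D.u₁))) < t := by
    have hc : Continuous fun x : ℝ => x * ((√D.ρ₀ * (√D.ρ₁ * x + √D.ξ) + √D.ρ₁ * (√D.ρ₀ * x + √D.ξ)) /
      (2 * √D.ρ₀ * √D.ρ₁ * (D.u₀ - D.u₁))) := by fun_prop
    have := (hc.tendsto' 0 0 (by simp)).comp tendsto_sqrt_zero
    exact this.eventually_lt_const ht
  have key : ∀ᶠ μ in 𝓝[>] (0 : ℝ), (shockFlow h₀ h₁ hξ h μ).moment i φ t =
      D.ρ₁ * D.u₁ ^ i * (∫ x, φ x) + ((D.ρ₀ * D.u₀ ^ i - D.ρ₁ * D.u₁ ^ i) *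
        primitive φ (D.leastVelocity √μ * t + Y μ) +
        (if i = 0 then D.ρ₀ * ((D.u₀ - D.leastVelocity √μ) * t - μ / 2 - Y μ) + D.ξ +
          D.ρ₁ * ((D.leastVelocity √μ - D.u₁) * t - μ / 2 + Y μ)
        else D.ρ₀ * D.u₀ * ((D.u₀ - D.leastVelocity √μ) * t - μ / 2 - Y μ) +
          D.ξ * D.leastVelocity √μ +
          D.ρ₁ * D.u₁ * ((D.leastVelocity √μ - D.u₁) * t - μ / 2 + Y μ)) *
        φ (D.leastVelocity √μ * t + Y μ)) := by
    filter_upwards [hT, self_mem_nhdsWithin] with μ hTt hμ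
    have hμ' : 0 < μ := hμ
    have hTt' : (collision h₀ h₁ hξ h hμ').T ≤ t := le_of_lt hTt
    have hσT := collision_σ_mul_T h₀ h₁ hξ h hμ'
    have hξ' := collision_ξ h₀ h₁ hξ h hμ'
    have hshift : (collision h₀ h₁ hξ h hμ').shift t = Y μ := by
      rw [ShockCollision.shift, hσT, hξ']; rfl
    rw [shockFlow, dif_pos hμ', ShockCollision.moment_of_ge _ i hφ hTt', hshift]
    congr 2
    congr 1
    rcases hi with rfl | rfl
    · rw [if_pos rfl, pow_zero, mul_one, ShockCollision.mergedMass, ShockCollision.absorbed₀,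
        ShockCollision.absorbed₁, hσT, hξ', hshift]
      rfl
    · rw [if_neg one_ne_zero, pow_one, ShockCollision.mergedVelocity_mul _ hTt',
        ShockCollision.mergedMomentum, ShockCollision.absorbed₀,
        ShockCollision.absorbed₁, hσT, hξ', hshift]
      rfl
  refine Tendsto.congr' (key.mono fun μ h => h.symm) ?_
  rw [deltaShock_moment h₀ h₁ hξ h i hφ ht.le, ← hmass, ← hy]
  refine ((hF.const_mul _).add (Tendsto.mul ?_ hφc)).const_add _
  rcases hi with rfl | rfl
  · simp only [if_true]
    exact hM.trans_eq (by congr 1; ring)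
  · simp only [one_ne_zero, if_false]
    refine hp.trans_eq ?_
    congr 1
    linear_combination t * hbal

theorem satisfiesBackwardEnergyCondition_iff_deltaShock (h₀ : 0 < D.ρ₀) (h₁ : 0 < D.ρ₁)
    (hξ : 0 < D.ξ) (h : D.u₁ < D.u₀) (hL : 0 < L) (U : GasFlow) :
    D.SatisfiesBackwardEnergyCondition L U ↔ U.Equiv D.deltaShock := by
  refine satisfiesBackwardEnergyCondition_iff (w := fun μ => D.leastVelocity √μ)
    (V := shockFlow h₀ h₁ hξ h) (deltaShock_admissible h₀ h₁ hξ h)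
    (fun U => equiv_deltaShock h₀ h₁ hξ h) ?_ (fun t ht φ hφ => ?_) U
  · filter_upwards [D.eventually_small hξ hL] with μ ⟨hμ, hμL, hμ₀, hμ₁⟩
    have hV := collision_admissible h₀ h₁ hξ h hμ
    rw [shockFlow, dif_pos hμ]
    refine ⟨hV, fun w' U' => isSelected_iff h₀ h₁ hμ hμL hμ₀ hμ₁ hV (fun w' => ?_)
      fun w' he hne => absurd he (energyRate_lt h₀ h₁ hξ h hμ w' hne).ne⟩
    by_cases hne : w' = D.leastVelocity √μ
    · rw [hne]
    · exact (energyRate_lt h₀ h₁ hξ h hμ w' hne).le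
  · rcases ht.eq_or_lt with rfl | ht
    · exact ⟨tendsto_shockFlow_moment_zero h₀ h₁ hξ h 0 hφ,
        tendsto_shockFlow_moment_zero h₀ h₁ hξ h 1 hφ⟩
    · exact ⟨tendsto_shockFlow_moment h₀ h₁ hξ h (Or.inl rfl) hφ ht,
        tendsto_shockFlow_moment h₀ h₁ hξ h (Or.inr rfl) hφ ht⟩

end Convergence

end DeltaRiemannData


/-! ### The theorem -/

theorem mainTheorem2 (D : DeltaRiemannData) (h₀ : 0 < D.ρ₀) (h₁ : 0 < D.ρ₁) (hξ : 0 < D.ξ)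
    (L : ℝ) (hL : 0 < L) :
    (D.u₁ < D.u₀ →
      ∀ U : GasFlow, D.SatisfiesBackwardEnergyCondition L U ↔ U.Equiv D.deltaShock) ∧
    (D.u₀ ≤ D.u₁ →
      (∀ U : GasFlow, D.SatisfiesBackwardEnergyCondition L U ↔ U.Equiv D.deltaContact) ∧
      D.deltaContact.LocallyConservesEnergy ∧
      D.contactSpeed ∈ Icc D.u₀ D.u₁ ∧
      ∀ μ : ℝ, 0 < μ → IsMinOn (D.initialEnergy L μ) (Icc D.u₀ D.u₁) D.contactSpeed) := by
  open DeltaRiemannData in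
  refine ⟨fun h => satisfiesBackwardEnergyCondition_iff_deltaShock h₀ h₁ hξ h hL, fun h =>
    ⟨satisfiesBackwardEnergyCondition_iff_deltaContact h₀ h₁ hξ hL h,
      deltaContact_locallyConservesEnergy h₀ h₁ hξ h, contactSpeed_mem h, fun μ hμ => ?_⟩⟩
  exact isMinOn_iff.2 fun w hw => initialEnergy_mono hξ hμ L (contactSpeed_sq_le h hw).1
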